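/- **Corollary (A solution of the main problem).** Let $n\ge 1$, $r\ge 0$, and let $Y$ be a smooth manifold of dimension $n+1$ with boundary $\partial Y$. A submanifold $L\subseteq Y$ of dimension $n$ is *admissible* if it is compact, connected and oriented, $\partial L=L\cap\partial Y$, and $L$ is nowhere tangent to $\partial Y$. Let $\lambda$ be a Lagrangian of order $r$ on $Y$, i.e. a horizontal $n$-form on the bundle of $r$-jets of $n$-dimensional submanifolds of $Y$; in local coordinates $(\boldsymbol x,u)=(x^1,\dots,x^n,u)$ it reads $\lambda=\mathcal L(\boldsymbol x,u,u_I)\,d^n\boldsymbol x$ with $\mathcal L$ smooth and $|I|\le r$. Let the action be $S_\lambda[L]=\int_L (j^rL)^*\lambda$, and let $L$ be a solution of the variational problem with free boundary values, i.e. an admissible submanifold such that $\frac{d}{dt}\big|_{t=0}S_\lambda[L_t]=0$ for every smooth one-parameter family $L_t$ of admissible submanifolds with $L_0=L$. In every smooth coordinate system $(\boldsymbol x,u)$ of $Y$ (where $\partial Y=\{x^n=0\}$ if the system meets $\partial Y$) let $D_i$ be the total derivatives on the infinite jet space with coordinates $(\boldsymbol x,u_I)$. Let $K(Y,\partial Y)$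 be the space of total differential operators $\square=\sum_I a^ID_I$ with smooth coefficients (functions of finite order), modulo the operators $\sum_i D_i\circ\square^i$ such that the coefficients of $\square^n$ vanish on $\{x^n=0\}$. The part $\{x^n=0\}$ of the infinite jet space is identified with the infinite jets, over $\partial Y$, of the pro-finite bundle with fibre coordinates $\nu^\alpha=\partial^\alpha u/\partial (x^n)^\alpha$, $\alpha=0,1,2,\dots$; let $\omega^\alpha=d\nu^\alpha-\sum_{i<n}\nu^\alpha_{1_i}dx^i$ be its zero-order contact forms, where $1_i$ is the multi-index with entry $1$ at place $i$, and put $d^{n-1}\boldsymbol x=dx^1\wedge\dots\wedge dx^{n-1}$. The class of the operator $E+\sum_\alpha D_n\circ b_\alpha\circ D_n^\alpha$ in $K(Y,\partial Y)$ is identified with the pair $\big(E,\ \sum_\alpha b_\alpha|_{x^n=0}\,\omega^\alpha\wedge d^{n-1}\boldsymbol x\big)$. The *relative Euler class* of $\lambda$ is the class of $\sum_{|I|\le r}\frac{\partial\mathcal L}{\partial u_I}D_I$, and $\boldsymbol E^\partial_Y(\lambda)$ denotes its second (boundary) component. Then, in every such coordinate system, the boundary component $\boldsymbol E^\partial_Y(\lambda)$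 exists and is unique, and: 1. at every point of $\partial L$ near which $L$ is the graph of a smooth function $u=u(\boldsymbol x)$ in these coordinates, the natural boundary conditions $\boldsymbol E^\partial_Y(\lambda)=0$ hold, i.e. $\boldsymbol E^\partial_Y(\lambda)$ vanishes at the infinite jet of $L$ at that point; 2. $\boldsymbol E^\partial_Y(\lambda)=\sum_{\alpha<r}\boldsymbol E^\partial_{Y,\alpha}(\lambda)\,\omega^\alpha\wedge d^{n-1}\boldsymbol x$, and where $L$ is locally the graph of $u=u(\boldsymbol x)$ over $\Omega\subseteq\{x^n\ge 0\}$, with $\partial\Omega=\Omega\cap\{x^n=0\}$, the components along $\partial L$ are, for $0\le\alpha<r$, $$\boldsymbol E^\partial_{Y,\alpha}(\lambda)=\sum_{|I|\le r,\ i_n>\alpha}(-1)^{|I|-\alpha-1}\,\frac{d^{\,|I|-i_n}}{dx^{I-i_n}}\left(\left.\frac{d^{\,i_n-\alpha-1}}{d(x^n)^{i_n-\alpha-1}}\left(\frac{\partial\mathcal L}{\partial u_I}\right)\right|_{\partial\Omega}\right),$$ where $I=(i_1,\dots,i_n)$, $I-i_n=(i_1,\dots,i_{n-1},0)$, and $\partial\mathcal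 L/\partial u_I$ is evaluated along the jets of $u(\boldsymbol x)$ before differentiating. -/

import Mathlib

open Set Filter Topology Manifold
open scoped ContDiff

noncomputable section

namespace FreeBoundary

/-! Conventions. The number of independent variables is `n = m + 1`, the number of tangential
ones is `m`. Charts of `Y` take values in the half-space of dimension `n + 1 = m + 2`, whose
boundary is the zero set of the coordinate with index `0`. Hence the independent variable
"normal to the boundary" is `x 0`, the tangential ones are `x i.succ`, and the dependent
variable `u` is the last coordinate. -/

/-! ### Multi-indices and iterated derivatives -/

/-- Multi-indices in `k` variables. -/
abbrev MIdx (k : ℕ) : Type := Fin k → ℕ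

/-- The length `|I|`. -/
def mlen {k : ℕ} (I : MIdx k) : ℕ := ∑ i, I i

/-- All multi-indices of length at most `r`. -/
def midxLE (k r : ℕ) : Finset (MIdx k) :=
  (Fintype.piFinset fun _ => Finset.range (r + 1)).filter fun I => mlen I ≤ r

/-- `D_I = D_0 ^ I_0 ∘ D_1 ^ I_1 ∘ ⋯` for a family of operators `D_i`. -/
def multiIter {k : ℕ} {A : Type*} (D : Fin k → A → A) (I : MIdx k) (a : A) : A :=
  (List.finRange k).foldr (fun i b => (D i)^[I i] b) a

/-- The closed half-space `x 0 ≥ 0` of the independent variables. -/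
def halfSpace (m : ℕ) : Set (Fin (m + 1) → ℝ) := {x | 0 ≤ x 0}

/-- The range of the variable `x i` in the half-space. -/
def axis {m : ℕ} (i : Fin (m + 1)) : Set ℝ := if i = 0 then Ici 0 else univ

/-- Partial derivative `∂ f / ∂ x_i` on the half-space (one-sided in the normal direction at
boundary points). -/
def pdHalf {m : ℕ} (i : Fin (m + 1)) (f : (Fin (m + 1) → ℝ) → ℝ) : (Fin (m + 1) → ℝ) → ℝ :=
  fun x => derivWithin (fun s => f (Function.update x i s)) (axis i) (x i)

/-- Partial derivative `∂ g / ∂ x_i` on `ℝ ^ k`. -/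
def pd {k : ℕ} (i : Fin k) (g : (Fin k → ℝ) → ℝ) : (Fin k → ℝ) → ℝ :=
  fun x => deriv (fun s => g (Function.update x i s)) (x i)

/-! ### Infinite jets in local coordinates -/

/-- The infinite jet space with coordinates `x` and `u_I`. -/
abbrev JetSp (m : ℕ) : Type := (Fin (m + 1) → ℝ) × (MIdx (m + 1) → ℝ)

/-- The part of the jet space over a set `D` of points `(x, u)`. -/
def jetDom {m : ℕ} (D : Set ((Fin (m + 1) → ℝ) × ℝ)) : Set (JetSp m) :=
  {z | (z.1, z.2 0) ∈ D}

/-- Truncation to the jet space of order `k`. -/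
def trunc (m k : ℕ) (z : JetSp m) : (Fin (m + 1) → ℝ) × (midxLE (m + 1) k → ℝ) :=
  (z.1, fun I => z.2 I)

/-- `F` is a smooth function of the coordinates `x` and `u_I`, `|I| ≤ k`, over `D`. -/
def SmoothOfOrder {m : ℕ} (D : Set ((Fin (m + 1) → ℝ) × ℝ)) (k : ℕ) (F : JetSp m → ℝ) : Prop :=
  ∃ g : (Fin (m + 1) → ℝ) × (midxLE (m + 1) k → ℝ) → ℝ,
    ContDiffOn ℝ ∞ g (trunc m k '' jetDom D) ∧ ∀ z ∈ jetDom D, F z = g (trunc m k z)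

/-- The smooth functions on the infinite jet space over `D`: those of some finite order. -/
def JetSmooth {m : ℕ} (D : Set ((Fin (m + 1) → ℝ) × ℝ)) (F : JetSp m → ℝ) : Prop :=
  ∃ k, SmoothOfOrder D k F

/-- `∂ F / ∂ u_I`. -/
def pdU {m : ℕ} (I : MIdx (m + 1)) (F : JetSp m → ℝ) : JetSp m → ℝ :=
  fun z => deriv (fun s => F (z.1, Function.update z.2 I s)) (z.2 I)

/-- The total derivative `D_i = ∂ / ∂ x_i + ∑_I u_{I + 1_i} ∂ / ∂ u_I`. -/
def totalD {m : ℕ} (i : Fin (m + 1)) (F : JetSp m → ℝ) : JetSp m → ℝ :=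
  fun z => derivWithin (fun s => F (Function.update z.1 i s, z.2)) (axis i) (z.1 i) +
    ∑ᶠ I : MIdx (m + 1), z.2 (I + Pi.single i 1) * pdU I F z

/-- The infinite prolongation of a function of the independent variables. -/
def prolong {m : ℕ} (f : (Fin (m + 1) → ℝ) → ℝ) (x : Fin (m + 1) → ℝ) : JetSp m :=
  (x, fun I => multiIter pdHalf I f x)

/-! ### Total differential operators and the relative Spencer coboundaries -/

/-- A total differential operator `∑_{|I| ≤ order} coeff I • D_I` with smooth coefficients. -/
structure TotalDiffOp {m : ℕ} (D : Set ((Fin (m + 1) → ℝ) × ℝ)) where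
  order : ℕ
  coeff : MIdx (m + 1) → JetSp m → ℝ
  smooth : ∀ I, JetSmooth D (coeff I)

/-- The action of a total differential operator on functions. -/
def TotalDiffOp.app {m : ℕ} {D : Set ((Fin (m + 1) → ℝ) × ℝ)} (P : TotalDiffOp D)
    (F : JetSp m → ℝ) : JetSp m → ℝ :=
  fun z => ∑ I ∈ midxLE (m + 1) P.order, P.coeff I z * multiIter totalD I F z

/-- Two operators `P`, `Q` (with values in horizontal `n`-forms, written as multiples of `dⁿx`)
define the same element of
`K(Y, ∂Y) = 𝒟(κ(Y), Ω_hⁿ) / δ (𝒟(κ(Y), Ω_hⁿ⁻¹(G, ∂G)))` over `D`. An operator with values in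
horizontal `(n-1)`-forms is a tuple `R` of operators (its components along the forms `∂_i ⌟ dⁿx`),
its Spencer differential is `∑ᵢ D_i ∘ R i`, and it takes values in relative forms (those which
vanish on the boundary `x 0 = 0`) when the coefficients of the normal component `R 0` vanish
there. -/
def SameRelClass {m : ℕ} (D : Set ((Fin (m + 1) → ℝ) × ℝ))
    (P Q : (JetSp m → ℝ) → JetSp m → ℝ) : Prop :=
  ∃ R : Fin (m + 1) → TotalDiffOp D,
    (∀ I, ∀ z ∈ jetDom D, z.1 0 = 0 → (R 0).coeff I z = 0) ∧
    ∀ F, JetSmooth D F → ∀ z ∈ jetDom D,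
      P F z - Q F z = ∑ i, totalD i ((R i).app F) z

/-- The linearization `ℓ = ∑_{|I| ≤ r} (∂ 𝓛 / ∂ u_I) D_I` of a function of order `r`. -/
def linearization {m : ℕ} (r : ℕ) (𝓛 : JetSp m → ℝ) (F : JetSp m → ℝ) : JetSp m → ℝ :=
  fun z => ∑ I ∈ midxLE (m + 1) r, pdU I 𝓛 z * multiIter totalD I F z

/-! ### The boundary: infinite jets of the bundle of normal derivatives -/

/-- The infinite jet space of the pro-finite bundle over the boundary whose fibre coordinates are
`ν^α` (`α = 0, 1, 2, …`; `ν^α` stands for the `α`-th normal derivative of `u`, and `ν^0 = u`):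
coordinates `x' = (x'_i)` and `ν^α_J`, `J` a multi-index in the `m` tangential variables. -/
abbrev NormalJet (m : ℕ) : Type := (Fin m → ℝ) × (ℕ → MIdx m → ℝ)

/-- The identification of `NormalJet m` with the boundary `x 0 = 0` of the infinite jet space:
`u_I = ν^{I_0}_{(I_1, …, I_m)}`. -/
def ofNormalJet {m : ℕ} (w : NormalJet m) : JetSp m :=
  (Fin.cons 0 w.1, fun I => w.2 (I 0) (Fin.tail I))

/-- The infinite jet at `x'` of the section `ν^α (x') = (∂^α f / ∂ x_0^α) (0, x')` of normal
derivatives of `f` along the boundary. -/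
def boundaryJet {m : ℕ} (f : (Fin (m + 1) → ℝ) → ℝ) (x' : Fin m → ℝ) : NormalJet m :=
  (x', fun α J => multiIter pd J
    (fun t : Fin m → ℝ => (pdHalf 0)^[α] f (Fin.cons 0 t)) x')

/-- Tangent vectors of `NormalJet m`. -/
abbrev NormalJetTangent (m : ℕ) : Type := (Fin m → ℝ) × (ℕ → MIdx m → ℝ)

/-- The zero-order contact form `ω^α = dν^α - ∑_i ν^α_{1_i} dx'_i` at `w`. -/
def contactForm {m : ℕ} (α : ℕ) (w : NormalJet m) : NormalJetTangent m →ₗ[ℝ] ℝ where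
  toFun v := v.2 α 0 - ∑ i, w.2 α (Pi.single i 1) * v.1 i
  map_add' v v' := by
    simp only [Prod.fst_add, Prod.snd_add, Pi.add_apply, mul_add, Finset.sum_add_distrib]
    ring
  map_smul' a v := by
    simp only [Prod.smul_fst, Prod.smul_snd, Pi.smul_apply, smul_eq_mul, RingHom.id_apply,
      mul_sub, Finset.mul_sum]
    congr 1
    exact Finset.sum_congr rfl fun i _ => by ring

/-- The `n`-form `ω^α ∧ dx'_1 ∧ ⋯ ∧ dx'_m` at `w`. -/
def contactTop {m : ℕ} (α : ℕ) (w : NormalJet m) :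
    NormalJetTangent m [⋀^Fin (m + 1)]→ₗ[ℝ] ℝ :=
  Matrix.detRowAlternating.compLinearMap
    (LinearMap.pi (Fin.cons (contactForm α w)
      (fun i : Fin m => (LinearMap.proj i).comp (LinearMap.fst ℝ _ _))))

/-- The relative Euler class of `𝓛 dⁿx` over `D`, i.e. the class of the linearization in
`K(Y, ∂Y)`, is identified with the pair `(E, η)`. Here `E` is the coefficient of the
interior (Euler-Lagrange) component and `η` is the boundary component: an `n`-form on the jets over
the boundary in the module generated by the forms `ω^α ∧ dx'_1 ∧ ⋯ ∧ dx'_m`.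
The pair `(E, ∑ b_α ω^α ∧ dx'_1 ∧ ⋯ ∧ dx'_m)` is the class of the operator
`E + ∑_α D_0 ∘ b_α ∘ D_0^α`, where only the values of the `b_α` on the boundary matter. -/
def IsRelEuler {m : ℕ} (D : Set ((Fin (m + 1) → ℝ) × ℝ)) (r : ℕ) (𝓛 : JetSp m → ℝ)
    (E : JetSp m → ℝ) (η : NormalJet m → NormalJetTangent m [⋀^Fin (m + 1)]→ₗ[ℝ] ℝ) : Prop :=
  JetSmooth D E ∧
  ∃ (k : ℕ) (b : ℕ → JetSp m → ℝ), (∀ α, JetSmooth D (b α)) ∧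
    SameRelClass D (linearization r 𝓛)
      (fun F z => E z * F z +
        ∑ α ∈ Finset.range k, totalD 0 (fun y => b α y * (totalD 0)^[α] F y) z) ∧
    ∀ w, ofNormalJet w ∈ jetDom D →
      η w = ∑ α ∈ Finset.range k, b α (ofNormalJet w) • contactTop α w

/-! ### Local coordinates on `Y` and graphs -/

section Manifold

variable {m : ℕ} {Y : Type*} [TopologicalSpace Y] [ChartedSpace (EuclideanHalfSpace (m + 2)) Y]

/-- The independent variables of the coordinate system `φ`. -/
def coordX (φ : OpenPartialHomeomorph Y (EuclideanHalfSpace (m + 2))) (y : Y) : Fin (m + 1) → ℝ :=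
  fun i => (φ y).1 i.castSucc

/-- The dependent variable of the coordinate system `φ`. -/
def coordU (φ : OpenPartialHomeomorph Y (EuclideanHalfSpace (m + 2))) (y : Y) : ℝ :=
  (φ y).1 (Fin.last (m + 1))

/-- The point with coordinates `(x, u)`. -/
def ofCoord (φ : OpenPartialHomeomorph Y (EuclideanHalfSpace (m + 2)))
    (x : Fin (m + 1) → ℝ) (u : ℝ) : Y :=
  (φ.extend (𝓡∂ (m + 2))).symm (WithLp.toLp 2 (Fin.snoc (α := fun _ => ℝ) x u))

/-- The range of the coordinate system `φ`. -/
def chartDom (φ : OpenPartialHomeomorph Y (EuclideanHalfSpace (m + 2))) :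
    Set ((Fin (m + 1) → ℝ) × ℝ) :=
  (fun y => (coordX φ y, coordU φ y)) '' φ.source

/-- Near its point `y` the set `L` is, in the smooth coordinate system `φ` of `Y`, the graph
`u = f x` of a function which is smooth up to the boundary. -/
def IsGraphNear (φ : OpenPartialHomeomorph Y (EuclideanHalfSpace (m + 2)))
    (f : (Fin (m + 1) → ℝ) → ℝ) (L : Set Y) (y : Y) : Prop :=
  φ ∈ IsManifold.maximalAtlas (𝓡∂ (m + 2)) ∞ Y ∧ y ∈ φ.source ∧ y ∈ L ∧
  (∃ W ∈ 𝓝 (coordX φ y), ContDiffOn ℝ ∞ f (W ∩ halfSpace m)) ∧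
  ∀ᶠ q in 𝓝 y, (q ∈ L ↔ coordU φ q = f (coordX φ q))

variable (m Y) in
/-- A Lagrangian of order `r` on `Y`: a horizontal `n`-form on the bundle of `r`-jets of
`n`-dimensional submanifolds of `Y`, given by its expressions `coeff φ (x, u, u_I) dⁿx` in all smooth
coordinate systems, which are smooth in `x`, `u`, `u_I` (`|I| ≤ r`) and agree on the `r`-jets of
every submanifold that is a graph in two coordinate systems. (Over boundary points only the jets
that are not tangent to `∂Y` are graphs; nothing is required at the others.) -/
structure Lagrangian (r : ℕ) where
  coeff : OpenPartialHomeomorph Y (EuclideanHalfSpace (m + 2)) → JetSp m → ℝ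
  smooth : ∀ φ ∈ IsManifold.maximalAtlas (𝓡∂ (m + 2)) ∞ Y,
    SmoothOfOrder (chartDom φ) r (coeff φ)
  compat : ∀ φ ψ f g (L : Set Y) y, IsGraphNear φ f L y → IsGraphNear ψ g L y →
    coeff φ (prolong f (coordX φ y)) = coeff ψ (prolong g (coordX ψ y)) *
      Matrix.det (Matrix.of fun i j =>
        pdHalf j (fun x => coordX ψ (ofCoord φ x (f x)) i) (coordX φ y))

variable {M : Type*} [TopologicalSpace M] [ChartedSpace (EuclideanHalfSpace (m + 1)) M]

variable (m M) in
/-- Fields of alternating `n`-forms on the `n`-dimensional manifold `M`. -/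
abbrev TopForm : Type _ :=
  ∀ p : M, (TangentSpace (𝓡∂ (m + 1)) p) [⋀^Fin (m + 1)]→ₗ[ℝ] ℝ

/-- The coefficient `w` of an `n`-form `θ = w dⁿs` in the chart of `M` at `c`, as a function of
the coordinates `s`. -/
def formCoeff (θ : TopForm m M) (c : M) (s : EuclideanSpace ℝ (Fin (m + 1))) : ℝ :=
  θ ((extChartAt (𝓡∂ (m + 1)) c).symm s) fun i =>
    mfderivWithin 𝓘(ℝ, EuclideanSpace ℝ (Fin (m + 1))) (𝓡∂ (m + 1))
      (extChartAt (𝓡∂ (m + 1)) c).symm (range (𝓡∂ (m + 1))) s (EuclideanSpace.single i (1 : ℝ))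

variable (m M) in
/-- An orientation of `M`, given by a continuous nowhere vanishing `n`-form. -/
structure OrientForm where
  form : TopForm m M
  ne_zero : ∀ p, form p ≠ 0
  cont : ∀ c : M, ContinuousOn (formCoeff form c) (extChartAt (𝓡∂ (m + 1)) c).target

/-- The integral of an `n`-form over a compact oriented manifold, by means of a partition of unity
subordinate to the charts; only the sign of the orienting form matters. -/
def formIntegral [IsManifold (𝓡∂ (m + 1)) ∞ M] [T2Space M] [CompactSpace M]
    (o : OrientForm m M) (θ : TopForm m M) : ℝ :=
  let ρ : SmoothPartitionOfUnity M (𝓡∂ (m + 1)) M univ :=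
    (SmoothPartitionOfUnity.exists_isSubordinate_chartAt_source (𝓡∂ (m + 1)) M).choose
  ∑ᶠ c : M, ∫ s in (extChartAt (𝓡∂ (m + 1)) c).target,
    ρ c ((extChartAt (𝓡∂ (m + 1)) c).symm s) *
      (SignType.sign (formCoeff o.form c s) : ℝ) * formCoeff θ c s

/-- `ι : M → Y` parametrizes an admissible submanifold `L = ι(M)`: it is a smooth embedding (for
compact `M` this is a smooth injective immersion), `∂L = L ∩ ∂Y`, and `L` is nowhere tangent to
`∂Y`. The tangent space of `∂Y` at a boundary point consists of the vectors whose coordinate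
with index `0` vanishes. -/
structure IsAdmissible (ι : M → Y) : Prop where
  smooth : ContMDiff (𝓡∂ (m + 1)) (𝓡∂ (m + 2)) ∞ ι
  injective : Function.Injective ι
  immersion : ∀ p, Function.Injective (mfderiv (𝓡∂ (m + 1)) (𝓡∂ (m + 2)) ι p)
  boundary : ∀ p, p ∈ (𝓡∂ (m + 1)).boundary M ↔ ι p ∈ (𝓡∂ (m + 2)).boundary Y
  not_tangent : ∀ p ∈ (𝓡∂ (m + 1)).boundary M, ∃ v : TangentSpace (𝓡∂ (m + 1)) p,
    (show EuclideanSpace ℝ (Fin (m + 2)) from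
      mfderiv (𝓡∂ (m + 1)) (𝓡∂ (m + 2)) ι p v) 0 ≠ 0

open Classical in
/-- The pull-back to `M` of a Lagrangian along the `r`-jet prolongation of `ι`: at `p` it is
`𝓛 (x, f, ∂f) dx_0 ∧ ⋯ ∧ dx_m`, pulled back, in any coordinate system in which `L = ι(M)` is a graph
`u = f x` near `ι p` (the compatibility of the local expressions makes the choice irrelevant). -/
def pullbackForm {r : ℕ} (lam : Lagrangian m Y r) (ι : M → Y) : TopForm m M := fun p =>
  if h : ∃ c : OpenPartialHomeomorph Y (EuclideanHalfSpace (m + 2)) × ((Fin (m + 1) → ℝ) → ℝ),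
      IsGraphNear c.1 c.2 (range ι) (ι p) then
    lam.coeff h.choose.1 (prolong h.choose.2 (coordX h.choose.1 (ι p))) •
      (Matrix.detRowAlternating (R := ℝ) (n := Fin (m + 1))).compLinearMap
        (mfderiv (𝓡∂ (m + 1)) 𝓘(ℝ, Fin (m + 1) → ℝ)
          (fun q => coordX h.choose.1 (ι q)) p).toLinearMap
  else 0

/-- The action `S[L] = ∫_L (j^r L)^* λ`. -/
def action [IsManifold (𝓡∂ (m + 1)) ∞ M] [T2Space M] [CompactSpace M] {r : ℕ}
    (lam : Lagrangian m Y r) (o : OrientForm m M) (ι : M → Y) : ℝ :=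
  formIntegral o (pullbackForm lam ι)

/-- `L = ι(M)` is a solution of the variational problem with free boundary values: it is admissible
and the action is stationary at `L` along every smooth one-parameter family of admissible
submanifolds through `L`. -/
def IsSolution [IsManifold (𝓡∂ (m + 1)) ∞ M] [T2Space M] [CompactSpace M] {r : ℕ}
    (lam : Lagrangian m Y r) (o : OrientForm m M) (ι : M → Y) : Prop :=
  IsAdmissible (m := m) ι ∧
  ∀ (ε : ℝ) (F : ℝ → M → Y), 0 < ε → F 0 = ι →
    ContMDiffOn (𝓘(ℝ, ℝ).prod (𝓡∂ (m + 1))) (𝓡∂ (m + 2)) ∞ (fun q : ℝ × M => F q.1 q.2)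
      (Ioo (-ε) ε ×ˢ univ) →
    (∀ t ∈ Ioo (-ε) ε, IsAdmissible (m := m) (F t)) →
    HasDerivAt (fun t => action lam o (F t)) 0 0

end Manifold

/-- The expression
`∑_{|I| ≤ r, I_0 > α} (-1)^(|I|-α-1) ∂_{I'} ( ∂_0^{I_0-α-1} (∂𝓛/∂u_I) restricted to x_0 = 0 )`
at the boundary point `x'`, where `I' = (I_1, …, I_m)` and `∂𝓛/∂u_I` is evaluated along the
jets of `f`. -/
def boundaryExpr {m : ℕ} (r α : ℕ) (𝓛 : JetSp m → ℝ) (f : (Fin (m + 1) → ℝ) → ℝ)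
    (x' : Fin m → ℝ) : ℝ :=
  ∑ I ∈ (midxLE (m + 1) r).filter (fun I => α < I 0),
    (-1 : ℝ) ^ (mlen I - α - 1) *
      multiIter pd (Fin.tail I)
        (fun t : Fin m → ℝ =>
          (pdHalf 0)^[I 0 - α - 1] (fun x => pdU I 𝓛 (prolong f x)) (Fin.cons 0 t)) x'

end FreeBoundary

end

/-!
The linearization of the Lagrangian is `ℓ = ∑ (∂𝓛/∂u_I) D_I`, and total derivatives commute, so that
`D_I = D_{I'} ∘ D_0 ^ I_0`, where `I'` is the tangential part of `I`.

*Existence and formula.* Moving `D_{I'}` to the coefficient by parts changes an operator by a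
coboundary without normal component (`isTangCob_tanD`), hence does not change its class in
`K(Y, ∂Y)`. Integrating `D_0 ^ I_0` by parts as well (`mul_iterate_totalD`) leaves the Euler-Lagrange
expression and terms `D_0 ∘ b_α ∘ D_0 ^ α` with explicit coefficients `b_α`
(`sameRelClass_linearization`). Jets of the normal derivatives of `u` along the boundary are the
boundary values of the jets of `u` (`ofNormalJet_boundaryJet`), and total derivatives turn into
partial derivatives along the jets of a function; this makes the coefficients `b_α` the stated
expressions in `u` (`bdryCoeff_prolong`).

*Uniqueness.* Every finite jet is the jet of a polynomial, so it is enough to determine the `b_α`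
along the jets of functions `f`. Applying the operators of a class to a test function `v` and
integrating over a half-cube at a boundary point gives Green's formula
(`SameRelClass.integral_eq`): relative coboundaries integrate to zero, because only the normal
component of a divergence reaches the boundary `x_0 = 0` and that of a relative coboundary vanishes
there. The boundary contribution is `-∫ ∑ b_α ∂_0^α v`. Since the normal derivatives of `v` along the
boundary can be prescribed independently of each other, the fundamental lemma of the calculus of
variations (`eq_zero_of_forall_integral`) recovers the `b_α` (`SameRelClass.boundary_unique`).

*Natural boundary conditions.* By the same argument, the `b_α` vanish along the jets of `f` as soon as
`∫ ℓ(v) = 0` for all test functions `v` supported near the boundary point, which need not vanish on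
the boundary (`SameRelClass.eq_zero_of_stationary`). To obtain this from stationarity of the action,
let the submanifold be the graph of `f` near the point (`GraphPatch`, `exists_graphPatch`) and
displace it by `t * v` in the direction of the dependent variable. In a small tube around the graph
(`exists_isTube`) this is a smooth family of admissible submanifolds (`contMDiffOn_variation`,
`isAdmissible_variation`). The change of the action is, up to a nonzero factor that compares
orientations, the change of `∫ 𝓛(x, f, ∂f) dx` (`GraphPatch.exists_action_variation_sub_eq`), whose
derivative at `t = 0` is `∫ ℓ(v)` (`hasDerivAt_integral_prolong`). For the former the difference of
the two pulled-back Lagrangians, which is supported in the displaced piece, has to be integrated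
globally; this requires the integrability of both, hence their continuity, which holds because an
admissible submanifold is a graph in some coordinate system near each of its points
(`IsAdmissible.exists_chart`). At boundary points that is where transversality to `∂Y` enters.
-/


noncomputable section

namespace FreeBoundary

/-! ### Multi-indices and iterated operators -/

theorem multiIter_succ {k : ℕ} {A : Type*} (D : Fin (k + 1) → A → A) (I : MIdx (k + 1)) (a : A) :
    multiIter D I a = (D 0)^[I 0] (multiIter (fun i => D i.succ) (Fin.tail I) a) := by
  simp [multiIter, List.finRange_succ, List.foldr_map, Fin.tail]

theorem multiIter_zero {k : ℕ} {A : Type*} (D : Fin k → A → A) (a : A) :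
    multiIter D 0 a = a := by
  induction k with
  | zero => simp [multiIter]
  | succ k ih =>
    rw [multiIter_succ]
    exact ih _

theorem iterate_rel {A B : Type*} {R : A → B → Prop} {D : A → A} {D' : B → B}
    (h : ∀ a b, R a b → R (D a) (D' b)) (n : ℕ) {a : A} {b : B} (hab : R a b) :
    R (D^[n] a) (D'^[n] b) := by
  induction n with
  | zero => exact hab
  | succ n ih =>
    rw [Function.iterate_succ_apply', Function.iterate_succ_apply']
    exact h _ _ ih

/-- A relation preserved by two families of operators is preserved by their iterates; used for
congruence, for invariance of a class of functions and for intertwining. -/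
theorem multiIter_rel {k : ℕ} {A B : Type*} {R : A → B → Prop} {D : Fin k → A → A}
    {D' : Fin k → B → B} (h : ∀ i a b, R a b → R (D i a) (D' i b)) (I : MIdx k) {a : A} {b : B}
    (hab : R a b) : R (multiIter D I a) (multiIter D' I b) := by
  induction k with
  | zero => simpa [multiIter] using hab
  | succ k ih =>
    rw [multiIter_succ, multiIter_succ]
    exact iterate_rel (h 0) _ (ih (fun i => h i.succ) _)

theorem multiIter_pred {k : ℕ} {A : Type*} {P : A → Prop} {D : Fin k → A → A}
    (h : ∀ i a, P a → P (D i a)) (I : MIdx k) {a : A} (ha : P a) : P (multiIter D I a) :=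
  multiIter_rel (R := fun a _ => P a) (B := A) (D' := D) (fun i a _ => h i a) I (b := a) ha

theorem iterate_comm_rel {A : Type*} {R : A → A → Prop} (hR : Equivalence R) {P : A → Prop}
    {D D' : A → A} (hP : ∀ a, P a → P (D a)) (hP' : ∀ a, P a → P (D' a))
    (hD : ∀ a b, P a → P b → R a b → R (D a) (D b))
    (hc : ∀ a, P a → R (D (D' a)) (D' (D a))) (n : ℕ) {a : A} (ha : P a) :
    R (D^[n] (D' a)) (D' (D^[n] a)) := by
  have hPn : ∀ n {a}, P a → P (D^[n] a) := fun n a ha => by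
    induction n with
    | zero => exact ha
    | succ n ih => rw [Function.iterate_succ_apply']; exact hP _ ih
  induction n with
  | zero => exact hR.refl _
  | succ n ih =>
    rw [Function.iterate_succ_apply', Function.iterate_succ_apply']
    exact hR.trans (hD _ _ (hPn n (hP' _ ha)) (hP' _ (hPn n ha)) ih) (hc _ (hPn n ha))

/-- For operators which commute up to an equivalence relation, on a class `P` which they
preserve, `D_{I + 1_i}` is `D_i ∘ D_I` up to this relation. -/
theorem multiIter_add_single {k : ℕ} {A : Type*} {R : A → A → Prop} (hR : Equivalence R)
    {P : A → Prop} {D : Fin k → A → A} (hP : ∀ i a, P a → P (D i a))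
    (hD : ∀ i a b, P a → P b → R a b → R (D i a) (D i b))
    (hc : ∀ i j a, P a → R (D i (D j a)) (D j (D i a))) (I : MIdx k) (i : Fin k) {a : A}
    (ha : P a) : R (multiIter D (I + Pi.single i 1) a) (D i (multiIter D I a)) := by
  induction k with
  | zero => exact i.elim0
  | succ k ih =>
    rw [multiIter_succ, multiIter_succ]
    have hPm : ∀ J, P (multiIter (fun i => D i.succ) J a) := fun J =>
      multiIter_pred (fun i => hP i.succ) J ha
    have key : ∀ n {b c}, P b → P c → R b c → R ((D 0)^[n] b) ((D 0)^[n] c) := by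
      intro n b c hb hc' h
      exact (iterate_rel (R := fun b c => P b ∧ P c ∧ R b c)
        (fun b c h => ⟨hP _ _ h.1, hP _ _ h.2.1, hD _ _ _ h.1 h.2.1 h.2.2⟩) n ⟨hb, hc', h⟩).2.2
    refine Fin.cases ?_ (fun j => ?_) i
    · have h1 : Fin.tail (I + Pi.single 0 1) = Fin.tail I := by
        funext j; simp [Fin.tail]
      rw [h1]
      simp only [Pi.add_apply, Pi.single_eq_same, Function.iterate_succ_apply']
      exact hR.refl _
    · have h1 : Fin.tail (I + Pi.single j.succ 1) = Fin.tail I + Pi.single j 1 := by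
        funext l
        simp [Fin.tail, Pi.single_apply]
      have h2 : (I + Pi.single j.succ 1 : MIdx (k + 1)) 0 = I 0 := by simp
      rw [h1, h2]
      refine hR.trans (key _ (hPm _) (hP _ _ (hPm _)) (ih (D := fun i => D i.succ)
        (fun i => hP i.succ) (fun i => hD i.succ) (fun i j => hc i.succ j.succ) (Fin.tail I) j)) ?_
      exact iterate_comm_rel hR (hP 0) (hP j.succ) (hD 0) (fun a ha => hc 0 j.succ a ha) _ (hPm _)

/-- An operator which commutes with each `D_i` commutes with `D_I`. -/
theorem comm_multiIter_rel {k : ℕ} {A : Type*} {R : A → A → Prop} (hR : Equivalence R)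
    {P : A → Prop} {D : Fin k → A → A} {T : A → A} (hP : ∀ i a, P a → P (D i a))
    (hPT : ∀ a, P a → P (T a)) (hD : ∀ i a b, P a → P b → R a b → R (D i a) (D i b))
    (hc : ∀ i a, P a → R (T (D i a)) (D i (T a))) (I : MIdx k) {a : A} (ha : P a) :
    R (T (multiIter D I a)) (multiIter D I (T a)) := by
  induction k with
  | zero => simpa [multiIter] using hR.refl _
  | succ k ih =>
    rw [multiIter_succ, multiIter_succ]
    have hPm : ∀ {b}, P b → P (multiIter (fun i => D i.succ) (Fin.tail I) b) := fun hb =>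
      multiIter_pred (fun i => hP i.succ) _ hb
    have h1 := iterate_comm_rel hR (hP 0) hPT (hD 0) (fun b hb => hR.symm (hc 0 b hb)) (I 0)
      (hPm ha)
    have h2 := ih (D := fun i => D i.succ) (fun i => hP i.succ) (fun i => hD i.succ)
      (fun i => hc i.succ) (Fin.tail I)
    refine hR.trans (hR.symm h1) ?_
    exact (iterate_rel (R := fun b c => P b ∧ P c ∧ R b c)
      (fun b c h => ⟨hP _ _ h.1, hP _ _ h.2.1, hD _ _ _ h.1 h.2.1 h.2.2⟩) (I 0)
      ⟨hPT _ (hPm ha), hPm (hPT _ ha), h2⟩).2.2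

theorem mlen_zero {k : ℕ} : mlen (0 : MIdx k) = 0 := by simp [mlen]

theorem mlen_add {k : ℕ} (I J : MIdx k) : mlen (I + J) = mlen I + mlen J := by
  simp [mlen, Finset.sum_add_distrib]

theorem mlen_single {k : ℕ} (i : Fin k) : mlen (Pi.single i 1 : MIdx k) = 1 := by
  simp [mlen]

theorem mlen_succ {k : ℕ} (I : MIdx (k + 1)) : mlen I = I 0 + mlen (Fin.tail I) := by
  simp [mlen, Fin.sum_univ_succ, Fin.tail]

theorem le_mlen {k : ℕ} (I : MIdx k) (i : Fin k) : I i ≤ mlen I :=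
  Finset.single_le_sum (f := I) (fun _ _ => Nat.zero_le _) (Finset.mem_univ i)

theorem mem_midxLE {k r : ℕ} {I : MIdx k} : I ∈ midxLE k r ↔ mlen I ≤ r := by
  simp only [midxLE, Finset.mem_filter, Fintype.mem_piFinset, Finset.mem_range,
    and_iff_right_iff_imp]
  exact fun h i => Nat.lt_succ_of_le ((le_mlen I i).trans h)

theorem zero_mem_midxLE {k r : ℕ} : (0 : MIdx k) ∈ midxLE k r :=
  mem_midxLE.2 (by simp [mlen_zero])

theorem midx_induction {k : ℕ} {p : MIdx k → Prop} (h0 : p 0)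
    (hs : ∀ I i, p I → p (I + Pi.single i 1)) (I : MIdx k) : p I := by
  induction hn : mlen I generalizing I with
  | zero =>
    have : I = 0 := by
      funext i
      have := le_mlen I i
      simp only [Pi.zero_apply]
      omega
    rwa [this]
  | succ n ih =>
    obtain ⟨i, hi⟩ : ∃ i, I i ≠ 0 := by
      by_contra! h
      have : I = 0 := funext h
      rw [this, mlen_zero] at hn
      omega
    have hI : I = (I - Pi.single i 1) + Pi.single i 1 := by
      funext j
      rcases eq_or_ne j i with rfl | h
      · simp only [Pi.add_apply, Pi.sub_apply, Pi.single_eq_same]; omega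
      · simp [h]
    rw [hI]
    apply hs
    apply ih
    have := congrArg mlen hI
    rw [mlen_add, mlen_single] at this
    omega

/-! ### Calculus on the half-space -/

section HalfSpace

variable {m : ℕ} {W : Set (Fin (m + 1) → ℝ)}

theorem convex_halfSpace : Convex ℝ (halfSpace m) := fun x hx y hy a b ha hb _ => by
  have hx' : 0 ≤ x 0 := hx
  have hy' : 0 ≤ y 0 := hy
  change 0 ≤ a * x 0 + b * y 0
  positivity

theorem isClosed_halfSpace : IsClosed (halfSpace m) :=
  isClosed_le continuous_const (continuous_apply 0)

theorem isOpen_pos : IsOpen {x : Fin (m + 1) → ℝ | 0 < x 0} :=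
  isOpen_lt continuous_const (continuous_apply 0)

theorem pos_subset_interior : {x : Fin (m + 1) → ℝ | 0 < x 0} ⊆ interior (halfSpace m) :=
  interior_maximal (fun x (hx : 0 < x 0) => show 0 ≤ x 0 from hx.le) isOpen_pos

theorem interior_halfSpace_nonempty : (interior (halfSpace m)).Nonempty :=
  ⟨fun _ => 1, pos_subset_interior (by simp)⟩

theorem uniqueDiffOn_halfSpace : UniqueDiffOn ℝ (halfSpace m) :=
  uniqueDiffOn_convex convex_halfSpace interior_halfSpace_nonempty

theorem uniqueDiffOn_inter_halfSpace (hW : IsOpen W) : UniqueDiffOn ℝ (W ∩ halfSpace m) := by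
  rw [inter_comm]
  exact uniqueDiffOn_halfSpace.inter hW

theorem halfSpace_subset_closure_interior : halfSpace m ⊆ closure (interior (halfSpace m)) := by
  rw [convex_halfSpace.closure_interior_eq_closure_of_nonempty_interior
    interior_halfSpace_nonempty]
  exact subset_closure

theorem uniqueDiffWithinAt_axis (i : Fin (m + 1)) {s : ℝ} (hs : s ∈ axis i) :
    UniqueDiffWithinAt ℝ (axis i) s := by
  unfold axis at *
  split_ifs at *
  · exact uniqueDiffOn_Ici 0 s hs
  · exact uniqueDiffWithinAt_univ

theorem mem_axis {x : Fin (m + 1) → ℝ} (hx : x ∈ halfSpace m) (i : Fin (m + 1)) :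
    x i ∈ axis i := by
  unfold axis
  split_ifs with h
  · subst h; exact hx
  · trivial

theorem update_mem_halfSpace {x : Fin (m + 1) → ℝ} (hx : x ∈ halfSpace m) {i : Fin (m + 1)}
    {s : ℝ} (hs : s ∈ axis i) : Function.update x i s ∈ halfSpace m := by
  unfold axis at hs
  change 0 ≤ Function.update x i s 0
  split_ifs at hs with h
  · subst h; simpa using hs
  · rw [Function.update_of_ne (Ne.symm h)]; exact hx

theorem tendsto_update_axis {x : Fin (m + 1) → ℝ} (hx : x ∈ halfSpace m) (i : Fin (m + 1)) :
    Tendsto (fun s => Function.update x i s) (𝓝[axis i] (x i)) (𝓝[halfSpace m] x) := by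
  refine tendsto_nhdsWithin_of_tendsto_nhds_of_eventually_within _ ?_ ?_
  · have : ContinuousAt (fun s => Function.update x i s) (x i) :=
      (continuous_const.update i continuous_id).continuousAt
    have h := this.tendsto
    rw [Function.update_eq_self] at h
    exact h.mono_left nhdsWithin_le_nhds
  · exact eventually_nhdsWithin_of_forall fun s hs => update_mem_halfSpace hx hs

theorem eventually_update_mem (hW : IsOpen W) {x : Fin (m + 1) → ℝ} (hx : x ∈ W ∩ halfSpace m)
    (i : Fin (m + 1)) : ∀ᶠ s in 𝓝[axis i] (x i), Function.update x i s ∈ W ∩ halfSpace m := by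
  have h := tendsto_update_axis hx.2 i
  exact h (inter_comm _ _ ▸ inter_mem_nhdsWithin _ (hW.mem_nhds hx.1))

theorem hasDerivAt_update_self {ι : Type*} [Fintype ι] [DecidableEq ι] (x : ι → ℝ) (i : ι) (s : ℝ) :
    HasDerivAt (fun s => Function.update x i s) (Pi.single i 1) s := by
  rw [hasDerivAt_pi]
  intro j
  rcases eq_or_ne j i with rfl | h
  · simpa using! hasDerivAt_id s
  · simpa [h] using hasDerivAt_const s (x j)

theorem _root_.HasFDerivWithinAt.hasDerivWithinAt_update (hW : IsOpen W)
    {E : Type*} [NormedAddCommGroup E] [NormedSpace ℝ E]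
    {f : (Fin (m + 1) → ℝ) → E} {L : (Fin (m + 1) → ℝ) →L[ℝ] E} {x : Fin (m + 1) → ℝ}
    (hf : HasFDerivWithinAt f L (W ∩ halfSpace m) x) (hx : x ∈ W ∩ halfSpace m)
    (i : Fin (m + 1)) :
    HasDerivWithinAt (fun s => f (Function.update x i s)) (L (Pi.single i 1)) (axis i) (x i) := by
  have hf' : HasFDerivWithinAt f L (halfSpace m) x := by
    rw [inter_comm] at hf
    exact hf.mono_of_mem_nhdsWithin (inter_mem_nhdsWithin _ (hW.mem_nhds hx.1))
  have h1 : HasDerivWithinAt (fun s => Function.update x i s) (Pi.single i 1) (axis i) (x i) :=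
    (hasDerivAt_update_self x i (x i)).hasDerivWithinAt
  have hf'' : HasFDerivWithinAt f L (halfSpace m) (Function.update x i (x i)) := by
    rwa [Function.update_eq_self]
  exact hf''.comp_hasDerivWithinAt (x i) h1 (fun s hs => update_mem_halfSpace hx.2 hs)

theorem _root_.HasFDerivWithinAt.pdHalf_eq (hW : IsOpen W)
    {f : (Fin (m + 1) → ℝ) → ℝ} {L : (Fin (m + 1) → ℝ) →L[ℝ] ℝ} {x : Fin (m + 1) → ℝ}
    (hf : HasFDerivWithinAt f L (W ∩ halfSpace m) x) (hx : x ∈ W ∩ halfSpace m)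
    (i : Fin (m + 1)) : pdHalf i f x = L (Pi.single i 1) :=
  (hf.hasDerivWithinAt_update hW hx i).derivWithin (uniqueDiffWithinAt_axis i (mem_axis hx.2 i))

theorem pdHalf_eq_fderivWithin (hW : IsOpen W) {f : (Fin (m + 1) → ℝ) → ℝ}
    {x : Fin (m + 1) → ℝ} (hf : DifferentiableWithinAt ℝ f (W ∩ halfSpace m) x)
    (hx : x ∈ W ∩ halfSpace m) (i : Fin (m + 1)) :
    pdHalf i f x = fderivWithin ℝ f (W ∩ halfSpace m) x (Pi.single i 1) :=
  hf.hasFDerivWithinAt.pdHalf_eq hW hx i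

theorem pdHalf_congr (hW : IsOpen W) {f g : (Fin (m + 1) → ℝ) → ℝ}
    (h : EqOn f g (W ∩ halfSpace m)) (i : Fin (m + 1)) :
    EqOn (pdHalf i f) (pdHalf i g) (W ∩ halfSpace m) := by
  intro x hx
  refine EventuallyEq.derivWithin_eq ?_ ?_
  · filter_upwards [eventually_update_mem hW hx i] with s hs using h hs
  · simpa using h hx

theorem contDiffOn_pdHalf (hW : IsOpen W) {f : (Fin (m + 1) → ℝ) → ℝ}
    (hf : ContDiffOn ℝ ∞ f (W ∩ halfSpace m)) (i : Fin (m + 1)) :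
    ContDiffOn ℝ ∞ (pdHalf i f) (W ∩ halfSpace m) := by
  have h : ContDiffOn ℝ ∞ (fun x => fderivWithin ℝ f (W ∩ halfSpace m) x (Pi.single i 1))
      (W ∩ halfSpace m) :=
    (hf.fderivWithin (uniqueDiffOn_inter_halfSpace hW) (by simp)).clm_apply contDiffOn_const
  exact h.congr fun x hx =>
    pdHalf_eq_fderivWithin hW (hf.differentiableOn (by simp) x hx) hx i

/-- Symmetry of second derivatives, at boundary points by approximation from the interior. -/
theorem pdHalf_comm (hW : IsOpen W) {f : (Fin (m + 1) → ℝ) → ℝ}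
    (hf : ContDiffOn ℝ ∞ f (W ∩ halfSpace m)) (i j : Fin (m + 1)) :
    EqOn (pdHalf i (pdHalf j f)) (pdHalf j (pdHalf i f)) (W ∩ halfSpace m) := by
  intro x hx
  have hu := uniqueDiffOn_inter_halfSpace hW
  have hd : DifferentiableWithinAt ℝ (fderivWithin ℝ f (W ∩ halfSpace m)) (W ∩ halfSpace m) x :=
    (hf.fderivWithin hu (m := ∞) (by simp)).differentiableOn (by simp) x hx
  have key : ∀ i j : Fin (m + 1), pdHalf i (pdHalf j f) x =
      fderivWithin ℝ (fderivWithin ℝ f (W ∩ halfSpace m)) (W ∩ halfSpace m) x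
        (Pi.single i 1) (Pi.single j 1) := by
    intro i j
    have h1 : EqOn (pdHalf j f)
        (fun x => fderivWithin ℝ f (W ∩ halfSpace m) x (Pi.single j 1)) (W ∩ halfSpace m) :=
      fun x hx => pdHalf_eq_fderivWithin hW (hf.differentiableOn (by simp) x hx) hx j
    rw [pdHalf_congr hW h1 i hx]
    have h2 : HasFDerivWithinAt (fun x => fderivWithin ℝ f (W ∩ halfSpace m) x (Pi.single j 1))
        ((ContinuousLinearMap.apply ℝ ℝ (Pi.single j 1)).comp
          (fderivWithin ℝ (fderivWithin ℝ f (W ∩ halfSpace m)) (W ∩ halfSpace m) x))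
        (W ∩ halfSpace m) x :=
      HasFDerivAt.comp_hasFDerivWithinAt x
        (g := fun L : (Fin (m + 1) → ℝ) →L[ℝ] ℝ => L (Pi.single j 1))
        (ContinuousLinearMap.apply ℝ ℝ (Pi.single j 1)).hasFDerivAt hd.hasFDerivWithinAt
    rw [h2.pdHalf_eq hW hx i]
    rfl
  rw [key, key]
  refine (hf x hx).isSymmSndFDerivWithinAt (by simp; exact WithTop.coe_le_coe.2 le_top) hu ?_ hx _ _
  have h1 := hu x hx
  have : W ∩ closure (interior (halfSpace m)) ⊆ closure (W ∩ interior (halfSpace m)) :=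
    hW.inter_closure
  rw [interior_inter, hW.interior_eq]
  exact this ⟨hx.1, halfSpace_subset_closure_interior hx.2⟩

theorem contDiffOn_iterate_pdHalf (hW : IsOpen W) {f : (Fin (m + 1) → ℝ) → ℝ}
    (hf : ContDiffOn ℝ ∞ f (W ∩ halfSpace m)) (i : Fin (m + 1)) (n : ℕ) :
    ContDiffOn ℝ ∞ ((pdHalf i)^[n] f) (W ∩ halfSpace m) :=
  iterate_rel (R := fun f _ => ContDiffOn ℝ ∞ f (W ∩ halfSpace m)) (D' := id) (B := ℕ)
    (fun _ _ h => contDiffOn_pdHalf hW h i) n (b := 0) hf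

theorem contDiffOn_multiIter_pdHalf (hW : IsOpen W) {f : (Fin (m + 1) → ℝ) → ℝ}
    (hf : ContDiffOn ℝ ∞ f (W ∩ halfSpace m)) (I : MIdx (m + 1)) :
    ContDiffOn ℝ ∞ (multiIter pdHalf I f) (W ∩ halfSpace m) :=
  multiIter_pred (P := fun f => ContDiffOn ℝ ∞ f (W ∩ halfSpace m))
    (fun i _ h => contDiffOn_pdHalf hW h i) I hf

theorem multiIter_pdHalf_congr (hW : IsOpen W) {f g : (Fin (m + 1) → ℝ) → ℝ}
    (h : EqOn f g (W ∩ halfSpace m)) (I : MIdx (m + 1)) :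
    EqOn (multiIter pdHalf I f) (multiIter pdHalf I g) (W ∩ halfSpace m) :=
  multiIter_rel (R := fun f g => EqOn f g (W ∩ halfSpace m))
    (fun i _ _ h => pdHalf_congr hW h i) I h

theorem iterate_pdHalf_congr (hW : IsOpen W) {f g : (Fin (m + 1) → ℝ) → ℝ}
    (h : EqOn f g (W ∩ halfSpace m)) (i : Fin (m + 1)) (n : ℕ) :
    EqOn ((pdHalf i)^[n] f) ((pdHalf i)^[n] g) (W ∩ halfSpace m) :=
  iterate_rel (R := fun f g => EqOn f g (W ∩ halfSpace m))
    (fun _ _ h => pdHalf_congr hW h i) n h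

theorem equivalence_eqOn {α β : Type*} (s : Set α) :
    Equivalence (fun f g : α → β => EqOn f g s) :=
  ⟨fun _ => eqOn_refl _ _, fun h => h.symm, fun h h' => h.trans h'⟩

theorem multiIter_pdHalf_add_single (hW : IsOpen W) {f : (Fin (m + 1) → ℝ) → ℝ}
    (hf : ContDiffOn ℝ ∞ f (W ∩ halfSpace m)) (I : MIdx (m + 1)) (i : Fin (m + 1)) :
    EqOn (multiIter pdHalf (I + Pi.single i 1) f) (pdHalf i (multiIter pdHalf I f))
      (W ∩ halfSpace m) :=
  multiIter_add_single (equivalence_eqOn _) (P := fun f => ContDiffOn ℝ ∞ f (W ∩ halfSpace m))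
    (fun i _ h => contDiffOn_pdHalf hW h i) (fun i _ _ _ _ h => pdHalf_congr hW h i)
    (fun i j _ h => pdHalf_comm hW h i j) I i hf

theorem pdHalf_add (hW : IsOpen W) {f g : (Fin (m + 1) → ℝ) → ℝ}
    (hf : ContDiffOn ℝ ∞ f (W ∩ halfSpace m)) (hg : ContDiffOn ℝ ∞ g (W ∩ halfSpace m))
    (i : Fin (m + 1)) {x} (hx : x ∈ W ∩ halfSpace m) :
    pdHalf i (fun x => f x + g x) x = pdHalf i f x + pdHalf i g x := by
  have h1 := (hf.differentiableOn (by simp) x hx).hasFDerivWithinAt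
  have h2 := (hg.differentiableOn (by simp) x hx).hasFDerivWithinAt
  rw [(h1.fun_add h2).pdHalf_eq hW hx, h1.pdHalf_eq hW hx, h2.pdHalf_eq hW hx]
  rfl

theorem pdHalf_const_mul (c : ℝ) {f : (Fin (m + 1) → ℝ) → ℝ} (i : Fin (m + 1))
    (x : Fin (m + 1) → ℝ) :
    pdHalf i (fun x => c * f x) x = c * pdHalf i f x := by
  unfold pdHalf
  exact derivWithin_const_mul_field c

theorem multiIter_pdHalf_add (hW : IsOpen W) {f g : (Fin (m + 1) → ℝ) → ℝ}
    (hf : ContDiffOn ℝ ∞ f (W ∩ halfSpace m)) (hg : ContDiffOn ℝ ∞ g (W ∩ halfSpace m))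
    (I : MIdx (m + 1)) {x} (hx : x ∈ W ∩ halfSpace m) :
    multiIter pdHalf I (fun x => f x + g x) x = multiIter pdHalf I f x + multiIter pdHalf I g x := by
  have := multiIter_rel (D := pdHalf) (D' := fun i (p : ((Fin (m + 1) → ℝ) → ℝ) × _) =>
      (pdHalf i p.1, pdHalf i p.2))
    (R := fun h p => ContDiffOn ℝ ∞ p.1 (W ∩ halfSpace m) ∧ ContDiffOn ℝ ∞ p.2 (W ∩ halfSpace m) ∧
      EqOn h (fun x => p.1 x + p.2 x) (W ∩ halfSpace m))
    (fun i h p hp => ⟨contDiffOn_pdHalf hW hp.1 i, contDiffOn_pdHalf hW hp.2.1 i,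
      (pdHalf_congr hW hp.2.2 i).trans fun x hx => pdHalf_add hW hp.1 hp.2.1 i hx⟩) I
    (a := fun x => f x + g x) (b := (f, g)) ⟨hf, hg, fun _ _ => rfl⟩
  have h2 := multiIter_rel (D := fun i (p : ((Fin (m + 1) → ℝ) → ℝ) × ((Fin (m + 1) → ℝ) → ℝ)) =>
      (pdHalf i p.1, pdHalf i p.2)) (D' := pdHalf) (R := fun p h => p.1 = h)
      (fun i p h e => congrArg (pdHalf i) e) I (a := (f, g)) (b := f) rfl
  have h3 := multiIter_rel (D := fun i (p : ((Fin (m + 1) → ℝ) → ℝ) × ((Fin (m + 1) → ℝ) → ℝ)) =>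
      (pdHalf i p.1, pdHalf i p.2)) (D' := pdHalf) (R := fun p h => p.2 = h)
      (fun i p h e => congrArg (pdHalf i) e) I (a := (f, g)) (b := g) rfl
  rw [this.2.2 hx, ← h2, ← h3]

theorem multiIter_pdHalf_const_mul (c : ℝ) (f : (Fin (m + 1) → ℝ) → ℝ) (I : MIdx (m + 1)) :
    multiIter pdHalf I (fun x => c * f x) = fun x => c * multiIter pdHalf I f x :=
  multiIter_rel (D := pdHalf) (D' := pdHalf)
    (R := fun (h f : (Fin (m + 1) → ℝ) → ℝ) => h = fun x => c * f x)
    (fun i h f e => by subst e; funext x; exact pdHalf_const_mul c i x) I rfl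

end HalfSpace

/-! ### Smooth functions on jet spaces and total derivatives -/

section Jets

variable {m : ℕ} {W : Set (Fin (m + 1) → ℝ)} {D : Set ((Fin (m + 1) → ℝ) × ℝ)}

/-- `D` is relatively open in the product of the half-space with the line. -/
def IsRelOpen (D : Set ((Fin (m + 1) → ℝ) × ℝ)) : Prop :=
  ∃ O, IsOpen O ∧ D = O ∩ {p | p.1 ∈ halfSpace m}

/-- The part of the `k`-jet space over `D`. -/
def jetSet (k : ℕ) (D : Set ((Fin (m + 1) → ℝ) × ℝ)) :
    Set ((Fin (m + 1) → ℝ) × (midxLE (m + 1) k → ℝ)) :=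
  {q | (q.1, q.2 ⟨0, zero_mem_midxLE⟩) ∈ D}

theorem trunc_image (k : ℕ) : trunc m k '' jetDom D = jetSet k D := by
  ext q
  constructor
  · rintro ⟨z, hz, rfl⟩
    exact hz
  · intro hq
    refine ⟨(q.1, fun I => if h : I ∈ midxLE (m + 1) k then q.2 ⟨I, h⟩ else 0), ?_, ?_⟩
    · change (q.1, if h : (0 : MIdx (m + 1)) ∈ midxLE (m + 1) k then q.2 ⟨0, h⟩ else 0) ∈ D
      rw [dif_pos zero_mem_midxLE]
      exact hq
    · refine Prod.ext rfl ?_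
      funext I
      simp [trunc]

theorem trunc_mem {k : ℕ} {z : JetSp m} (hz : z ∈ jetDom D) : trunc m k z ∈ jetSet k D := hz

theorem smoothOfOrder_iff {k : ℕ} {F : JetSp m → ℝ} : SmoothOfOrder D k F ↔
    ∃ g, ContDiffOn ℝ ∞ g (jetSet k D) ∧ ∀ z ∈ jetDom D, F z = g (trunc m k z) := by
  rw [← trunc_image]; rfl

theorem IsRelOpen.jetSet_eq (hD : IsRelOpen D) (k : ℕ) : ∃ O, IsOpen O ∧
    jetSet k D = ({x | x ∈ halfSpace m} ×ˢ univ) ∩ O := by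
  obtain ⟨O, hO, rfl⟩ := hD
  refine ⟨(fun q : (Fin (m + 1) → ℝ) × (midxLE (m + 1) k → ℝ) =>
    (q.1, q.2 ⟨0, zero_mem_midxLE⟩)) ⁻¹' O, hO.preimage (by fun_prop), ?_⟩
  ext q
  simp [jetSet, and_comm]

theorem uniqueDiffOn_jetSet (hD : IsRelOpen D) (k : ℕ) : UniqueDiffOn ℝ (jetSet k D) := by
  obtain ⟨O, hO, h⟩ := hD.jetSet_eq k
  rw [h]
  exact (uniqueDiffOn_halfSpace.prod uniqueDiffOn_univ).inter hO

theorem _root_.HasFDerivWithinAt.comp_curve {E : Type*} [NormedAddCommGroup E] [NormedSpace ℝ E]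
    {g : E → ℝ} {L : E →L[ℝ] ℝ} {S : Set E} {A : Set ℝ} {γ : ℝ → E} {γ' p : E} {s₀ : ℝ}
    (hg : HasFDerivWithinAt g L S p) (hγ : HasDerivWithinAt γ γ' A s₀) (hp : γ s₀ = p)
    (hA : ∀ᶠ s in 𝓝[A] s₀, γ s ∈ S) : HasDerivWithinAt (fun s => g (γ s)) (L γ') A s₀ := by
  subst hp
  have h1 : A ∩ {s | γ s ∈ S} ∈ 𝓝[A] s₀ := inter_mem self_mem_nhdsWithin hA
  have h2 : HasDerivWithinAt γ γ' (A ∩ {s | γ s ∈ S}) s₀ := hγ.mono inter_subset_left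
  have h3 := hg.comp_hasDerivWithinAt s₀ h2 (fun s hs => hs.2)
  exact h3.mono_of_mem_nhdsWithin h1

theorem IsRelOpen.eventually_mem (hD : IsRelOpen D) {α : Type*} {l : Filter α}
    {γ : α → (Fin (m + 1) → ℝ) × ℝ} {p : (Fin (m + 1) → ℝ) × ℝ} (hp : p ∈ D)
    (hγ : Tendsto γ l (𝓝 p)) (h : ∀ᶠ a in l, (γ a).1 ∈ halfSpace m) : ∀ᶠ a in l, γ a ∈ D := by
  obtain ⟨O, hO, rfl⟩ := hD
  filter_upwards [hγ (hO.mem_nhds hp.1), h] with a h1 h2 using ⟨h1, h2⟩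

theorem IsRelOpen.mem_halfSpace (hD : IsRelOpen D) {p} (hp : p ∈ D) : p.1 ∈ halfSpace m := by
  obtain ⟨O, hO, rfl⟩ := hD
  exact hp.2

theorem eventually_jetDom_x (hD : IsRelOpen D) {z : JetSp m} (hz : z ∈ jetDom D)
    (i : Fin (m + 1)) :
    ∀ᶠ s in 𝓝[axis i] (z.1 i), (Function.update z.1 i s, z.2) ∈ jetDom D := by
  have h := tendsto_update_axis (hD.mem_halfSpace hz) i
  refine hD.eventually_mem (γ := fun s => (Function.update z.1 i s, z.2 0)) hz
    ((h.mono_right nhdsWithin_le_nhds).prodMk_nhds tendsto_const_nhds) ?_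
  exact eventually_nhdsWithin_of_forall fun s hs => update_mem_halfSpace (hD.mem_halfSpace hz) hs

theorem eventually_jetDom_u (hD : IsRelOpen D) {z : JetSp m} (hz : z ∈ jetDom D)
    (I : MIdx (m + 1)) :
    ∀ᶠ s in 𝓝 (z.2 I), (z.1, Function.update z.2 I s) ∈ jetDom D := by
  refine hD.eventually_mem (γ := fun s => (z.1, Function.update z.2 I s 0)) (p := (z.1, z.2 0)) hz
    (tendsto_const_nhds.prodMk_nhds ?_)
    (Eventually.of_forall fun _ => show z.1 ∈ _ from hD.mem_halfSpace hz)
  have : ContinuousAt (fun s => Function.update z.2 I s 0) (z.2 I) := by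
    have h : Continuous (fun s => Function.update z.2 I s) := continuous_const.update I continuous_id
    exact ((continuous_apply 0).comp h).continuousAt
  simpa [ContinuousAt] using this

theorem pdU_apply (hD : IsRelOpen D) {k : ℕ} {F : JetSp m → ℝ}
    {g : (Fin (m + 1) → ℝ) × (midxLE (m + 1) k → ℝ) → ℝ} (hg : ContDiffOn ℝ ∞ g (jetSet k D))
    (hF : ∀ z ∈ jetDom D, F z = g (trunc m k z)) {z : JetSp m} (hz : z ∈ jetDom D)
    (I : MIdx (m + 1)) :
    pdU I F z = if h : I ∈ midxLE (m + 1) k then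
      fderivWithin ℝ g (jetSet k D) (trunc m k z) (0, Pi.single ⟨I, h⟩ 1) else 0 := by
  have hL := (hg.differentiableOn (by simp) _ (trunc_mem hz)).hasFDerivWithinAt
  have he : (fun s => F (z.1, Function.update z.2 I s)) =ᶠ[𝓝 (z.2 I)]
      fun s => g (trunc m k (z.1, Function.update z.2 I s)) := by
    filter_upwards [eventually_jetDom_u hD hz I] with s hs using hF _ hs
  unfold pdU
  rw [he.deriv_eq]
  split_ifs with h
  · have h1 : ∀ s, trunc m k (z.1, Function.update z.2 I s) =
        (z.1, Function.update (trunc m k z).2 ⟨I, h⟩ s) := by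
      intro s
      refine Prod.ext rfl ?_
      funext J
      simp [trunc, Function.update_apply, Subtype.ext_iff]
    have h2 : HasDerivWithinAt (fun s => trunc m k (z.1, Function.update z.2 I s))
        (0, Pi.single ⟨I, h⟩ 1) univ (z.2 I) := by
      simp only [h1]
      exact ((hasDerivAt_const _ _).prodMk (hasDerivAt_update_self _ _ _)).hasDerivWithinAt
    have h3 := hL.comp_curve h2 (by simp) (by
      rw [nhdsWithin_univ]
      filter_upwards [eventually_jetDom_u hD hz I] with s hs using trunc_mem hs)
    exact (hasDerivWithinAt_univ.1 h3).deriv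
  · have h1 : ∀ s, trunc m k (z.1, Function.update z.2 I s) = trunc m k z := by
      intro s
      refine Prod.ext rfl ?_
      funext J
      have : (J : MIdx (m + 1)) ≠ I := fun e => h (e ▸ J.2)
      simp [trunc, this]
    simp [h1]

/-- On functions of order `k` the total derivative is the derivative along the truncated Cartan vector
`(∂_i, u_{I + 1_i})`; the sum over `I` is then finite. -/
theorem totalD_apply (hD : IsRelOpen D) {k : ℕ} {F : JetSp m → ℝ}
    {g : (Fin (m + 1) → ℝ) × (midxLE (m + 1) k → ℝ) → ℝ} (hg : ContDiffOn ℝ ∞ g (jetSet k D))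
    (hF : ∀ z ∈ jetDom D, F z = g (trunc m k z)) {z : JetSp m} (hz : z ∈ jetDom D)
    (i : Fin (m + 1)) :
    totalD i F z = fderivWithin ℝ g (jetSet k D) (trunc m k z)
      (Pi.single i 1, fun I => z.2 (I.1 + Pi.single i 1)) := by
  have hL := (hg.differentiableOn (by simp) _ (trunc_mem hz)).hasFDerivWithinAt
  set L := fderivWithin ℝ g (jetSet k D) (trunc m k z) with hLdef
  have h1 : derivWithin (fun s => F (Function.update z.1 i s, z.2)) (axis i) (z.1 i) =
      L (Pi.single i 1, 0) := by
    have he : (fun s => F (Function.update z.1 i s, z.2)) =ᶠ[𝓝[axis i] (z.1 i)]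
        fun s => g (trunc m k (Function.update z.1 i s, z.2)) := by
      filter_upwards [eventually_jetDom_x hD hz i] with s hs using hF _ hs
    rw [he.derivWithin_eq (by simpa using hF _ hz)]
    have h2 : HasDerivWithinAt (fun s => trunc m k (Function.update z.1 i s, z.2))
        (Pi.single i 1, 0) (axis i) (z.1 i) :=
      HasDerivAt.hasDerivWithinAt (HasDerivAt.prodMk (hasDerivAt_update_self z.1 i (z.1 i))
        (hasDerivAt_const (z.1 i) (trunc m k z).2))
    have h3 := hL.comp_curve h2 (by simp) (by
      filter_upwards [eventually_jetDom_x hD hz i] with s hs using trunc_mem hs)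
    exact h3.derivWithin (uniqueDiffWithinAt_axis i (mem_axis (hD.mem_halfSpace hz) i))
  have h2 : ∑ᶠ I : MIdx (m + 1), z.2 (I + Pi.single i 1) * pdU I F z =
      L (0, fun I => z.2 (I.1 + Pi.single i 1)) := by
    rw [finsum_eq_sum_of_support_subset (s := midxLE (m + 1) k)]
    · rw [← Finset.sum_coe_sort]
      have h3 : ((0 : Fin (m + 1) → ℝ), fun I : midxLE (m + 1) k => z.2 (I.1 + Pi.single i 1)) =
          ∑ I : midxLE (m + 1) k, z.2 (I.1 + Pi.single i 1) •
            ((0 : Fin (m + 1) → ℝ), (Pi.single I 1 : midxLE (m + 1) k → ℝ)) := by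
        refine Prod.ext ?_ ?_
        · simp [Prod.fst_sum]
        · funext J
          simp [Prod.snd_sum, Finset.sum_apply, Pi.single_apply]
      rw [h3, map_sum]
      refine Finset.sum_congr rfl fun I _ => ?_
      rw [pdU_apply hD hg hF hz, dif_pos I.2, map_smul, smul_eq_mul]
    · intro I hI
      by_contra h
      apply hI
      simp only
      rw [pdU_apply hD hg hF hz, dif_neg (by simpa using h), mul_zero]
  unfold totalD
  rw [h1, h2, ← map_add]
  simp

/-- The projection of jets of order `k'` to jets of order `k`. -/
def jetRestr {k k' : ℕ} (h : k ≤ k') (q : (Fin (m + 1) → ℝ) × (midxLE (m + 1) k' → ℝ)) :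
    (Fin (m + 1) → ℝ) × (midxLE (m + 1) k → ℝ) :=
  (q.1, fun I => q.2 ⟨I, mem_midxLE.2 ((mem_midxLE.1 I.2).trans h)⟩)

theorem contDiff_jetRestr {k k' : ℕ} (h : k ≤ k') : ContDiff ℝ ∞ (jetRestr (m := m) h) := by
  unfold jetRestr
  fun_prop

theorem SmoothOfOrder.mono {k k' : ℕ} (h : k ≤ k') {F : JetSp m → ℝ} (hF : SmoothOfOrder D k F) :
    SmoothOfOrder D k' F := by
  rw [smoothOfOrder_iff] at *
  obtain ⟨g, hg, hF⟩ := hF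
  exact ⟨g ∘ jetRestr h, hg.comp (contDiff_jetRestr h).contDiffOn fun q hq => hq, hF⟩

theorem SmoothOfOrder.congr {k : ℕ} {F G : JetSp m → ℝ} (hF : SmoothOfOrder D k F)
    (h : EqOn G F (jetDom D)) : SmoothOfOrder D k G := by
  obtain ⟨g, hg, hF⟩ := hF
  exact ⟨g, hg, fun z hz => (h hz).trans (hF z hz)⟩

theorem SmoothOfOrder.add {k : ℕ} {F G : JetSp m → ℝ} (hF : SmoothOfOrder D k F)
    (hG : SmoothOfOrder D k G) : SmoothOfOrder D k (fun z => F z + G z) := by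
  obtain ⟨g, hg, hF⟩ := hF
  obtain ⟨g', hg', hG⟩ := hG
  exact ⟨fun q => g q + g' q, hg.add hg', fun z hz => by simp only [hF z hz, hG z hz]⟩

theorem SmoothOfOrder.mul {k : ℕ} {F G : JetSp m → ℝ} (hF : SmoothOfOrder D k F)
    (hG : SmoothOfOrder D k G) : SmoothOfOrder D k (fun z => F z * G z) := by
  obtain ⟨g, hg, hF⟩ := hF
  obtain ⟨g', hg', hG⟩ := hG
  exact ⟨fun q => g q * g' q, hg.mul hg', fun z hz => by simp only [hF z hz, hG z hz]⟩

theorem SmoothOfOrder.totalD (hD : IsRelOpen D) {k : ℕ} {F : JetSp m → ℝ}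
    (hF : SmoothOfOrder D k F) (i : Fin (m + 1)) :
    SmoothOfOrder D (k + 1) (FreeBoundary.totalD i F) := by
  rw [smoothOfOrder_iff] at *
  obtain ⟨g, hg, hF⟩ := hF
  refine ⟨fun q => fderivWithin ℝ g (jetSet k D) (jetRestr (Nat.le_succ k) q)
    (Pi.single i 1, fun I => q.2 ⟨I.1 + Pi.single i 1, mem_midxLE.2 (by
      rw [mlen_add, mlen_single]; exact Nat.succ_le_succ (mem_midxLE.1 I.2))⟩), ?_,
    fun z hz => by rw [totalD_apply hD hg hF hz i]; rfl⟩
  refine ContDiffOn.clm_apply ?_ (ContDiff.contDiffOn (by fun_prop))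
  exact (hg.fderivWithin (uniqueDiffOn_jetSet hD k) (m := ∞) (by simp)).comp
    (contDiff_jetRestr _).contDiffOn fun q hq => hq

theorem SmoothOfOrder.pdU (hD : IsRelOpen D) {k : ℕ} {F : JetSp m → ℝ}
    (hF : SmoothOfOrder D k F) (I : MIdx (m + 1)) :
    SmoothOfOrder D k (FreeBoundary.pdU I F) := by
  rw [smoothOfOrder_iff] at *
  obtain ⟨g, hg, hF⟩ := hF
  refine ⟨fun q => if h : I ∈ midxLE (m + 1) k then
    fderivWithin ℝ g (jetSet k D) q (0, Pi.single ⟨I, h⟩ 1) else 0, ?_,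
    fun z hz => pdU_apply hD hg hF hz I⟩
  split_ifs with h
  · exact (hg.fderivWithin (uniqueDiffOn_jetSet hD k) (m := ∞) (by simp)).clm_apply
      contDiffOn_const
  · exact contDiffOn_const

theorem JetSmooth.add {F G : JetSp m → ℝ} (hF : JetSmooth D F) (hG : JetSmooth D G) :
    JetSmooth D (fun z => F z + G z) := by
  obtain ⟨k, hF⟩ := hF
  obtain ⟨l, hG⟩ := hG
  exact ⟨max k l, (hF.mono (le_max_left _ _)).add (hG.mono (le_max_right _ _))⟩

theorem JetSmooth.mul {F G : JetSp m → ℝ} (hF : JetSmooth D F) (hG : JetSmooth D G) :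
    JetSmooth D (fun z => F z * G z) := by
  obtain ⟨k, hF⟩ := hF
  obtain ⟨l, hG⟩ := hG
  exact ⟨max k l, (hF.mono (le_max_left _ _)).mul (hG.mono (le_max_right _ _))⟩

theorem JetSmooth.totalD (hD : IsRelOpen D) {F : JetSp m → ℝ} (hF : JetSmooth D F)
    (i : Fin (m + 1)) : JetSmooth D (FreeBoundary.totalD i F) :=
  let ⟨_, hF⟩ := hF
  ⟨_, hF.totalD hD i⟩

theorem JetSmooth.pdU (hD : IsRelOpen D) {F : JetSp m → ℝ} (hF : JetSmooth D F)
    (I : MIdx (m + 1)) : JetSmooth D (FreeBoundary.pdU I F) :=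
  let ⟨_, hF⟩ := hF
  ⟨_, hF.pdU hD I⟩

theorem JetSmooth.congr {F G : JetSp m → ℝ} (hF : JetSmooth D F) (h : EqOn G F (jetDom D)) :
    JetSmooth D G :=
  let ⟨_, hF⟩ := hF
  ⟨_, hF.congr h⟩

/-- Functions of the independent variables are functions on the jet space. -/
theorem jetSmooth_base {v : (Fin (m + 1) → ℝ) → ℝ} (hv : ContDiff ℝ ∞ v) :
    JetSmooth D (fun z => v z.1) :=
  ⟨0, fun q => v q.1, (hv.comp contDiff_fst).contDiffOn, fun _ _ => rfl⟩

theorem jetSmooth_const (c : ℝ) : JetSmooth D (fun _ => c) :=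
  jetSmooth_base (v := fun _ => c) contDiff_const

theorem JetSmooth.sum {ι : Type*} (s : Finset ι) {F : ι → JetSp m → ℝ}
    (hF : ∀ i ∈ s, JetSmooth D (F i)) : JetSmooth D (fun z => ∑ i ∈ s, F i z) := by
  classical
  induction s using Finset.induction_on with
  | empty => simpa using jetSmooth_const 0
  | insert a s ha ih =>
    simp only [Finset.sum_insert ha]
    exact (hF a (by simp)).add (ih fun i hi => hF i (by simp [hi]))

theorem JetSmooth.iterate_totalD (hD : IsRelOpen D) {F : JetSp m → ℝ} (hF : JetSmooth D F)
    (i : Fin (m + 1)) (n : ℕ) : JetSmooth D ((FreeBoundary.totalD i)^[n] F) :=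
  iterate_rel (R := fun f _ => JetSmooth D f) (D' := id) (B := ℕ)
    (fun _ _ h => h.totalD hD i) n (b := 0) hF

theorem JetSmooth.multiIter_totalD (hD : IsRelOpen D) {F : JetSp m → ℝ} (hF : JetSmooth D F)
    (I : MIdx (m + 1)) : JetSmooth D (multiIter FreeBoundary.totalD I F) :=
  multiIter_pred (P := fun f => JetSmooth D f) (fun i _ h => h.totalD hD i) I hF

theorem totalD_congr (hD : IsRelOpen D) {F G : JetSp m → ℝ} (hF : JetSmooth D F)
    (h : EqOn F G (jetDom D)) (i : Fin (m + 1)) :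
    EqOn (totalD i F) (totalD i G) (jetDom D) := by
  obtain ⟨k, hF⟩ := hF
  obtain ⟨g, hg, hF⟩ := smoothOfOrder_iff.1 hF
  intro z hz
  rw [totalD_apply hD hg hF hz, totalD_apply hD hg (fun z hz => (h hz).symm.trans (hF z hz)) hz]

theorem totalD_add (hD : IsRelOpen D) {F G : JetSp m → ℝ} (hF : JetSmooth D F)
    (hG : JetSmooth D G) (i : Fin (m + 1)) {z : JetSp m} (hz : z ∈ jetDom D) :
    totalD i (fun z => F z + G z) z = totalD i F z + totalD i G z := by
  obtain ⟨k, hF⟩ := hF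
  obtain ⟨l, hG⟩ := hG
  obtain ⟨f, hf, hF⟩ := smoothOfOrder_iff.1 (hF.mono (le_max_left k l))
  obtain ⟨g, hg, hG⟩ := smoothOfOrder_iff.1 (hG.mono (le_max_right k l))
  rw [totalD_apply hD hf hF hz, totalD_apply hD hg hG hz,
    totalD_apply hD (hf.add hg) (fun z hz => by simp only [hF z hz, hG z hz]) hz]
  rw [fderivWithin_fun_add (uniqueDiffOn_jetSet hD _ _ (trunc_mem hz))
    (hf.differentiableOn (by simp) _ (trunc_mem hz))
    (hg.differentiableOn (by simp) _ (trunc_mem hz))]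
  rfl

theorem totalD_mul (hD : IsRelOpen D) {F G : JetSp m → ℝ} (hF : JetSmooth D F)
    (hG : JetSmooth D G) (i : Fin (m + 1)) {z : JetSp m} (hz : z ∈ jetDom D) :
    totalD i (fun z => F z * G z) z = F z * totalD i G z + totalD i F z * G z := by
  obtain ⟨k, hF⟩ := hF
  obtain ⟨l, hG⟩ := hG
  obtain ⟨f, hf, hF⟩ := smoothOfOrder_iff.1 (hF.mono (le_max_left k l))
  obtain ⟨g, hg, hG⟩ := smoothOfOrder_iff.1 (hG.mono (le_max_right k l))
  rw [totalD_apply hD hf hF hz, totalD_apply hD hg hG hz,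
    totalD_apply hD (hf.mul hg) (fun z hz => by simp only [hF z hz, hG z hz]) hz]
  rw [fderivWithin_fun_mul (uniqueDiffOn_jetSet hD _ _ (trunc_mem hz))
    (hf.differentiableOn (by simp) _ (trunc_mem hz))
    (hg.differentiableOn (by simp) _ (trunc_mem hz)), hF z hz, hG z hz]
  simp only [add_apply, smul_apply, smul_eq_mul]
  ring

theorem totalD_const (c : ℝ) (i : Fin (m + 1)) (z : JetSp m) :
    totalD i (fun _ => c) z = 0 := by
  simp [totalD, pdU]

theorem totalD_const_mul (hD : IsRelOpen D) (c : ℝ) {G : JetSp m → ℝ}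
    (hG : JetSmooth D G) (i : Fin (m + 1)) {z : JetSp m} (hz : z ∈ jetDom D) :
    totalD i (fun z => c * G z) z = c * totalD i G z := by
  rw [totalD_mul hD (jetSmooth_const c) hG i hz, totalD_const]
  ring

theorem totalD_sum (hD : IsRelOpen D) {ι : Type*} (s : Finset ι) {F : ι → JetSp m → ℝ}
    (hF : ∀ i ∈ s, JetSmooth D (F i)) (j : Fin (m + 1)) {z : JetSp m} (hz : z ∈ jetDom D) :
    totalD j (fun z => ∑ i ∈ s, F i z) z = ∑ i ∈ s, totalD j (F i) z := by
  classical
  induction s using Finset.induction_on with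
  | empty => simp [totalD_const]
  | insert a s ha ih =>
    simp only [Finset.sum_insert ha]
    rw [totalD_add hD (hF a (by simp)) (JetSmooth.sum s fun i hi => hF i (by simp [hi])) j hz,
      ih fun i hi => hF i (by simp [hi])]

/-! ### Prolongation intertwines total and partial derivatives -/

theorem prolong_snd_zero (f : (Fin (m + 1) → ℝ) → ℝ) (x : Fin (m + 1) → ℝ) :
    (prolong f x).2 0 = f x := by
  simp [prolong, multiIter_zero]

theorem prolong_mem_jetDom {f : (Fin (m + 1) → ℝ) → ℝ} {x : Fin (m + 1) → ℝ}
    (h : (x, f x) ∈ D) : prolong f x ∈ jetDom D := by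
  change (x, (prolong f x).2 0) ∈ D
  rwa [prolong_snd_zero]

theorem contDiffOn_trunc_prolong (hW : IsOpen W) {f : (Fin (m + 1) → ℝ) → ℝ}
    (hf : ContDiffOn ℝ ∞ f (W ∩ halfSpace m)) (k : ℕ) :
    ContDiffOn ℝ ∞ (fun x => trunc m k (prolong f x)) (W ∩ halfSpace m) :=
  contDiffOn_id.prodMk (contDiffOn_pi.2 fun I => contDiffOn_multiIter_pdHalf hW hf I)

theorem JetSmooth.comp_prolong {F : JetSp m → ℝ} (hF : JetSmooth D F)
    (hW : IsOpen W) {f : (Fin (m + 1) → ℝ) → ℝ} (hf : ContDiffOn ℝ ∞ f (W ∩ halfSpace m))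
    (hfD : ∀ x ∈ W ∩ halfSpace m, (x, f x) ∈ D) :
    ContDiffOn ℝ ∞ (fun x => F (prolong f x)) (W ∩ halfSpace m) := by
  obtain ⟨k, hF⟩ := hF
  obtain ⟨g, hg, hF⟩ := smoothOfOrder_iff.1 hF
  refine (hg.comp (contDiffOn_trunc_prolong hW hf k) fun x hx =>
    trunc_mem (prolong_mem_jetDom (hfD x hx))).congr fun x hx =>
      hF _ (prolong_mem_jetDom (hfD x hx))

/-- The chain rule: along the jets of a function the total derivatives are partial derivatives. -/
theorem totalD_prolong (hD : IsRelOpen D) {F : JetSp m → ℝ} (hF : JetSmooth D F)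
    (hW : IsOpen W) {f : (Fin (m + 1) → ℝ) → ℝ} (hf : ContDiffOn ℝ ∞ f (W ∩ halfSpace m))
    (hfD : ∀ x ∈ W ∩ halfSpace m, (x, f x) ∈ D) (i : Fin (m + 1)) :
    EqOn (fun x => totalD i F (prolong f x)) (pdHalf i (fun x => F (prolong f x)))
      (W ∩ halfSpace m) := by
  obtain ⟨k, hF⟩ := hF
  obtain ⟨g, hg, hF⟩ := smoothOfOrder_iff.1 hF
  intro x hx
  have hz := prolong_mem_jetDom (hfD x hx)
  simp only
  rw [totalD_apply hD hg hF hz i]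
  have h1 : EqOn (fun x => F (prolong f x)) (fun x => g (trunc m k (prolong f x)))
      (W ∩ halfSpace m) := fun x hx => hF _ (prolong_mem_jetDom (hfD x hx))
  rw [pdHalf_congr hW h1 i hx]
  have hL := (hg.differentiableOn (by simp) _ (trunc_mem hz)).hasFDerivWithinAt
  have h2 := ((contDiffOn_trunc_prolong hW hf k).differentiableOn
    (by simp) x hx).hasFDerivWithinAt
  have h3 := hL.comp x h2 fun x hx => trunc_mem (prolong_mem_jetDom (hfD x hx))
  have h4 := h3.pdHalf_eq hW hx i
  have h5 := h2.hasDerivWithinAt_update hW hx i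
  have h6 : HasDerivWithinAt (fun s => trunc m k (prolong f (Function.update x i s)))
      (Pi.single i 1, fun I => (prolong f x).2 (I.1 + Pi.single i 1)) (axis i) (x i) := by
    refine HasDerivWithinAt.prodMk (hasDerivAt_update_self x i (x i)).hasDerivWithinAt ?_
    rw [hasDerivWithinAt_pi]
    intro I
    have h7 := ((contDiffOn_multiIter_pdHalf hW hf I).differentiableOn
      (by simp) x hx).hasFDerivWithinAt
    have h8 := h7.hasDerivWithinAt_update hW hx i
    rw [← h7.pdHalf_eq hW hx i, ← multiIter_pdHalf_add_single hW hf I i hx] at h8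
    exact h8
  have h9 := (uniqueDiffWithinAt_axis i (mem_axis hx.2 i)).eq_deriv _ h5 h6
  rw [ContinuousLinearMap.comp_apply, h9] at h4
  exact h4.symm

theorem iterate_totalD_prolong (hD : IsRelOpen D) {F : JetSp m → ℝ} (hF : JetSmooth D F)
    (hW : IsOpen W) {f : (Fin (m + 1) → ℝ) → ℝ} (hf : ContDiffOn ℝ ∞ f (W ∩ halfSpace m))
    (hfD : ∀ x ∈ W ∩ halfSpace m, (x, f x) ∈ D) (i : Fin (m + 1)) (n : ℕ) :
    EqOn (fun x => (totalD i)^[n] F (prolong f x)) ((pdHalf i)^[n] (fun x => F (prolong f x)))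
      (W ∩ halfSpace m) :=
  (iterate_rel (D := totalD i) (D' := pdHalf i) (R := fun F h => JetSmooth D F ∧
    EqOn (fun x => F (prolong f x)) h (W ∩ halfSpace m))
    (fun _ _ hF => ⟨hF.1.totalD hD i,
      (totalD_prolong hD hF.1 hW hf hfD i).trans (pdHalf_congr hW hF.2 i)⟩) n
    (a := F) (b := fun x => F (prolong f x)) ⟨hF, eqOn_refl _ _⟩).2

theorem multiIter_totalD_prolong (hD : IsRelOpen D) {F : JetSp m → ℝ} (hF : JetSmooth D F)
    (hW : IsOpen W) {f : (Fin (m + 1) → ℝ) → ℝ} (hf : ContDiffOn ℝ ∞ f (W ∩ halfSpace m))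
    (hfD : ∀ x ∈ W ∩ halfSpace m, (x, f x) ∈ D) (I : MIdx (m + 1)) :
    EqOn (fun x => multiIter totalD I F (prolong f x))
      (multiIter pdHalf I (fun x => F (prolong f x))) (W ∩ halfSpace m) :=
  (multiIter_rel (D := totalD) (D' := pdHalf) (R := fun F h => JetSmooth D F ∧
    EqOn (fun x => F (prolong f x)) h (W ∩ halfSpace m))
    (fun i _ _ hF => ⟨hF.1.totalD hD i,
      (totalD_prolong hD hF.1 hW hf hfD i).trans (pdHalf_congr hW hF.2 i)⟩) I
    (a := F) (b := fun x => F (prolong f x)) ⟨hF, eqOn_refl _ _⟩).2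

end Jets

/-! ### Realization of finite jets by polynomials -/

section Realize

variable {m : ℕ} {W : Set (Fin (m + 1) → ℝ)} {D : Set ((Fin (m + 1) → ℝ) × ℝ)}

/-- The `b`-th derivative of `t ^ a / a!`; it is zero for `b > a`. -/
def divPow (a b : ℕ) (t : ℝ) : ℝ := if b ≤ a then t ^ (a - b) / (a - b).factorial else 0

theorem hasDerivAt_divPow (a b : ℕ) (t : ℝ) : HasDerivAt (divPow a b) (divPow a (b + 1) t) t := by
  unfold divPow
  rcases lt_trichotomy a b with h | h | h
  · simpa [not_le.2 h, show ¬ b + 1 ≤ a by omega] using hasDerivAt_const t (0 : ℝ)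
  · subst h
    simpa using hasDerivAt_const t (1 : ℝ)
  · obtain ⟨n, rfl⟩ : ∃ n, a = b + (n + 1) := ⟨a - b - 1, by omega⟩
    have h1 : b + (n + 1) - b = n + 1 := by omega
    have h2 : b + (n + 1) - (b + 1) = n := by omega
    simp only [h1, h2, if_pos (show b ≤ b + (n + 1) by omega),
      if_pos (show b + 1 ≤ b + (n + 1) by omega)]
    have h3 := (hasDerivAt_pow (n + 1) t).div_const ((n + 1).factorial : ℝ)
    refine h3.congr_deriv ?_
    rw [Nat.factorial_succ]
    push_cast
    have : (n : ℝ) + 1 ≠ 0 := by positivity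
    field_simp

theorem contDiff_divPow (a b : ℕ) : ContDiff ℝ ∞ (divPow a b) := by
  unfold divPow
  split_ifs
  · exact (contDiff_id.pow _).div_const _
  · exact contDiff_const

theorem divPow_zero (a b : ℕ) : divPow a b 0 = if a = b then 1 else 0 := by
  unfold divPow
  rcases lt_trichotomy a b with h | h | h
  · simp [not_le.2 h, h.ne]
  · simp [h]
  · simp [h.le, h.ne', show a - b ≠ 0 by omega]

/-- The `J`-th partial derivative of the monomial `∏ (x_i - c_i) ^ I_i / I_i!`. -/
def divMono {k : ℕ} (c : Fin k → ℝ) (J I : MIdx k) (x : Fin k → ℝ) : ℝ :=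
  ∏ j, divPow (I j) (J j) (x j - c j)

theorem hasDerivAt_divMono {k : ℕ} (c : Fin k → ℝ) (J I : MIdx k) (x : Fin k → ℝ) (i : Fin k) :
    HasDerivAt (fun s => divMono c J I (Function.update x i s))
      (divMono c (J + Pi.single i 1) I x) (x i) := by
  unfold divMono
  simp only [Fintype.prod_eq_mul_prod_compl i]
  have h1 : ∀ s, ∏ j ∈ {i}ᶜ, divPow (I j) (J j) (Function.update x i s j - c j) =
      ∏ j ∈ {i}ᶜ, divPow (I j) (J j) (x j - c j) := fun s =>
    Finset.prod_congr rfl fun j hj => by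
      rw [Function.update_of_ne (by simpa using hj)]
  have h2 : ∏ j ∈ {i}ᶜ, divPow (I j) (J j + (Pi.single i 1 : MIdx k) j) (x j - c j) =
      ∏ j ∈ {i}ᶜ, divPow (I j) (J j) (x j - c j) :=
    Finset.prod_congr rfl fun j hj => by
      have : j ≠ i := by simpa using hj
      simp [this]
  simp only [h1, Function.update_self, Pi.add_apply, Pi.single_eq_same]
  rw [h2]
  have h3 := (hasDerivAt_divPow (I i) (J i) (x i - c i)).comp_sub_const (x i) (c i)
  exact h3.mul_const _

theorem divMono_self {k : ℕ} (c : Fin k → ℝ) (J I : MIdx k) :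
    divMono c J I c = if I = J then 1 else 0 := by
  unfold divMono
  simp only [sub_self, divPow_zero]
  split_ifs with h
  · simp [h]
  · obtain ⟨j, hj⟩ := Function.ne_iff.1 h
    exact Finset.prod_eq_zero (Finset.mem_univ j) (by simp [hj])

theorem contDiff_divMono {k : ℕ} (c : Fin k → ℝ) (J I : MIdx k) :
    ContDiff ℝ ∞ (divMono c J I) := by
  unfold divMono
  refine contDiff_prod fun j _ => (contDiff_divPow _ _).comp ?_
  fun_prop

theorem pdHalf_sum_divMono {k : ℕ} (a : MIdx (m + 1) → ℝ) (c : Fin (m + 1) → ℝ)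
    (J : MIdx (m + 1)) (i : Fin (m + 1)) :
    EqOn (pdHalf i fun x => ∑ I ∈ midxLE (m + 1) k, a I * divMono c J I x)
      (fun x => ∑ I ∈ midxLE (m + 1) k, a I * divMono c (J + Pi.single i 1) I x)
      (univ ∩ halfSpace m) := by
  intro x hx
  have : HasDerivAt
      (fun s => ∑ I ∈ midxLE (m + 1) k, a I * divMono c J I (Function.update x i s))
      (∑ I ∈ midxLE (m + 1) k, a I * divMono c (J + Pi.single i 1) I x) (x i) :=
    HasDerivAt.fun_sum fun I _ => (hasDerivAt_divMono c J I x i).const_mul (a I)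
  exact this.hasDerivWithinAt.derivWithin (uniqueDiffWithinAt_axis i (mem_axis hx.2 i))

theorem contDiff_sum_divMono (k : ℕ) (a : MIdx (m + 1) → ℝ) (c : Fin (m + 1) → ℝ)
    (J : MIdx (m + 1)) :
    ContDiff ℝ ∞ fun x => ∑ I ∈ midxLE (m + 1) k, a I * divMono c J I x :=
  ContDiff.sum fun I _ => contDiff_const.mul (contDiff_divMono c J I)

theorem multiIter_pdHalf_sum_divMono (k : ℕ) (a : MIdx (m + 1) → ℝ) (c : Fin (m + 1) → ℝ)
    (J : MIdx (m + 1)) :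
    EqOn (multiIter pdHalf J fun x => ∑ I ∈ midxLE (m + 1) k, a I * divMono c 0 I x)
      (fun x => ∑ I ∈ midxLE (m + 1) k, a I * divMono c J I x) (univ ∩ halfSpace m) := by
  induction J using midx_induction with
  | h0 => rw [multiIter_zero]; exact eqOn_refl _ _
  | hs J i ih =>
    refine (multiIter_pdHalf_add_single isOpen_univ
      (contDiff_sum_divMono k a c 0).contDiffOn J i).trans ?_
    exact (pdHalf_congr isOpen_univ ih i).trans (pdHalf_sum_divMono a c J i)

/-- Every finite jet over `D` is the jet of a smooth function with graph in `D`. -/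
theorem exists_prolong_eq (hD : IsRelOpen D) {z : JetSp m} (hz : z ∈ jetDom D) (k : ℕ) :
    ∃ (f : (Fin (m + 1) → ℝ) → ℝ) (W : Set (Fin (m + 1) → ℝ)), ContDiff ℝ ∞ f ∧ IsOpen W ∧
      z.1 ∈ W ∧ (∀ x ∈ W ∩ halfSpace m, (x, f x) ∈ D) ∧
      trunc m k (prolong f z.1) = trunc m k z := by
  set f := fun x => ∑ I ∈ midxLE (m + 1) k, z.2 I * divMono z.1 0 I x with hf
  have hfc : ContDiff ℝ ∞ f := contDiff_sum_divMono k z.2 z.1 0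
  have hzH : z.1 ∈ halfSpace m := hD.mem_halfSpace hz
  have hval : ∀ J ∈ midxLE (m + 1) k, multiIter pdHalf J f z.1 = z.2 J := by
    intro J hJ
    rw [hf, multiIter_pdHalf_sum_divMono k z.2 z.1 J ⟨trivial, hzH⟩]
    simp only [divMono_self, mul_ite, mul_one, mul_zero]
    rw [Finset.sum_ite_eq' (midxLE (m + 1) k) J z.2, if_pos hJ]
  have h0 : f z.1 = z.2 0 := by
    have := hval 0 zero_mem_midxLE
    rwa [multiIter_zero] at this
  obtain ⟨O, hO, rfl⟩ := hD
  refine ⟨f, (fun x => (x, f x)) ⁻¹' O, hfc, hO.preimage (by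
    have := hfc.continuous; fun_prop), ?_, fun x hx => ⟨hx.1, hx.2⟩, ?_⟩
  · change (z.1, f z.1) ∈ O
    rw [h0]
    exact hz.1
  · refine Prod.ext rfl ?_
    funext J
    exact hval J J.2

theorem SmoothOfOrder.eq_of_trunc_eq {k : ℕ} {F : JetSp m → ℝ} (hF : SmoothOfOrder D k F)
    {z z' : JetSp m} (h : trunc m k z = trunc m k z') (hz : z ∈ jetDom D) (hz' : z' ∈ jetDom D) :
    F z = F z' := by
  obtain ⟨g, -, hF⟩ := hF
  rw [hF z hz, hF z' hz', h]

/-- Total derivatives commute because partial derivatives do: at a given jet they may be computed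
along a function which has that jet to the required order. -/
theorem totalD_comm (hD : IsRelOpen D) {F : JetSp m → ℝ} (hF : JetSmooth D F)
    (i j : Fin (m + 1)) :
    EqOn (totalD i (totalD j F)) (totalD j (totalD i F)) (jetDom D) := by
  intro z hz
  obtain ⟨k, hk⟩ := hF
  have hF : JetSmooth D F := ⟨k, hk⟩
  obtain ⟨f, W, hf, hW, hzW, hfD, hfz⟩ := exists_prolong_eq hD hz (k + 1 + 1)
  have hx : z.1 ∈ W ∩ halfSpace m := ⟨hzW, hD.mem_halfSpace hz⟩
  have hz' := prolong_mem_jetDom (hfD _ hx)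
  have key : ∀ i j, totalD i (totalD j F) z = pdHalf i (pdHalf j fun x => F (prolong f x)) z.1 := by
    intro i j
    rw [← ((hk.totalD hD j).totalD hD i).eq_of_trunc_eq hfz hz' hz]
    rw [← pdHalf_congr hW (totalD_prolong hD hF hW hf.contDiffOn hfD j) i hx]
    exact totalD_prolong hD (hF.totalD hD j) hW hf.contDiffOn hfD i hx
  rw [key, key]
  exact pdHalf_comm hW (hF.comp_prolong hW hf.contDiffOn hfD) i j hx

theorem multiIter_totalD_add_single (hD : IsRelOpen D) {F : JetSp m → ℝ} (hF : JetSmooth D F)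
    (I : MIdx (m + 1)) (i : Fin (m + 1)) :
    EqOn (multiIter totalD (I + Pi.single i 1) F) (totalD i (multiIter totalD I F)) (jetDom D) :=
  multiIter_add_single (equivalence_eqOn _) (P := fun f => JetSmooth D f)
    (fun i _ h => h.totalD hD i) (fun i _ _ h _ e => totalD_congr hD h e i)
    (fun i j _ h => totalD_comm hD h i j) I i hF

/-- The tangential total derivatives `D_J`. -/
def tanD (J : MIdx m) (F : JetSp m → ℝ) : JetSp m → ℝ :=
  multiIter (fun i : Fin m => totalD i.succ) J F

theorem JetSmooth.tanD (hD : IsRelOpen D) {F : JetSp m → ℝ} (hF : JetSmooth D F)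
    (J : MIdx m) : JetSmooth D (tanD J F) :=
  multiIter_pred (P := fun f => JetSmooth D f) (fun i _ h => h.totalD hD i.succ) J hF

theorem tanD_add_single (hD : IsRelOpen D) {F : JetSp m → ℝ} (hF : JetSmooth D F)
    (J : MIdx m) (i : Fin m) :
    EqOn (tanD (J + Pi.single i 1) F) (totalD i.succ (tanD J F)) (jetDom D) :=
  multiIter_add_single (equivalence_eqOn _) (P := fun f => JetSmooth D f)
    (fun i _ h => h.totalD hD i.succ) (fun i _ _ h _ e => totalD_congr hD h e i.succ)
    (fun i j _ h => totalD_comm hD h i.succ j.succ) J i hF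

theorem iterate_totalD_zero_comm (hD : IsRelOpen D) {F : JetSp m → ℝ} (hF : JetSmooth D F)
    (i : Fin (m + 1)) (n : ℕ) :
    EqOn ((totalD 0)^[n] (totalD i F)) (totalD i ((totalD 0)^[n] F)) (jetDom D) :=
  iterate_comm_rel (equivalence_eqOn _) (P := fun f => JetSmooth D f)
    (fun _ h => h.totalD hD 0) (fun _ h => h.totalD hD i)
    (fun _ _ h _ e => totalD_congr hD h e 0) (fun _ h => totalD_comm hD h 0 i) n hF

theorem iterate_totalD_tanD (hD : IsRelOpen D) {F : JetSp m → ℝ} (hF : JetSmooth D F)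
    (J : MIdx m) (n : ℕ) :
    EqOn ((totalD 0)^[n] (tanD J F)) (tanD J ((totalD 0)^[n] F)) (jetDom D) := by
  exact comm_multiIter_rel (equivalence_eqOn _) (P := fun f => JetSmooth D f)
    (fun i _ h => h.totalD hD i.succ) (fun _ h => h.iterate_totalD hD 0 n)
    (fun i _ _ h _ e => totalD_congr hD h e i.succ)
    (fun i _ h => iterate_totalD_zero_comm hD h i.succ n) J hF

theorem tanD_multiIter (hD : IsRelOpen D) {F : JetSp m → ℝ} (hF : JetSmooth D F)
    (J : MIdx m) (I : MIdx (m + 1)) :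
    EqOn (tanD J (multiIter totalD I F)) (multiIter totalD (I + Fin.cons 0 J) F) (jetDom D) := by
  induction J using midx_induction with
  | h0 =>
    have : (Fin.cons 0 0 : MIdx (m + 1)) = 0 := by
      funext j; refine Fin.cases ?_ (fun j => ?_) j <;> simp
    rw [this, add_zero]
    simp only [tanD, multiIter_zero]
    exact eqOn_refl _ _
  | hs J i ih =>
    have : (I + Fin.cons 0 (J + Pi.single i 1) : MIdx (m + 1)) =
        (I + Fin.cons 0 J) + Pi.single i.succ 1 := by
      funext j
      refine Fin.cases ?_ (fun j => ?_) j
      · simp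
      · simp [Pi.single_apply, add_assoc]
    rw [this]
    refine (tanD_add_single hD (hF.multiIter_totalD hD I) J i).trans ?_
    refine (totalD_congr hD ((hF.multiIter_totalD hD I).tanD hD J) ih i.succ).trans ?_
    exact (multiIter_totalD_add_single hD hF _ i.succ).symm

theorem multiIter_totalD_single_zero (F : JetSp m → ℝ) (n : ℕ) :
    multiIter totalD (Pi.single 0 n) F = (totalD 0)^[n] F := by
  rw [multiIter_succ]
  have : Fin.tail (Pi.single 0 n : MIdx (m + 1)) = 0 := by
    funext j; simp [Fin.tail]
  rw [this, multiIter_zero]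
  simp

/-- `D_I = D_{I'} ∘ D_0 ^ I_0`: the normal derivatives may be taken first. -/
theorem multiIter_totalD_eq_tanD (hD : IsRelOpen D) {F : JetSp m → ℝ} (hF : JetSmooth D F)
    (I : MIdx (m + 1)) :
    EqOn (multiIter totalD I F) (tanD (Fin.tail I) ((totalD 0)^[I 0] F)) (jetDom D) := by
  have h := tanD_multiIter hD hF (Fin.tail I) (Pi.single 0 (I 0))
  have : (Pi.single 0 (I 0) + Fin.cons 0 (Fin.tail I) : MIdx (m + 1)) = I := by
    funext j
    refine Fin.cases ?_ (fun j => ?_) j <;> simp [Fin.tail]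
  rw [this, multiIter_totalD_single_zero] at h
  exact h.symm

end Realize

/-! ### Total differential operators modulo coboundaries: existence of the relative Euler class -/

section Existence

variable {m : ℕ} {D : Set ((Fin (m + 1) → ℝ) × ℝ)}

/-- `P` acts on smooth functions over `D` as a total differential operator. -/
def IsTDO (D : Set ((Fin (m + 1) → ℝ) × ℝ)) (P : (JetSp m → ℝ) → JetSp m → ℝ) : Prop :=
  ∃ R : TotalDiffOp D, ∀ F, JetSmooth D F → EqOn (P F) (R.app F) (jetDom D)

theorem isTDO_monomial {a : JetSp m → ℝ} (ha : JetSmooth D a) (I : MIdx (m + 1)) :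
    IsTDO D (fun F z => a z * multiIter totalD I F z) := by
  classical
  refine ⟨⟨mlen I, fun J => if J = I then a else fun _ => 0, fun J => ?_⟩, fun F _ z _ => ?_⟩
  · split_ifs
    · exact ha
    · exact jetSmooth_const 0
  · simp only [TotalDiffOp.app]
    rw [Finset.sum_eq_single I]
    · simp
    · intro J _ hJ
      simp [hJ]
    · intro h
      exact absurd (mem_midxLE.2 le_rfl) h

theorem IsTDO.add {P Q : (JetSp m → ℝ) → JetSp m → ℝ} (hP : IsTDO D P) (hQ : IsTDO D Q) :
    IsTDO D (fun F z => P F z + Q F z) := by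
  classical
  obtain ⟨R, hR⟩ := hP
  obtain ⟨S, hS⟩ := hQ
  have aux : ∀ (T : TotalDiffOp D) (N : ℕ), T.order ≤ N → ∀ F z, T.app F z =
      ∑ I ∈ midxLE (m + 1) N, (if mlen I ≤ T.order then T.coeff I else fun _ => 0) z *
        multiIter totalD I F z := by
    intro T N hN F z
    have hsub : midxLE (m + 1) T.order ⊆ midxLE (m + 1) N := fun I hI =>
      mem_midxLE.2 ((mem_midxLE.1 hI).trans hN)
    rw [← Finset.sum_subset hsub]
    · refine Finset.sum_congr rfl fun I hI => ?_
      rw [if_pos (mem_midxLE.1 hI)]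
    · intro I _ hI
      rw [if_neg (fun h => hI (mem_midxLE.2 h)), zero_mul]
  refine ⟨⟨max R.order S.order, fun I z => (if mlen I ≤ R.order then R.coeff I else fun _ => 0) z +
    (if mlen I ≤ S.order then S.coeff I else fun _ => 0) z, fun I => ?_⟩, fun F hF z hz => ?_⟩
  · refine JetSmooth.add ?_ ?_
    · split_ifs
      · exact R.smooth I
      · exact jetSmooth_const 0
    · split_ifs
      · exact S.smooth I
      · exact jetSmooth_const 0
  · simp only
    rw [hR F hF hz, hS F hF hz, aux R _ (le_max_left _ S.order), aux S _ (le_max_right R.order _),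
      ← Finset.sum_add_distrib]
    refine Finset.sum_congr rfl fun I _ => ?_
    ring

theorem isTDO_zero : IsTDO D (fun _ _ => 0) :=
  ⟨⟨0, fun _ _ => 0, fun _ => jetSmooth_const 0⟩, fun F _ z _ => by simp [TotalDiffOp.app]⟩

theorem TotalDiffOp.app_smooth (hD : IsRelOpen D) (R : TotalDiffOp D) {F : JetSp m → ℝ}
    (hF : JetSmooth D F) : JetSmooth D (R.app F) :=
  JetSmooth.sum _ fun I _ => (R.smooth I).mul (hF.multiIter_totalD hD I)

theorem IsTDO.smooth (hD : IsRelOpen D) {P : (JetSp m → ℝ) → JetSp m → ℝ} (hP : IsTDO D P)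
    {F : JetSp m → ℝ} (hF : JetSmooth D F) : JetSmooth D (P F) :=
  let ⟨R, hR⟩ := hP
  (R.app_smooth hD hF).congr (hR F hF)

/-- `P` is the Spencer differential of a form without normal component: `P = ∑ D_i ∘ Q_i`, the
sum over the tangential directions. -/
def IsTangCob (D : Set ((Fin (m + 1) → ℝ) × ℝ)) (P : (JetSp m → ℝ) → JetSp m → ℝ) : Prop :=
  ∃ Q : Fin m → (JetSp m → ℝ) → JetSp m → ℝ, (∀ i, IsTDO D (Q i)) ∧
    ∀ F, JetSmooth D F → ∀ z ∈ jetDom D, P F z = ∑ i : Fin m, totalD i.succ (Q i F) z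

theorem IsTangCob.congr {P P' : (JetSp m → ℝ) → JetSp m → ℝ} (hP : IsTangCob D P)
    (h : ∀ F, JetSmooth D F → ∀ z ∈ jetDom D, P' F z = P F z) : IsTangCob D P' :=
  let ⟨Q, hQ, hP⟩ := hP
  ⟨Q, hQ, fun F hF z hz => (h F hF z hz).trans (hP F hF z hz)⟩

theorem isTangCob_zero : IsTangCob D (fun _ _ => 0) :=
  ⟨fun _ _ _ => 0, fun _ => isTDO_zero, fun F _ z _ => by simp [totalD_const]⟩

theorem IsTangCob.add (hD : IsRelOpen D) {P P' : (JetSp m → ℝ) → JetSp m → ℝ}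
    (hP : IsTangCob D P) (hP' : IsTangCob D P') : IsTangCob D (fun F z => P F z + P' F z) := by
  obtain ⟨Q, hQ, hP⟩ := hP
  obtain ⟨Q', hQ', hP'⟩ := hP'
  refine ⟨fun i F z => Q i F z + Q' i F z, fun i => (hQ i).add (hQ' i), fun F hF z hz => ?_⟩
  simp only
  rw [hP F hF z hz, hP' F hF z hz, ← Finset.sum_add_distrib]
  exact Finset.sum_congr rfl fun i _ =>
    (totalD_add hD ((hQ i).smooth hD hF) ((hQ' i).smooth hD hF) _ hz).symm

theorem IsTangCob.sum (hD : IsRelOpen D) {ι : Type*} (s : Finset ι)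
    {P : ι → (JetSp m → ℝ) → JetSp m → ℝ} (hP : ∀ i ∈ s, IsTangCob D (P i)) :
    IsTangCob D (fun F z => ∑ i ∈ s, P i F z) := by
  classical
  induction s using Finset.induction_on with
  | empty => simpa using isTangCob_zero
  | insert a s ha ih =>
    simp only [Finset.sum_insert ha]
    exact (hP a (by simp)).add hD (ih fun i hi => hP i (by simp [hi]))

theorem isTangCob_totalD {a : JetSp m → ℝ} (ha : JetSmooth D a) (I : MIdx (m + 1)) (i : Fin m) :
    IsTangCob D (fun F => totalD i.succ (fun z => a z * multiIter totalD I F z)) := by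
  classical
  refine ⟨fun j => if j = i then fun F z => a z * multiIter totalD I F z else fun _ _ => 0,
    fun j => ?_, fun F _ z _ => ?_⟩
  · beta_reduce
    split_ifs
    · exact isTDO_monomial ha I
    · exact isTDO_zero
  · rw [Finset.sum_eq_single i]
    · simp
    · intro j _ hj
      simp [hj, totalD_const]
    · simp

/-- Integration by parts in the tangential directions. -/
theorem isTangCob_tanD (hD : IsRelOpen D) (J : MIdx m) (I : MIdx (m + 1)) :
    ∀ {a : JetSp m → ℝ}, JetSmooth D a → IsTangCob D (fun F z =>
      a z * tanD J (multiIter totalD I F) z -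
        (-1) ^ mlen J * (tanD J a z * multiIter totalD I F z)) := by
  induction J using midx_induction with
  | h0 =>
    intro a _
    refine isTangCob_zero.congr fun F _ z _ => ?_
    simp [tanD, multiIter_zero, mlen_zero]
  | hs J i ih =>
    intro a ha
    have hneg : JetSmooth D fun z => (-1) * totalD i.succ a z :=
      (jetSmooth_const (-1)).mul (ha.totalD hD i.succ)
    refine ((isTangCob_totalD ha (I + Fin.cons 0 J) i).add hD (ih hneg)).congr fun F hF z hz => ?_
    have h1 := tanD_multiIter hD hF J I
    have hG := (hF.multiIter_totalD hD I).tanD hD J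
    have h2 : totalD i.succ (fun z => a z * multiIter totalD (I + Fin.cons 0 J) F z) z =
        a z * totalD i.succ (tanD J (multiIter totalD I F)) z +
          totalD i.succ a z * tanD J (multiIter totalD I F) z := by
      rw [totalD_mul hD ha (hF.multiIter_totalD hD _) _ hz, ← totalD_congr hD hG h1 _ hz, h1 hz]
    have h3 : tanD J (fun z => (-1) * totalD i.succ a z) z = - tanD J (totalD i.succ a) z := by
      have := multiIter_rel (D := fun i : Fin m => totalD i.succ) (D' := fun i : Fin m =>
        totalD i.succ) (R := fun F G => JetSmooth D G ∧ EqOn F (fun z => (-1) * G z) (jetDom D))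
        (fun i F G h => ⟨h.1.totalD hD i.succ, fun z hz => by
          have h0 : JetSmooth D fun z => (-1) * G z := (jetSmooth_const (-1)).mul h.1
          rw [← totalD_congr hD h0 h.2.symm i.succ hz, totalD_const_mul hD _ h.1 _ hz]⟩) J
        (a := fun z => (-1) * totalD i.succ a z) (b := totalD i.succ a)
        ⟨ha.totalD hD i.succ, eqOn_refl _ _⟩
      rw [tanD, this.2 hz, tanD]
      ring
    have h4 : tanD (J + Pi.single i 1) a z = tanD J (totalD i.succ a) z := by
      rw [tanD_add_single hD ha J i hz]
      exact comm_multiIter_rel (equivalence_eqOn _) (P := fun f => JetSmooth D f)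
        (fun i _ h => h.totalD hD i.succ) (fun _ h => h.totalD hD i.succ)
        (fun i _ _ h _ e => totalD_congr hD h e i.succ)
        (fun j _ h => totalD_comm hD h i.succ j.succ) J ha hz
    rw [tanD_add_single hD (hF.multiIter_totalD hD I) J i hz, h2, h3, h4, mlen_add, mlen_single,
      pow_succ]
    ring

/-- Integration by parts in the normal direction. -/
theorem mul_iterate_totalD (hD : IsRelOpen D) {G : JetSp m → ℝ} (hG : JetSmooth D G) (k : ℕ) :
    ∀ {c : JetSp m → ℝ}, JetSmooth D c → ∀ z ∈ jetDom D,
      c z * (totalD 0)^[k] G z =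
        ∑ α ∈ Finset.range k, (-1) ^ (k - 1 - α) *
          totalD 0 (fun y => (totalD 0)^[k - 1 - α] c y * (totalD 0)^[α] G y) z +
        (-1) ^ k * ((totalD 0)^[k] c z * G z) := by
  induction k with
  | zero => intro c _ z _; simp
  | succ k ih =>
    intro c hc z hz
    have h1 := totalD_mul hD hc (hG.iterate_totalD hD 0 k) 0 hz
    have h2 := ih (hc.totalD hD 0) z hz
    rw [Finset.sum_range_succ, Function.iterate_succ_apply', Function.iterate_succ_apply]
    have h3 : ∑ α ∈ Finset.range k, (-1 : ℝ) ^ (k + 1 - 1 - α) *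
          totalD 0 (fun y => (totalD 0)^[k + 1 - 1 - α] c y * (totalD 0)^[α] G y) z =
        - ∑ α ∈ Finset.range k, (-1 : ℝ) ^ (k - 1 - α) *
          totalD 0 (fun y => (totalD 0)^[k - 1 - α] (totalD 0 c) y * (totalD 0)^[α] G y) z := by
      rw [← Finset.sum_neg_distrib]
      refine Finset.sum_congr rfl fun α hα => ?_
      have : k + 1 - 1 - α = (k - 1 - α) + 1 := by
        have := Finset.mem_range.1 hα
        omega
      rw [this, pow_succ]
      simp only [Function.iterate_succ_apply]
      ring
    rw [h3]
    simp only [show k + 1 - 1 - k = 0 by omega, pow_zero, one_mul, Function.iterate_zero, id]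
    rw [h1, pow_succ]
    linear_combination -h2

/-- The coefficients
`∑_{I_0 > α} (-1)^(|I|-α-1) D_{I'} D_0^(I_0-α-1) (∂𝓛/∂u_I)` of the boundary component of the
relative Euler class. -/
def bdryCoeff (r : ℕ) (𝓛 : JetSp m → ℝ) (α : ℕ) (z : JetSp m) : ℝ :=
  ∑ I ∈ (midxLE (m + 1) r).filter (fun I => α < I 0),
    (-1 : ℝ) ^ (mlen I - α - 1) * tanD (Fin.tail I) ((totalD 0)^[I 0 - α - 1] (pdU I 𝓛)) z

/-- The Euler–Lagrange expression of `𝓛`. -/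
def eulerCoeff (r : ℕ) (𝓛 : JetSp m → ℝ) (z : JetSp m) : ℝ :=
  ∑ I ∈ midxLE (m + 1) r,
    (-1 : ℝ) ^ mlen I * (totalD 0)^[I 0] (tanD (Fin.tail I) (pdU I 𝓛)) z

theorem bdryCoeff_smooth (hD : IsRelOpen D) {𝓛 : JetSp m → ℝ} (h : JetSmooth D 𝓛) (r α : ℕ) :
    JetSmooth D (bdryCoeff r 𝓛 α) :=
  JetSmooth.sum _ fun I _ => (jetSmooth_const _).mul
    (((h.pdU hD I).iterate_totalD hD 0 _).tanD hD _)

theorem eulerCoeff_smooth (hD : IsRelOpen D) {𝓛 : JetSp m → ℝ} (h : JetSmooth D 𝓛) (r : ℕ) :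
    JetSmooth D (eulerCoeff r 𝓛) :=
  JetSmooth.sum _ fun I _ => (jetSmooth_const _).mul
    (((h.pdU hD I).tanD hD _).iterate_totalD hD 0 _)

theorem sameRelClass_of_isTangCob {P Q : (JetSp m → ℝ) → JetSp m → ℝ}
    (h : IsTangCob D (fun F z => P F z - Q F z)) (hD : IsRelOpen D) : SameRelClass D P Q := by
  obtain ⟨T, hT, h⟩ := h
  choose R hR using hT
  refine ⟨Fin.cons ⟨0, fun _ _ => 0, fun _ => jetSmooth_const 0⟩ R, fun I z _ _ => rfl,
    fun F hF z hz => ?_⟩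
  refine (h F hF z hz).trans ?_
  rw [Fin.sum_univ_succ]
  have h0 : totalD 0 ((Fin.cons (α := fun _ => TotalDiffOp D)
      ⟨0, fun _ _ => 0, fun _ => jetSmooth_const 0⟩ R 0).app F) z = 0 := by
    have : (TotalDiffOp.app (D := D) ⟨0, fun _ _ => 0, fun _ => jetSmooth_const 0⟩ F) =
        fun _ => 0 := by
      funext; simp [TotalDiffOp.app]
    rw [Fin.cons_zero, this, totalD_const]
  rw [h0, zero_add]
  refine Finset.sum_congr rfl fun i _ => ?_
  rw [Fin.cons_succ]
  exact totalD_congr hD ((R i).app_smooth hD hF |>.congr (hR i F hF)) (hR i F hF) _ hz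

/-- Integration by parts brings the linearization to the normal form `E + ∑ D_0 ∘ b_α ∘ D_0^α`. The
tangential steps only use coboundaries without normal component; the normal steps leave the boundary
terms `D_0 ∘ b_α ∘ D_0^α`. -/
theorem sameRelClass_linearization (hD : IsRelOpen D) {𝓛 : JetSp m → ℝ} (h : JetSmooth D 𝓛)
    (r : ℕ) : SameRelClass D (linearization r 𝓛) (fun F z => eulerCoeff r 𝓛 z * F z +
      ∑ α ∈ Finset.range r, totalD 0 (fun y => bdryCoeff r 𝓛 α y * (totalD 0)^[α] F y) z) := by
  classical
  refine sameRelClass_of_isTangCob ?_ hD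
  refine (IsTangCob.sum hD (midxLE (m + 1) r) fun I _ =>
    isTangCob_tanD hD (Fin.tail I) (Pi.single 0 (I 0)) (h.pdU hD I)).congr fun F hF z hz => ?_
  rw [Finset.sum_sub_distrib]
  congr 1
  · unfold linearization
    refine Finset.sum_congr rfl fun I _ => ?_
    rw [multiIter_totalD_eq_tanD hD hF I hz, multiIter_totalD_single_zero]
  · have h1 : ∀ I ∈ midxLE (m + 1) r, (-1 : ℝ) ^ mlen (Fin.tail I) *
        (tanD (Fin.tail I) (pdU I 𝓛) z * multiIter totalD (Pi.single 0 (I 0)) F z) =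
        (-1 : ℝ) ^ mlen I * (totalD 0)^[I 0] (tanD (Fin.tail I) (pdU I 𝓛)) z * F z +
        ∑ α ∈ Finset.range r, if α < I 0 then (-1 : ℝ) ^ (mlen I - α - 1) * totalD 0 (fun y =>
          tanD (Fin.tail I) ((totalD 0)^[I 0 - α - 1] (pdU I 𝓛)) y * (totalD 0)^[α] F y) z
          else 0 := by
      intro I hI
      rw [multiIter_totalD_single_zero,
        mul_iterate_totalD hD hF (I 0) ((h.pdU hD I).tanD hD _) z hz, mlen_succ I, pow_add,
        mul_add, ← Finset.sum_filter]
      have hr : (Finset.range r).filter (fun α => α < I 0) = Finset.range (I 0) := by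
        ext α
        have := (le_mlen I 0).trans (mem_midxLE.1 hI)
        simp only [Finset.mem_filter, Finset.mem_range]
        omega
      rw [hr, Finset.mul_sum, add_comm]
      congr 1
      · ring
      · refine Finset.sum_congr rfl fun α hα => ?_
        have hα := Finset.mem_range.1 hα
        have h2 : I 0 + mlen (Fin.tail I) - α - 1 = mlen (Fin.tail I) + (I 0 - 1 - α) := by omega
        rw [h2, pow_add, mul_assoc]
        have h3 : I 0 - α - 1 = I 0 - 1 - α := by omega
        rw [h3]
        congr 2
        refine totalD_congr hD ((((h.pdU hD I).tanD hD _).iterate_totalD hD 0 _).mul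
          (hF.iterate_totalD hD 0 α)) (fun y hy => ?_) 0 hz
        simp only
        rw [iterate_totalD_tanD hD (h.pdU hD I) _ _ hy]
    rw [Finset.sum_congr rfl h1, Finset.sum_add_distrib, eulerCoeff, Finset.sum_mul,
      Finset.sum_comm]
    congr 1
    refine Finset.sum_congr rfl fun α _ => ?_
    rw [← Finset.sum_filter]
    have h4 : (fun y => bdryCoeff r 𝓛 α y * (totalD 0)^[α] F y) = fun y =>
        ∑ I ∈ (midxLE (m + 1) r).filter (fun I => α < I 0), (-1 : ℝ) ^ (mlen I - α - 1) *
          (tanD (Fin.tail I) ((totalD 0)^[I 0 - α - 1] (pdU I 𝓛)) y * (totalD 0)^[α] F y) := by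
      funext y
      rw [bdryCoeff, Finset.sum_mul]
      exact Finset.sum_congr rfl fun I _ => by ring
    have hs : ∀ I : MIdx (m + 1), JetSmooth D fun y =>
        tanD (Fin.tail I) ((totalD 0)^[I 0 - α - 1] (pdU I 𝓛)) y * (totalD 0)^[α] F y := fun I =>
      (((h.pdU hD I).iterate_totalD hD 0 _).tanD hD _).mul (hF.iterate_totalD hD 0 α)
    rw [h4, totalD_sum hD _ (fun I _ => (jetSmooth_const _).mul (hs I)) 0 hz]
    exact Finset.sum_congr rfl fun I _ => totalD_const_mul hD _ (hs I) 0 hz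

theorem exists_isRelEuler (hD : IsRelOpen D) {𝓛 : JetSp m → ℝ} (h : JetSmooth D 𝓛) (r : ℕ) :
    IsRelEuler D r 𝓛 (eulerCoeff r 𝓛)
      (fun w => ∑ α ∈ Finset.range r, bdryCoeff r 𝓛 α (ofNormalJet w) • contactTop α w) :=
  ⟨eulerCoeff_smooth hD h r, r, bdryCoeff r 𝓛, bdryCoeff_smooth hD h r,
    sameRelClass_linearization hD h r, fun _ _ => rfl⟩

end Existence

/-! ### Jets along the boundary -/

section Boundary

variable {m : ℕ} {W : Set (Fin (m + 1) → ℝ)} {D : Set ((Fin (m + 1) → ℝ) × ℝ)}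

theorem pdHalf_succ_cons (g : (Fin (m + 1) → ℝ) → ℝ) (i : Fin m) (t : Fin m → ℝ) :
    pdHalf i.succ g (Fin.cons 0 t) = pd i (fun t => g (Fin.cons 0 t)) t := by
  have : axis i.succ = univ := if_neg (Fin.succ_ne_zero i)
  simp [pdHalf, pd, this, Fin.cons_update]

theorem multiIter_pd_cons (J : MIdx m) (g : (Fin (m + 1) → ℝ) → ℝ) (t : Fin m → ℝ) :
    multiIter pd J (fun t => g (Fin.cons 0 t)) t =
      multiIter (fun i : Fin m => pdHalf i.succ) J g (Fin.cons 0 t) :=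
  congrFun (multiIter_rel (D := pd) (D' := fun i : Fin m => pdHalf i.succ)
    (R := fun h g => h = fun t => g (Fin.cons 0 t))
    (fun i h g e => by subst e; funext t; exact (pdHalf_succ_cons g i t).symm) J rfl) t

theorem multiIter_pdHalf_eq_tan (hW : IsOpen W) {f : (Fin (m + 1) → ℝ) → ℝ}
    (hf : ContDiffOn ℝ ∞ f (W ∩ halfSpace m)) (I : MIdx (m + 1)) :
    EqOn (multiIter pdHalf I f)
      (multiIter (fun i : Fin m => pdHalf i.succ) (Fin.tail I) ((pdHalf 0)^[I 0] f))
      (W ∩ halfSpace m) := by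
  rw [multiIter_succ]
  exact comm_multiIter_rel (equivalence_eqOn _)
    (P := fun f => ContDiffOn ℝ ∞ f (W ∩ halfSpace m))
    (fun i _ h => contDiffOn_pdHalf hW h i.succ) (fun _ h => contDiffOn_iterate_pdHalf hW h 0 _)
    (fun i _ _ _ _ e => pdHalf_congr hW e i.succ)
    (fun i _ h => iterate_comm_rel (equivalence_eqOn _)
      (P := fun f => ContDiffOn ℝ ∞ f (W ∩ halfSpace m))
      (fun _ h => contDiffOn_pdHalf hW h 0) (fun _ h => contDiffOn_pdHalf hW h i.succ)
      (fun _ _ _ _ e => pdHalf_congr hW e 0) (fun _ h => pdHalf_comm hW h 0 i.succ) _ h) _ hf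

/-- At a boundary point, tangential derivatives of the normal derivatives are all the derivatives. -/
theorem ofNormalJet_boundaryJet (hW : IsOpen W) {f : (Fin (m + 1) → ℝ) → ℝ}
    (hf : ContDiffOn ℝ ∞ f (W ∩ halfSpace m)) {t : Fin m → ℝ}
    (ht : (Fin.cons 0 t : Fin (m + 1) → ℝ) ∈ W) :
    ofNormalJet (boundaryJet f t) = prolong f (Fin.cons 0 t) := by
  refine Prod.ext rfl ?_
  funext I
  change multiIter pd (Fin.tail I) (fun t => (pdHalf 0)^[I 0] f (Fin.cons 0 t)) t =
    multiIter pdHalf I f (Fin.cons 0 t)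
  rw [multiIter_pdHalf_eq_tan hW hf I ⟨ht, show (0 : ℝ) ≤ _ by simp⟩, multiIter_pd_cons]

theorem tanD_prolong (hD : IsRelOpen D) {F : JetSp m → ℝ} (hF : JetSmooth D F)
    (hW : IsOpen W) {f : (Fin (m + 1) → ℝ) → ℝ} (hf : ContDiffOn ℝ ∞ f (W ∩ halfSpace m))
    (hfD : ∀ x ∈ W ∩ halfSpace m, (x, f x) ∈ D) (J : MIdx m) :
    EqOn (fun x => tanD J F (prolong f x))
      (multiIter (fun i : Fin m => pdHalf i.succ) J (fun x => F (prolong f x)))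
      (W ∩ halfSpace m) :=
  (multiIter_rel (D := fun i : Fin m => totalD i.succ) (D' := fun i : Fin m => pdHalf i.succ)
    (R := fun F h => JetSmooth D F ∧ EqOn (fun x => F (prolong f x)) h (W ∩ halfSpace m))
    (fun i _ _ hF => ⟨hF.1.totalD hD i.succ,
      (totalD_prolong hD hF.1 hW hf hfD i.succ).trans (pdHalf_congr hW hF.2 i.succ)⟩) J
    (a := F) (b := fun x => F (prolong f x)) ⟨hF, eqOn_refl _ _⟩).2

/-- Along the jets of a function, the boundary coefficients are given by the formula in terms of
iterated partial derivatives. -/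
theorem bdryCoeff_prolong (hD : IsRelOpen D) {𝓛 : JetSp m → ℝ} (h : JetSmooth D 𝓛)
    (hW : IsOpen W) {f : (Fin (m + 1) → ℝ) → ℝ} (hf : ContDiffOn ℝ ∞ f (W ∩ halfSpace m))
    (hfD : ∀ x ∈ W ∩ halfSpace m, (x, f x) ∈ D) (r α : ℕ) {t : Fin m → ℝ}
    (ht : (Fin.cons 0 t : Fin (m + 1) → ℝ) ∈ W) :
    bdryCoeff r 𝓛 α (prolong f (Fin.cons 0 t)) = boundaryExpr r α 𝓛 f t := by
  have ht' : (Fin.cons 0 t : Fin (m + 1) → ℝ) ∈ W ∩ halfSpace m :=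
    ⟨ht, show (0 : ℝ) ≤ _ by simp⟩
  refine Finset.sum_congr rfl fun I _ => ?_
  rw [multiIter_pd_cons]
  congr 1
  refine (tanD_prolong hD ((h.pdU hD I).iterate_totalD hD 0 _) hW hf hfD _ ht').trans ?_
  exact (multiIter_rel (D := fun i : Fin m => pdHalf i.succ) (D' := fun i : Fin m => pdHalf i.succ)
    (R := fun f g => EqOn f g (W ∩ halfSpace m))
    (fun i _ _ h => pdHalf_congr hW h i.succ) (Fin.tail I)
    (iterate_totalD_prolong hD (h.pdU hD I) hW hf hfD 0 _)) ht'

end Boundary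

/-! ### Integration by parts on half-cubes and the fundamental lemma -/

section Integration

open MeasureTheory Metric

variable {m : ℕ} {W : Set (Fin (m + 1) → ℝ)}

/-- The half-cube of radius `δ` centred at a boundary point; the closed balls of the product norm
are cubes. -/
def halfCube (x₀ : Fin (m + 1) → ℝ) (δ : ℝ) : Set (Fin (m + 1) → ℝ) :=
  closedBall x₀ δ ∩ halfSpace m

theorem cons_zero_tail {x₀ : Fin (m + 1) → ℝ} (hx₀ : x₀ 0 = 0) :
    (Fin.cons 0 (Fin.tail x₀) : Fin (m + 1) → ℝ) = x₀ := by
  funext j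
  refine Fin.cases ?_ (fun j => ?_) j
  · simp [hx₀]
  · simp [Fin.tail]

theorem halfCube_eq_Icc {x₀ : Fin (m + 1) → ℝ} (hx₀ : x₀ 0 = 0) {δ : ℝ} (hδ : 0 < δ) :
    halfCube x₀ δ = Icc (Fin.cons 0 fun i => x₀ i.succ - δ : Fin (m + 1) → ℝ)
      (fun i => x₀ i + δ) := by
  ext x
  simp only [halfCube, halfSpace, mem_inter_iff, mem_closedBall, mem_ofPred_eq, mem_Icc,
    dist_pi_le_iff hδ.le, Real.dist_eq, abs_le, Pi.le_def, Fin.forall_fin_succ, Fin.cons_zero,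
    Fin.cons_succ, hx₀]
  constructor
  · rintro ⟨⟨h1, h2⟩, h3⟩
    exact ⟨⟨h3, fun i => by linarith [(h2 i).1]⟩, by linarith [h1.2],
      fun i => by linarith [(h2 i).2]⟩
  · rintro ⟨⟨h1, h2⟩, h3, h4⟩
    exact ⟨⟨⟨by linarith, by linarith⟩, fun i => ⟨by linarith [h2 i], by linarith [h4 i]⟩⟩, h1⟩

theorem isCompact_halfCube (x₀ : Fin (m + 1) → ℝ) (δ : ℝ) : IsCompact (halfCube x₀ δ) :=
  (isCompact_closedBall x₀ δ).inter_right isClosed_halfSpace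

theorem measurableSet_halfCube (x₀ : Fin (m + 1) → ℝ) (δ : ℝ) : MeasurableSet (halfCube x₀ δ) :=
  (isCompact_halfCube x₀ δ).measurableSet

theorem closedBall_tail_eq_Icc (x₀ : Fin (m + 1) → ℝ) {δ : ℝ} (hδ : 0 < δ) :
    closedBall (Fin.tail x₀) δ = Icc (fun i => x₀ i.succ - δ) (fun i => x₀ i.succ + δ) := by
  ext x
  simp only [mem_closedBall, dist_pi_le_iff hδ.le, Real.dist_eq, abs_le, mem_Icc, Pi.le_def,
    Fin.tail]
  constructor
  · intro h
    exact ⟨fun i => by linarith [(h i).1], fun i => by linarith [(h i).2]⟩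
  · rintro ⟨h1, h2⟩ i
    exact ⟨by linarith [h1 i], by linarith [h2 i]⟩

/-- The divergence theorem for functions vanishing off the open cube: only the face `x 0 = 0`
contributes, with the sign of its outward normal `-∂/∂x_0`. -/
theorem integral_pdHalf (hW : IsOpen W) {x₀ : Fin (m + 1) → ℝ} (hx₀ : x₀ 0 = 0) {δ : ℝ}
    (hδ : 0 < δ) (hδW : closedBall x₀ δ ⊆ W) {g : (Fin (m + 1) → ℝ) → ℝ}
    (hg : ContDiffOn ℝ ∞ g (W ∩ halfSpace m))
    (hg0 : ∀ x ∈ W ∩ halfSpace m, x ∉ ball x₀ δ → g x = 0) (i : Fin (m + 1)) :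
    ∫ x in halfCube x₀ δ, pdHalf i g x =
      if i = 0 then - ∫ t in closedBall (Fin.tail x₀) δ, g (Fin.cons 0 t) else 0 := by
  classical
  set a : Fin (m + 1) → ℝ := Fin.cons 0 fun i => x₀ i.succ - δ with ha
  set b : Fin (m + 1) → ℝ := fun i => x₀ i + δ with hb
  have hQ : halfCube x₀ δ = Icc a b := halfCube_eq_Icc hx₀ hδ
  have hsub : Icc a b ⊆ W ∩ halfSpace m := by
    rw [← hQ]; exact fun x hx => ⟨hδW hx.1, hx.2⟩
  have hle : a ≤ b := by
    intro j
    refine Fin.cases ?_ (fun j => ?_) j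
    · simp [ha, hb, hx₀, hδ.le]
    · simp only [ha, hb, Fin.cons_succ]; linarith
  have hdg : ∀ x ∈ W ∩ halfSpace m, DifferentiableWithinAt ℝ g (W ∩ halfSpace m) x :=
    hg.differentiableOn (by simp)
  have key := integral_divergence_of_hasFDerivAt_off_countable' a b hle
    (fun j => if j = i then g else fun _ => 0)
    (fun j x => if j = i then fderivWithin ℝ g (W ∩ halfSpace m) x else 0) ∅ countable_empty
    (by
      intro j
      split_ifs
      · exact hg.continuousOn.mono hsub
      · exact continuousOn_const)
    (by
      rintro x ⟨hx, -⟩ j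
      split_ifs
      · have hx' : ∀ j, a j < x j ∧ x j < b j := fun j => hx j (mem_univ j)
        have hxI : x ∈ Icc a b := ⟨fun j => (hx' j).1.le, fun j => (hx' j).2.le⟩
        have hpos : 0 < x 0 := by simpa [ha] using (hx' 0).1
        refine (hdg x (hsub hxI)).hasFDerivWithinAt.hasFDerivAt ?_
        exact inter_mem (hW.mem_nhds (hsub hxI).1)
          (mem_of_superset (isOpen_pos.mem_nhds hpos) fun y (hy : 0 < y 0) => hy.le)
      · exact hasFDerivAt_const _ _)
    (by
      have : ∀ x, ∑ j, (if j = i then fderivWithin ℝ g (W ∩ halfSpace m) x else 0)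
          (Pi.single j 1) = fderivWithin ℝ g (W ∩ halfSpace m) x (Pi.single i 1) := by
        intro x
        rw [Finset.sum_eq_single i] <;> simp +contextual
      simp only [this]
      refine ContinuousOn.integrableOn_compact isCompact_Icc ?_
      exact ((hg.continuousOn_fderivWithin (uniqueDiffOn_inter_halfSpace hW) (by simp)).mono
        hsub).clm_apply continuousOn_const)
  have h1 : ∫ x in Icc a b, ∑ j, (if j = i then fderivWithin ℝ g (W ∩ halfSpace m) x else 0)
      (Pi.single j 1) = ∫ x in Icc a b, pdHalf i g x := by
    refine setIntegral_congr_fun measurableSet_Icc fun x hx => ?_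
    rw [Finset.sum_eq_single i, if_pos rfl, pdHalf_eq_fderivWithin hW (hdg x (hsub hx)) (hsub hx)]
    · intro j _ hj; simp [hj]
    · simp
  have h2 : ∀ (j : Fin (m + 1)) (c : ℝ) (t : Fin m → ℝ), a j ≤ c → c ≤ b j → |c - x₀ j| = δ →
      t ∈ Icc (a ∘ j.succAbove) (b ∘ j.succAbove) → g (j.insertNth c t) = 0 := by
    intro j c t h1 h2 h3 ht
    have hm : (j.insertNth c t : Fin (m + 1) → ℝ) ∈ Icc a b :=
      Fin.insertNth_mem_Icc.2 ⟨⟨h1, h2⟩, ht⟩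
    refine hg0 _ (hsub hm) fun hball => ?_
    rw [mem_ball, dist_pi_lt_iff hδ] at hball
    have := hball j
    rw [Fin.insertNth_apply_same, Real.dist_eq, h3] at this
    exact lt_irrefl _ this
  rw [hQ, ← h1, key, Finset.sum_eq_single i]
  · have hfront : ∫ t in Icc (a ∘ i.succAbove) (b ∘ i.succAbove),
        (if i = i then g else fun _ => 0) (i.insertNth (b i) t) = 0 := by
      refine setIntegral_eq_zero_of_forall_eq_zero fun t ht => ?_
      rw [if_pos rfl]
      exact h2 i (b i) t (hle i) le_rfl (by simp [hb, abs_of_pos hδ]) ht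
    rw [hfront, zero_sub]
    simp only [if_true]
    split_ifs with hi
    · subst hi
      have ea : a ∘ Fin.succAbove 0 = fun i => x₀ i.succ - δ := by funext j; simp [ha]
      have eb : b ∘ Fin.succAbove 0 = fun i => x₀ i.succ + δ := by funext j; simp [hb]
      rw [closedBall_tail_eq_Icc x₀ hδ, ea, eb]
      simp [ha, Fin.insertNth_zero']
    · rw [neg_eq_zero]
      refine setIntegral_eq_zero_of_forall_eq_zero fun t ht => ?_
      refine h2 i (a i) t le_rfl (hle i) ?_ ht
      obtain ⟨j, rfl⟩ := Fin.exists_succ_eq.2 hi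
      simp [ha, abs_of_pos hδ]
  · intro j _ hj
    simp [hj]
  · simp

theorem iterate_pdHalf_eq_zero {v : (Fin (m + 1) → ℝ) → ℝ} (n : ℕ) {x : Fin (m + 1) → ℝ}
    (hx : x ∈ halfSpace m) (hv : x ∉ tsupport v) : (pdHalf 0)^[n] v x = 0 := by
  have h1 : EqOn v (fun _ => 0) ((tsupport v)ᶜ ∩ halfSpace m) := fun y hy =>
    image_eq_zero_of_notMem_tsupport hy.1
  have h2 : ∀ n, (pdHalf 0)^[n] (fun _ : Fin (m + 1) → ℝ => (0 : ℝ)) = fun _ => 0 := by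
    intro n
    induction n with
    | zero => rfl
    | succ n ih => rw [Function.iterate_succ_apply', ih]; funext y; simp [pdHalf]
  rw [iterate_pdHalf_congr (isClosed_tsupport v).isOpen_compl h1 0 n ⟨hv, hx⟩, h2]

theorem pdHalf_divPow_mul (β : ℕ) (w : (Fin m → ℝ) → ℝ) (α : ℕ) :
    EqOn ((pdHalf 0)^[α] fun x : Fin (m + 1) → ℝ => divPow β 0 (x 0) * w (Fin.tail x))
      (fun x => divPow β α (x 0) * w (Fin.tail x)) (univ ∩ halfSpace m) := by
  induction α with
  | zero => exact eqOn_refl _ _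
  | succ α ih =>
    rw [Function.iterate_succ_apply']
    refine (pdHalf_congr isOpen_univ ih 0).trans fun x hx => ?_
    have h1 : ∀ s, Fin.tail (Function.update x 0 s) = Fin.tail x := fun s => by
      funext j; simp [Fin.tail]
    have : HasDerivAt (fun s => divPow β α (Function.update x 0 s 0) *
        w (Fin.tail (Function.update x 0 s))) (divPow β (α + 1) (x 0) * w (Fin.tail x)) (x 0) := by
      simp only [Function.update_self, h1]
      exact (hasDerivAt_divPow β α (x 0)).mul_const _
    exact this.hasDerivWithinAt.derivWithin (uniqueDiffWithinAt_axis 0 (mem_axis hx.2 0))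

/-- The fundamental lemma of the calculus of variations for free boundary values: the normal
derivatives of a test function along the boundary are independent. -/
theorem eq_zero_of_forall_integral {x₀ : Fin (m + 1) → ℝ} (hx₀ : x₀ 0 = 0)
    {δ : ℝ} (hδ : 0 < δ) (hδW : closedBall x₀ δ ⊆ W) {E : (Fin (m + 1) → ℝ) → ℝ}
    (hE : ContinuousOn E (W ∩ halfSpace m)) {k : ℕ} {b : ℕ → (Fin (m + 1) → ℝ) → ℝ}
    (hb : ∀ α, ContinuousOn (b α) (W ∩ halfSpace m))
    (h : ∀ v : (Fin (m + 1) → ℝ) → ℝ, ContDiff ℝ ∞ v → tsupport v ⊆ ball x₀ δ →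
      ∫ x in halfCube x₀ δ, E x * v x = ∑ α ∈ Finset.range k,
        ∫ t in closedBall (Fin.tail x₀) δ, b α (Fin.cons 0 t) * (pdHalf 0)^[α] v (Fin.cons 0 t))
    {α : ℕ} (hα : α < k) : b α x₀ = 0 := by
  have hQW : halfCube x₀ δ ⊆ W ∩ halfSpace m := fun x hx => ⟨hδW hx.1, hx.2⟩
  have hcons : ∀ t : Fin m → ℝ, (Fin.cons 0 t : Fin (m + 1) → ℝ) ∈ halfSpace m :=
    fun t => show (0 : ℝ) ≤ _ by simp
  -- the interior term vanishes
  have hU : IsOpen (ball x₀ δ ∩ {x | 0 < x 0}) := isOpen_ball.inter isOpen_pos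
  have hUQ : ball x₀ δ ∩ {x | 0 < x 0} ⊆ halfCube x₀ δ := fun x hx =>
    ⟨ball_subset_closedBall hx.1, show 0 ≤ x 0 from le_of_lt hx.2⟩
  have hE0 : ∀ᵐ x, x ∈ ball x₀ δ ∩ {x | 0 < x 0} → E x = 0 := by
    refine hU.ae_eq_zero_of_integral_contDiff_smul_eq_zero
      ((hE.mono (hUQ.trans hQW)).locallyIntegrableOn hU.measurableSet) fun g hg _ hgs => ?_
    have h1 := h g hg (hgs.trans inter_subset_left)
    rw [Finset.sum_eq_zero] at h1
    · rw [← h1, ← setIntegral_eq_integral_of_forall_compl_eq_zero (s := halfCube x₀ δ)]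
      · simp only [smul_eq_mul, mul_comm]
      · intro x hx
        rw [image_eq_zero_of_notMem_tsupport fun hx' => hx (hUQ (hgs hx')), zero_smul]
    · intro β _
      refine setIntegral_eq_zero_of_forall_eq_zero fun t _ => ?_
      rw [iterate_pdHalf_eq_zero β (hcons t) fun ht => ?_, mul_zero]
      have := (hgs ht).2
      simp at this
  have hEv : ∀ v : (Fin (m + 1) → ℝ) → ℝ, tsupport v ⊆ ball x₀ δ →
      ∫ x in halfCube x₀ δ, E x * v x = 0 := by
    intro v hv
    refine (setIntegral_congr_ae (g := fun _ => 0) (measurableSet_halfCube x₀ δ) ?_).trans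
      (by simp)
    have hnull : ∀ᵐ x : Fin (m + 1) → ℝ, x 0 ≠ 0 := by
      rw [ae_iff]
      simpa [volume_pi] using
        Measure.pi_hyperplane (fun _ : Fin (m + 1) => (volume : Measure ℝ)) 0 0
    filter_upwards [hE0, hnull] with x hx hx0 hxQ
    by_cases hxv : x ∈ tsupport v
    · rw [hx ⟨hv hxv, lt_of_le_of_ne hxQ.2 (Ne.symm hx0)⟩, zero_mul]
    · rw [image_eq_zero_of_notMem_tsupport hxv, mul_zero]
  -- the boundary terms, tested with `x_0 ^ α / α! * w (x')` near the boundary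
  have hcont : Continuous fun t : Fin m → ℝ => (Fin.cons 0 t : Fin (m + 1) → ℝ) :=
    continuous_const.finCons continuous_id
  have hmaps : MapsTo (fun t : Fin m → ℝ => (Fin.cons 0 t : Fin (m + 1) → ℝ))
      (closedBall (Fin.tail x₀) δ) (W ∩ halfSpace m) := by
    intro t ht
    refine ⟨hδW ?_, hcons t⟩
    rw [mem_closedBall, dist_pi_le_iff hδ.le] at *
    refine Fin.forall_fin_succ.2 ⟨?_, fun i => ?_⟩
    · simp [hx₀, hδ.le]
    · simpa [Fin.tail] using ht i
  have hbc : ContinuousOn (fun t : Fin m → ℝ => b α (Fin.cons 0 t)) (ball (Fin.tail x₀) δ) :=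
    (hb α).comp hcont.continuousOn (hmaps.mono_left ball_subset_closedBall)
  have hae : ∀ᵐ t, t ∈ ball (Fin.tail x₀) δ → b α (Fin.cons 0 t) = 0 := by
    refine isOpen_ball.ae_eq_zero_of_integral_contDiff_smul_eq_zero
      (hbc.locallyIntegrableOn measurableSet_ball) fun w hw _ hws => ?_
    let χ : ContDiffBump (0 : ℝ) := ⟨δ / 4, δ / 2, by positivity, by linarith⟩
    set v : (Fin (m + 1) → ℝ) → ℝ := fun x => χ (x 0) * (divPow α 0 (x 0) * w (Fin.tail x))
      with hv
    have htail : ContDiff ℝ ∞ fun x : Fin (m + 1) → ℝ => Fin.tail x := by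
      unfold Fin.tail; fun_prop
    have hvc : ContDiff ℝ ∞ v :=
      (χ.contDiff.comp (contDiff_apply ℝ ℝ 0)).mul
        (((contDiff_divPow α 0).comp (contDiff_apply ℝ ℝ 0)).mul (hw.comp htail))
    have hvs : tsupport v ⊆ ball x₀ δ := by
      have h1 : tsupport v ⊆ {x | x 0 ∈ closedBall (0 : ℝ) (δ / 2) ∧ Fin.tail x ∈ tsupport w} := by
        have hcl : IsClosed ((fun x : Fin (m + 1) → ℝ => x 0) ⁻¹' closedBall (0 : ℝ) (δ / 2) ∩
            (fun x => Fin.tail x) ⁻¹' tsupport w) :=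
          (isClosed_closedBall.preimage (continuous_apply 0)).inter
            ((isClosed_tsupport w).preimage htail.continuous)
        refine closure_minimal (fun x hx => ⟨?_, ?_⟩) hcl
        · by_contra hx0
          refine hx ?_
          have : χ (x 0) = 0 := χ.zero_of_le_dist (not_le.1 hx0).le
          simp [hv, this]
        · by_contra hx0
          refine hx ?_
          simp [hv, image_eq_zero_of_notMem_tsupport hx0]
      intro x hx
      obtain ⟨h2, h3⟩ := h1 hx
      have h4 := hws h3
      rw [mem_ball, dist_pi_lt_iff hδ] at *
      refine Fin.forall_fin_succ.2 ⟨?_, fun i => h4 i⟩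
      rw [hx₀]
      exact lt_of_le_of_lt h2 (by linarith)
    have h1 := h v hvc hvs
    rw [hEv v hvs] at h1
    have h2 : ∀ β (t : Fin m → ℝ), (pdHalf 0)^[β] v (Fin.cons 0 t) =
        if α = β then w t else 0 := by
      intro β t
      have hO : IsOpen {x : Fin (m + 1) → ℝ | x 0 ∈ ball (0 : ℝ) (δ / 4)} :=
        isOpen_ball.preimage (continuous_apply 0)
      have h3 : EqOn v (fun x => divPow α 0 (x 0) * w (Fin.tail x))
          ({x : Fin (m + 1) → ℝ | x 0 ∈ ball (0 : ℝ) (δ / 4)} ∩ halfSpace m) := fun x hx => by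
        have : χ (x 0) = 1 := χ.one_of_mem_closedBall (ball_subset_closedBall hx.1)
        simp [hv, this]
      rw [iterate_pdHalf_congr hO h3 0 β ⟨by simp [hδ], hcons t⟩,
        pdHalf_divPow_mul α w β ⟨trivial, hcons t⟩]
      simp [divPow_zero]
    rw [Finset.sum_eq_single α] at h1
    · simp only [h2, if_true] at h1
      rw [setIntegral_eq_integral_of_forall_compl_eq_zero] at h1
      · simp only [smul_eq_mul, mul_comm (w _)]
        exact h1.symm
      · intro t ht
        rw [image_eq_zero_of_notMem_tsupport
          (fun h => ht (ball_subset_closedBall (hws h))), mul_zero]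
    · intro β _ hβ
      simp [h2, hβ.symm]
    · intro hα'
      exact absurd (Finset.mem_range.2 hα) hα'
  have hres : (fun t : Fin m → ℝ => b α (Fin.cons 0 t))
      =ᵐ[volume.restrict (ball (Fin.tail x₀) δ)] fun _ => 0 := by
    rw [Filter.EventuallyEq, ae_restrict_iff' measurableSet_ball]
    exact hae
  have := Measure.eqOn_open_of_ae_eq hres isOpen_ball hbc continuousOn_const
    (mem_ball_self hδ)
  simp only at this
  rwa [cons_zero_tail hx₀] at this

end Integration

/-! ### Uniqueness of the boundary component -/

section Uniqueness

open MeasureTheory Metric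

variable {m : ℕ} {W : Set (Fin (m + 1) → ℝ)} {D : Set ((Fin (m + 1) → ℝ) × ℝ)}

theorem multiIter_pdHalf_eq_zero {v : (Fin (m + 1) → ℝ) → ℝ} (I : MIdx (m + 1))
    {x : Fin (m + 1) → ℝ} (hx : x ∈ halfSpace m) (hv : x ∉ tsupport v) :
    multiIter pdHalf I v x = 0 := by
  have h1 : EqOn v (fun _ => 0) ((tsupport v)ᶜ ∩ halfSpace m) := fun y hy =>
    image_eq_zero_of_notMem_tsupport hy.1
  have h2 : multiIter pdHalf I (fun _ : Fin (m + 1) → ℝ => (0 : ℝ)) = fun _ => 0 :=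
    multiIter_pred (P := fun f : (Fin (m + 1) → ℝ) → ℝ => f = fun _ => 0)
      (fun i f hf => by subst hf; funext y; simp [pdHalf]) I rfl
  rw [multiIter_pdHalf_congr (isClosed_tsupport v).isOpen_compl h1 I ⟨hv, hx⟩, h2]

theorem JetSmooth.integrableOn_halfCube {F : JetSp m → ℝ} (hF : JetSmooth D F)
    (hW : IsOpen W) {f : (Fin (m + 1) → ℝ) → ℝ} (hf : ContDiffOn ℝ ∞ f (W ∩ halfSpace m))
    (hfD : ∀ x ∈ W ∩ halfSpace m, (x, f x) ∈ D) {x₀ : Fin (m + 1) → ℝ} {δ : ℝ}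
    (hδW : closedBall x₀ δ ⊆ W) :
    IntegrableOn (fun x => F (prolong f x)) (halfCube x₀ δ) :=
  ((hF.comp_prolong hW hf hfD).continuousOn.mono fun _ hx =>
    ⟨hδW hx.1, hx.2⟩).integrableOn_compact (isCompact_halfCube x₀ δ)

/-- Along a function, horizontal divergences integrate to boundary terms. -/
theorem integral_totalD (hD : IsRelOpen D) {F : JetSp m → ℝ} (hF : JetSmooth D F)
    (hW : IsOpen W) {f : (Fin (m + 1) → ℝ) → ℝ} (hf : ContDiffOn ℝ ∞ f (W ∩ halfSpace m))
    (hfD : ∀ x ∈ W ∩ halfSpace m, (x, f x) ∈ D) {x₀ : Fin (m + 1) → ℝ} (hx₀ : x₀ 0 = 0) {δ : ℝ}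
    (hδ : 0 < δ) (hδW : closedBall x₀ δ ⊆ W)
    (hF0 : ∀ x ∈ W ∩ halfSpace m, x ∉ ball x₀ δ → F (prolong f x) = 0) (i : Fin (m + 1)) :
    ∫ x in halfCube x₀ δ, totalD i F (prolong f x) =
      if i = 0 then - ∫ t in closedBall (Fin.tail x₀) δ, F (prolong f (Fin.cons 0 t)) else 0 := by
  rw [← integral_pdHalf hW hx₀ hδ hδW (hF.comp_prolong hW hf hfD) hF0 i]
  exact setIntegral_congr_fun (measurableSet_halfCube x₀ δ) fun x hx =>
    totalD_prolong hD hF hW hf hfD i ⟨hδW hx.1, hx.2⟩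

theorem closedBall_tail_cons {x₀ : Fin (m + 1) → ℝ} (hx₀ : x₀ 0 = 0) {δ : ℝ} (hδ : 0 ≤ δ)
    {t : Fin m → ℝ} (ht : t ∈ closedBall (Fin.tail x₀) δ) :
    (Fin.cons 0 t : Fin (m + 1) → ℝ) ∈ halfCube x₀ δ := by
  refine ⟨?_, show (0 : ℝ) ≤ _ by simp⟩
  rw [mem_closedBall, dist_pi_le_iff hδ] at *
  refine Fin.forall_fin_succ.2 ⟨?_, fun i => ?_⟩
  · simp [hx₀, hδ]
  · simpa [Fin.tail] using ht i

/-- Green's formula: an operator in the class `(E, ∑ b_α ω^α)` is applied to a test function along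
the jets of `f` and integrated. -/
theorem SameRelClass.integral_eq (hD : IsRelOpen D) {P : (JetSp m → ℝ) → JetSp m → ℝ}
    {E : JetSp m → ℝ} (hE : JetSmooth D E) {k : ℕ} {b : ℕ → JetSp m → ℝ}
    (hb : ∀ α, JetSmooth D (b α))
    (h : SameRelClass D P (fun F z => E z * F z +
      ∑ α ∈ Finset.range k, totalD 0 (fun y => b α y * (totalD 0)^[α] F y) z))
    (hW : IsOpen W) {f : (Fin (m + 1) → ℝ) → ℝ} (hf : ContDiffOn ℝ ∞ f (W ∩ halfSpace m))
    (hfD : ∀ x ∈ W ∩ halfSpace m, (x, f x) ∈ D) {x₀ : Fin (m + 1) → ℝ} (hx₀ : x₀ 0 = 0) {δ : ℝ}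
    (hδ : 0 < δ) (hδW : closedBall x₀ δ ⊆ W) {v : (Fin (m + 1) → ℝ) → ℝ} (hv : ContDiff ℝ ∞ v)
    (hvs : tsupport v ⊆ ball x₀ δ) :
    ∫ x in halfCube x₀ δ, P (fun z => v z.1) (prolong f x) =
      (∫ x in halfCube x₀ δ, E (prolong f x) * v x) - ∑ α ∈ Finset.range k,
        ∫ t in closedBall (Fin.tail x₀) δ,
          b α (prolong f (Fin.cons 0 t)) * (pdHalf 0)^[α] v (Fin.cons 0 t) := by
  obtain ⟨R, hR0, hR⟩ := h
  have hQ : ∀ x ∈ halfCube x₀ δ, x ∈ W ∩ halfSpace m := fun x hx => ⟨hδW hx.1, hx.2⟩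
  set V : JetSp m → ℝ := fun z => v z.1 with hV
  have hVs : JetSmooth D V := jetSmooth_base hv
  have hB : ∀ α, JetSmooth D fun y => b α y * (totalD 0)^[α] V y := fun α =>
    (hb α).mul (hVs.iterate_totalD hD 0 α)
  have hA : ∀ i, JetSmooth D ((R i).app V) := fun i => (R i).app_smooth hD hVs
  have hDV : ∀ α, ∀ x ∈ W ∩ halfSpace m,
      (totalD 0)^[α] V (prolong f x) = (pdHalf 0)^[α] v x := fun α x hx =>
    iterate_totalD_prolong hD hVs hW hf hfD 0 α hx
  have hDV' : ∀ I, ∀ x ∈ W ∩ halfSpace m,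
      multiIter totalD I V (prolong f x) = multiIter pdHalf I v x := fun I x hx =>
    multiIter_totalD_prolong hD hVs hW hf hfD I hx
  have h1 : ∀ x ∈ halfCube x₀ δ, P V (prolong f x) = E (prolong f x) * v x +
      ∑ α ∈ Finset.range k, totalD 0 (fun y => b α y * (totalD 0)^[α] V y) (prolong f x) +
      ∑ i, totalD i ((R i).app V) (prolong f x) := by
    intro x hx
    have := hR V hVs _ (prolong_mem_jetDom (hfD x (hQ x hx)))
    rw [← this]
    simp only [hV, prolong]
    ring
  rw [setIntegral_congr_fun (measurableSet_halfCube x₀ δ) h1]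
  have i1 : IntegrableOn (fun x => E (prolong f x) * v x) (halfCube x₀ δ) :=
    (hE.mul hVs).integrableOn_halfCube hW hf hfD hδW
  have i2 : ∀ α, IntegrableOn (fun x => totalD 0 (fun y => b α y * (totalD 0)^[α] V y)
      (prolong f x)) (halfCube x₀ δ) := fun α =>
    ((hB α).totalD hD 0).integrableOn_halfCube hW hf hfD hδW
  have i3 : ∀ i, IntegrableOn (fun x => totalD i ((R i).app V) (prolong f x)) (halfCube x₀ δ) :=
    fun i => ((hA i).totalD hD i).integrableOn_halfCube hW hf hfD hδW
  have i2' := integrable_finsetSum (Finset.range k) fun α _ => i2 α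
  have i3' := integrable_finsetSum Finset.univ fun i _ => i3 i
  have i12 : IntegrableOn (fun x => E (prolong f x) * v x + ∑ α ∈ Finset.range k,
      totalD 0 (fun y => b α y * (totalD 0)^[α] V y) (prolong f x)) (halfCube x₀ δ) := i1.add i2'
  rw [integral_add i12 i3', integral_add i1 i2', integral_finsetSum _ fun α _ => i2 α,
    integral_finsetSum _ fun i _ => i3 i]
  have e2 : ∀ α, ∫ x in halfCube x₀ δ, totalD 0 (fun y => b α y * (totalD 0)^[α] V y)
      (prolong f x) = - ∫ t in closedBall (Fin.tail x₀) δ,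
        b α (prolong f (Fin.cons 0 t)) * (pdHalf 0)^[α] v (Fin.cons 0 t) := by
    intro α
    rw [integral_totalD hD (hB α) hW hf hfD hx₀ hδ hδW (fun x hx hxb => by
      rw [hDV α x hx, iterate_pdHalf_eq_zero α hx.2 (fun h => hxb (hvs h)), mul_zero]) 0, if_pos rfl]
    congr 1
    refine setIntegral_congr_fun measurableSet_closedBall fun t ht => ?_
    rw [hDV α _ (hQ _ (closedBall_tail_cons hx₀ hδ.le ht))]
  have e3 : ∀ i, ∫ x in halfCube x₀ δ, totalD i ((R i).app V) (prolong f x) = 0 := by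
    intro i
    rw [integral_totalD hD (hA i) hW hf hfD hx₀ hδ hδW (fun x hx hxb => by
      refine Finset.sum_eq_zero fun I _ => ?_
      rw [hDV' I x hx, multiIter_pdHalf_eq_zero I hx.2 (fun h => hxb (hvs h)), mul_zero]) i]
    split_ifs with hi
    · subst hi
      rw [neg_eq_zero]
      refine setIntegral_eq_zero_of_forall_eq_zero fun t ht => ?_
      refine Finset.sum_eq_zero fun I _ => ?_
      have hx := hQ _ (closedBall_tail_cons hx₀ hδ.le ht)
      rw [hR0 I _ (prolong_mem_jetDom (hfD _ hx)) (by simp [prolong]), zero_mul]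
    · rfl
  simp only [e2, e3, Finset.sum_neg_distrib, Finset.sum_const_zero]
  ring

/-- Along a function at which the first variation vanishes, the boundary coefficients vanish. -/
theorem SameRelClass.eq_zero_of_stationary (hD : IsRelOpen D) {P : (JetSp m → ℝ) → JetSp m → ℝ}
    {E : JetSp m → ℝ} (hE : JetSmooth D E) {k : ℕ} {b : ℕ → JetSp m → ℝ}
    (hb : ∀ α, JetSmooth D (b α))
    (h : SameRelClass D P (fun F z => E z * F z +
      ∑ α ∈ Finset.range k, totalD 0 (fun y => b α y * (totalD 0)^[α] F y) z))
    (hW : IsOpen W) {f : (Fin (m + 1) → ℝ) → ℝ} (hf : ContDiffOn ℝ ∞ f (W ∩ halfSpace m))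
    (hfD : ∀ x ∈ W ∩ halfSpace m, (x, f x) ∈ D) {x₀ : Fin (m + 1) → ℝ} (hx₀ : x₀ 0 = 0) {δ : ℝ}
    (hδ : 0 < δ) (hδW : closedBall x₀ δ ⊆ W)
    (hstat : ∀ v : (Fin (m + 1) → ℝ) → ℝ, ContDiff ℝ ∞ v → tsupport v ⊆ ball x₀ δ →
      ∫ x in halfCube x₀ δ, P (fun z => v z.1) (prolong f x) = 0) {α : ℕ} (hα : α < k) :
    b α (prolong f x₀) = 0 := by
  refine eq_zero_of_forall_integral (E := fun x => E (prolong f x))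
    (b := fun α x => b α (prolong f x)) hx₀ hδ hδW (hE.comp_prolong hW hf hfD).continuousOn
    (fun α => ((hb α).comp_prolong hW hf hfD).continuousOn) (fun v hv hvs => ?_) hα
  have h1 := h.integral_eq hD hE hb hW hf hfD hx₀ hδ hδW hv hvs
  rw [hstat v hv hvs] at h1
  linarith

/-- The boundary coefficients of a class are unique. -/
theorem SameRelClass.boundary_unique (hD : IsRelOpen D) {P : (JetSp m → ℝ) → JetSp m → ℝ}
    {E : JetSp m → ℝ} (hE : JetSmooth D E) {k : ℕ} {b : ℕ → JetSp m → ℝ}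
    (hb : ∀ α, JetSmooth D (b α))
    (h : SameRelClass D P (fun F z => E z * F z +
      ∑ α ∈ Finset.range k, totalD 0 (fun y => b α y * (totalD 0)^[α] F y) z))
    {E' : JetSp m → ℝ} (hE' : JetSmooth D E') {k' : ℕ} {b' : ℕ → JetSp m → ℝ}
    (hb' : ∀ α, JetSmooth D (b' α))
    (h' : SameRelClass D P (fun F z => E' z * F z +
      ∑ α ∈ Finset.range k', totalD 0 (fun y => b' α y * (totalD 0)^[α] F y) z))
    {z : JetSp m} (hz : z ∈ jetDom D) (hz0 : z.1 0 = 0) (α : ℕ) :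
    (if α < k then b α z else 0) = if α < k' then b' α z else 0 := by
  by_cases hα : α < max k k'
  swap
  · rw [if_neg (by omega), if_neg (by omega)]
  obtain ⟨n, hn⟩ := hb α
  obtain ⟨n', hn'⟩ := hb' α
  obtain ⟨f, W, hf, hW, hzW, hfD, hfz⟩ := exists_prolong_eq hD hz (max n n')
  have hzH := hD.mem_halfSpace hz
  have hz' := prolong_mem_jetDom (hfD _ ⟨hzW, hzH⟩)
  obtain ⟨δ, hδ, hδW⟩ := nhds_basis_closedBall.mem_iff.1 (hW.mem_nhds hzW)
  set c : ℕ → JetSp m → ℝ := fun α z => (if α < k then b α z else 0) +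
    (-1) * if α < k' then b' α z else 0 with hc
  have hcs : ∀ α, JetSmooth D (c α) := by
    intro α
    refine JetSmooth.add ?_ ((jetSmooth_const (-1)).mul ?_)
    · split_ifs
      · exact hb α
      · exact jetSmooth_const 0
    · split_ifs
      · exact hb' α
      · exact jetSmooth_const 0
  have hEs : JetSmooth D fun z => E z + (-1) * E' z := hE.add ((jetSmooth_const (-1)).mul hE')
  have key : c α (prolong f z.1) = 0 := by
    refine eq_zero_of_forall_integral (E := fun x => E (prolong f x) + (-1) * E' (prolong f x))
      (b := fun α x => c α (prolong f x)) hz0 hδ hδW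
      (hEs.comp_prolong hW hf.contDiffOn hfD).continuousOn
      (fun α => ((hcs α).comp_prolong hW hf.contDiffOn hfD).continuousOn) (fun v hv hvs => ?_) hα
    have h1 := h.integral_eq hD hE hb hW hf.contDiffOn hfD hz0 hδ hδW hv hvs
    rw [h'.integral_eq hD hE' hb' hW hf.contDiffOn hfD hz0 hδ hδW hv hvs] at h1
    have i1 : IntegrableOn (fun x => E (prolong f x) * v x) (halfCube z.1 δ) :=
      (hE.mul (jetSmooth_base hv)).integrableOn_halfCube
      hW hf.contDiffOn hfD hδW
    have i2 : IntegrableOn (fun x => E' (prolong f x) * v x) (halfCube z.1 δ) :=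
      (hE'.mul (jetSmooth_base hv)).integrableOn_halfCube
      hW hf.contDiffOn hfD hδW
    have e1 : ∫ x in halfCube z.1 δ, (E (prolong f x) + (-1) * E' (prolong f x)) * v x =
        (∫ x in halfCube z.1 δ, E (prolong f x) * v x) -
          ∫ x in halfCube z.1 δ, E' (prolong f x) * v x := by
      rw [← integral_sub i1 i2]
      congr 1
      funext x
      ring
    have hext : ∀ (n : ℕ) (a : ℕ → ℝ), n ≤ max k k' → ∑ α ∈ Finset.range n, a α =
        ∑ α ∈ Finset.range (max k k'), if α < n then a α else 0 := by
      intro n a hn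
      rw [← Finset.sum_filter]
      congr 1
      ext β
      simp only [Finset.mem_filter, Finset.mem_range]
      omega
    have j1 : ∀ (a : JetSp m → ℝ) (β : ℕ), JetSmooth D a →
        IntegrableOn (fun t : Fin m → ℝ => a (prolong f (Fin.cons 0 t)) *
          (pdHalf 0)^[β] v (Fin.cons 0 t)) (closedBall (Fin.tail z.1) δ) := by
      intro a β ha
      refine ContinuousOn.integrableOn_compact (isCompact_closedBall _ _) ?_
      have hcont : Continuous fun t : Fin m → ℝ => (Fin.cons 0 t : Fin (m + 1) → ℝ) :=
        continuous_const.finCons continuous_id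
      have hvW := contDiffOn_iterate_pdHalf (W := W) hW hv.contDiffOn 0 β
      exact (((ha.comp_prolong hW hf.contDiffOn hfD).mul hvW).continuousOn).comp
        hcont.continuousOn fun t ht =>
          let h := closedBall_tail_cons hz0 hδ.le ht
          ⟨hδW h.1, h.2⟩
    rw [e1]
    have e2 : (∫ x in halfCube z.1 δ, E (prolong f x) * v x) -
        (∫ x in halfCube z.1 δ, E' (prolong f x) * v x) =
        ∑ α ∈ Finset.range k, (∫ t in closedBall (Fin.tail z.1) δ,
          b α (prolong f (Fin.cons 0 t)) * (pdHalf 0)^[α] v (Fin.cons 0 t)) -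
        ∑ α ∈ Finset.range k', ∫ t in closedBall (Fin.tail z.1) δ,
          b' α (prolong f (Fin.cons 0 t)) * (pdHalf 0)^[α] v (Fin.cons 0 t) := by
      linarith
    rw [e2, hext k _ (le_max_left _ _), hext k' _ (le_max_right _ _), ← Finset.sum_sub_distrib]
    refine Finset.sum_congr rfl fun β _ => ?_
    have e3 : ∀ (p : Prop) [Decidable p] (a : JetSp m → ℝ),
        (if p then ∫ t in closedBall (Fin.tail z.1) δ,
          a (prolong f (Fin.cons 0 t)) * (pdHalf 0)^[β] v (Fin.cons 0 t) else 0) =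
        ∫ t in closedBall (Fin.tail z.1) δ,
          (if p then a (prolong f (Fin.cons 0 t)) else 0) * (pdHalf 0)^[β] v (Fin.cons 0 t) := by
      intro p _ a
      split_ifs <;> simp
    have e4 : ∀ (p : Prop) [Decidable p] (a : JetSp m → ℝ), JetSmooth D a →
        IntegrableOn (fun t : Fin m → ℝ => (if p then a (prolong f (Fin.cons 0 t)) else 0) *
          (pdHalf 0)^[β] v (Fin.cons 0 t)) (closedBall (Fin.tail z.1) δ) := by
      intro p _ a ha
      split_ifs
      · exact j1 a β ha
      · simp
    rw [e3, e3, ← integral_sub (e4 _ _ (hb β)) (e4 _ _ (hb' β))]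
    congr 1
    funext t
    simp only [hc]
    ring
  have hval : c α z = 0 := by
    rw [← key]
    simp only [hc]
    rw [(hn.mono (le_max_left n n')).eq_of_trunc_eq hfz hz' hz,
      (hn'.mono (le_max_right n n')).eq_of_trunc_eq hfz hz' hz]
  simp only [hc] at hval
  linarith

end Uniqueness

/-! ### Local inversion on the half-space -/

section Inversion

open Metric

variable {m : ℕ}

/-- If `g` maps the half-space to itself near `g.symm y₀`, and only the boundary to the boundary, then
`g.symm` maps the half-space to itself near `y₀`: the preimage of an open half-ball is connected,
misses the hyperplane `x 0 = 0` and contains a point of the open half-space. -/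
theorem symm_mem_halfSpace {B : Set (Fin (m + 1) → ℝ)}
    {g : (Fin (m + 1) → ℝ) ≃ₜ (Fin (m + 1) → ℝ)}
    {y₀ : Fin (m + 1) → ℝ} {ρ : ℝ} (hρ : 0 < ρ)
    (hB : ∀ y ∈ ball y₀ ρ, g.symm y ∈ B) (hB' : IsOpen B)
    (hg : ∀ x ∈ B, x ∈ halfSpace m → g x ∈ halfSpace m ∧ (g x 0 = 0 ↔ x 0 = 0))
    (h0 : g.symm y₀ ∈ halfSpace m) {y : Fin (m + 1) → ℝ} (hy : y ∈ ball y₀ ρ)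
    (hyH : y ∈ halfSpace m) : g.symm y ∈ halfSpace m := by
  set P := ball y₀ ρ ∩ {y | 0 < y 0} with hP
  have hconv : Convex ℝ P := (convex_ball y₀ ρ).inter fun x hx y hy a b ha hb hab => by
    have hx' : 0 < x 0 := hx
    have hy' : 0 < y 0 := hy
    change 0 < a * x 0 + b * y 0
    rcases ha.eq_or_lt with rfl | ha
    · have : b = 1 := by linarith
      subst this; simpa using hy'
    · have : 0 ≤ b * y 0 := by positivity
      have : 0 < a * x 0 := by positivity
      linarith
  have hconn : IsPreconnected (g.symm '' P) :=
    hconv.isPreconnected.image _ g.symm.continuous.continuousOn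
  -- it contains a point of the open half-space
  obtain ⟨x₁, hx₁P, hx₁⟩ : ∃ x₁ ∈ g.symm '' P, 0 < x₁ 0 := by
    have hO : IsOpen (B ∩ g ⁻¹' ball y₀ ρ) := hB'.inter (isOpen_ball.preimage g.continuous)
    have hx₀ : g.symm y₀ ∈ B ∩ g ⁻¹' ball y₀ ρ :=
      ⟨hB _ (mem_ball_self hρ), by simp [hρ]⟩
    have hcl : g.symm y₀ ∈ closure (interior (halfSpace m)) := halfSpace_subset_closure_interior h0
    obtain ⟨x, hxO, hxI⟩ := mem_closure_iff.1 hcl _ hO hx₀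
    obtain ⟨ε, hε, hεO⟩ := Metric.isOpen_iff.1 (hO.inter isOpen_interior) x ⟨hxO, hxI⟩
    -- move slightly into the open half-space
    set x' := Function.update x 0 (x 0 + ε / 2) with hx'
    have hx'm : x' ∈ ball x ε := by
      rw [mem_ball, dist_pi_lt_iff hε]
      intro j
      rcases eq_or_ne j 0 with rfl | hj
      · simp [hx', abs_of_pos hε, hε]
      · simp [hx', hj, hε]
    have hx'0 : 0 < x' 0 := by
      have h0 : x ∈ halfSpace m := interior_subset hxI
      have : 0 ≤ x 0 := h0
      simp only [hx', Function.update_self]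
      linarith
    have h1 := (hεO hx'm).1
    have h2 := hg x' h1.1 (show 0 ≤ x' 0 from hx'0.le)
    have h3 : 0 ≤ g x' 0 := h2.1
    refine ⟨x', ⟨g x', ⟨h1.2, lt_of_le_of_ne h3 fun h => ?_⟩, by simp⟩, hx'0⟩
    exact hx'0.ne' (h2.2.1 h.symm)
  have hne : ∀ x ∈ g.symm '' P, x 0 ≠ 0 := by
    rintro _ ⟨y, hy, rfl⟩ h
    have h1 := (hg _ (hB y hy.1) (show 0 ≤ g.symm y 0 from h.ge)).2.2 h
    rw [g.apply_symm_apply] at h1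
    exact hy.2.ne' h1
  have hpos : ∀ x ∈ g.symm '' P, 0 < x 0 := by
    intro x hx
    by_contra hlt
    have hiv := (hconn.image (fun x => x 0) (continuous_apply 0).continuousOn).ordConnected
    obtain ⟨z, hz, hz0⟩ : (0 : ℝ) ∈ (fun x : Fin (m + 1) → ℝ => x 0) '' (g.symm '' P) :=
      hiv.out ⟨x, hx, rfl⟩ ⟨x₁, hx₁P, rfl⟩ ⟨not_lt.1 hlt, hx₁.le⟩
    exact hne z hz hz0
  have hycl : y ∈ closure P := by
    have h1 := halfSpace_subset_closure_interior hyH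
    have h2 : ball y₀ ρ ∩ closure {y : Fin (m + 1) → ℝ | 0 < y 0} ⊆ closure P :=
      isOpen_ball.inter_closure
    refine h2 ⟨hy, ?_⟩
    refine Metric.mem_closure_iff.2 fun ε hε => ?_
    refine ⟨Function.update y 0 (y 0 + ε / 2), ?_, ?_⟩
    · have : 0 ≤ y 0 := hyH
      change 0 < Function.update y 0 (y 0 + ε / 2) 0
      simp only [Function.update_self]; linarith
    · rw [dist_pi_lt_iff hε]
      intro j
      rcases eq_or_ne j 0 with rfl | hj
      · simp [abs_of_pos hε, hε]
      · simp [hj, hε]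
  have h3 : g.symm y ∈ closure (g.symm '' P) := image_closure_subset_closure_image
    g.symm.continuous ⟨y, hycl, rfl⟩
  exact closure_minimal (fun x hx => (hpos x hx).le) isClosed_halfSpace h3

/-- A continuous local inverse of a smooth map with invertible differentials is smooth: the formula
`(h⁻¹)' = (h')⁻¹ ∘ h⁻¹` raises its regularity by one step at a time. -/
theorem contDiffOn_of_leftInverse {V V' : Set (Fin (m + 1) → ℝ)} (hV : IsOpen V)
    (hV' : IsOpen V') {h κ : (Fin (m + 1) → ℝ) → Fin (m + 1) → ℝ}
    (hh : ContDiffOn ℝ ∞ h (V ∩ halfSpace m)) (hκ : ContinuousOn κ (V' ∩ halfSpace m))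
    (hmaps : MapsTo κ (V' ∩ halfSpace m) (V ∩ halfSpace m))
    (hinv : ∀ y ∈ V' ∩ halfSpace m, h (κ y) = y)
    (hd : ∀ x ∈ V ∩ halfSpace m, ∃ A : (Fin (m + 1) → ℝ) ≃L[ℝ] (Fin (m + 1) → ℝ),
      fderivWithin ℝ h (V ∩ halfSpace m) x = A) :
    ContDiffOn ℝ ∞ κ (V' ∩ halfSpace m) := by
  have hu := uniqueDiffOn_inter_halfSpace (m := m) hV'
  have hder : ∀ y ∈ V' ∩ halfSpace m, HasFDerivWithinAt κ
      (ContinuousLinearMap.inverse (fderivWithin ℝ h (V ∩ halfSpace m) (κ y)))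
      (V' ∩ halfSpace m) y := by
    intro y hy
    obtain ⟨A, hA⟩ := hd _ (hmaps hy)
    rw [hA, ContinuousLinearMap.inverse_equiv]
    refine HasFDerivWithinAt.of_local_left_inverse (t := V ∩ halfSpace m)
      ((hκ y hy).tendsto_nhdsWithin hmaps) ?_ hy
      (eventually_nhdsWithin_of_forall hinv)
    rw [← hA]
    exact ((hh.differentiableOn (by simp)) _ (hmaps hy)).hasFDerivWithinAt
  have hh' : ContDiffOn ℝ ∞ (fderivWithin ℝ h (V ∩ halfSpace m)) (V ∩ halfSpace m) :=
    hh.fderivWithin (uniqueDiffOn_inter_halfSpace hV) (by simp)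
  have hn : ∀ n : ℕ, ContDiffOn ℝ n κ (V' ∩ halfSpace m) := by
    intro n
    induction n with
    | zero => exact contDiffOn_zero.2 hκ
    | succ n ih =>
      push_cast
      rw [contDiffOn_succ_iff_fderivWithin hu]
      refine ⟨fun y hy => (hder y hy).differentiableWithinAt, by simp, ?_⟩
      have h1 : ContDiffOn ℝ n (fun y => ContinuousLinearMap.inverse
          (fderivWithin ℝ h (V ∩ halfSpace m) (κ y))) (V' ∩ halfSpace m) := by
        intro y hy
        obtain ⟨A, hA⟩ := hd _ (hmaps hy)
        have h2 : ContDiffWithinAt ℝ n (fun y => fderivWithin ℝ h (V ∩ halfSpace m) (κ y))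
            (V' ∩ halfSpace m) y :=
          ((hh'.of_le (by exact_mod_cast le_top)) _ (hmaps hy)).comp y (ih y hy) hmaps
        have h3 : ContDiffAt ℝ n ContinuousLinearMap.inverse
            (fderivWithin ℝ h (V ∩ halfSpace m) (κ y)) := by
          rw [hA]; exact contDiffAt_map_inverse A
        exact h3.comp_contDiffWithinAt y h2
      exact h1.congr fun y hy => (hder y hy).fderivWithin (hu y hy)
  exact contDiffOn_infty.2 hn

/-- The inverse function theorem on the half-space, for maps preserving the boundary and the
interior. -/
theorem exists_local_inverse {V : Set (Fin (m + 1) → ℝ)} (hV : IsOpen V)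
    {h : (Fin (m + 1) → ℝ) → Fin (m + 1) → ℝ} (hh : ContDiffOn ℝ ∞ h (V ∩ halfSpace m))
    {x₀ : Fin (m + 1) → ℝ} (hx₀ : x₀ ∈ V ∩ halfSpace m)
    (hinj : Function.Injective (fderivWithin ℝ h (V ∩ halfSpace m) x₀))
    (hH : ∀ x ∈ V ∩ halfSpace m, h x ∈ halfSpace m ∧ (h x 0 = 0 ↔ x 0 = 0)) :
    ∃ (B V' : Set (Fin (m + 1) → ℝ)) (κ : (Fin (m + 1) → ℝ) → Fin (m + 1) → ℝ), IsOpen B ∧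
      B ⊆ V ∧ x₀ ∈ B ∧ IsOpen V' ∧ h x₀ ∈ V' ∧ ContDiffOn ℝ ∞ κ (V' ∩ halfSpace m) ∧
      MapsTo κ (V' ∩ halfSpace m) (B ∩ halfSpace m) ∧ (∀ y ∈ V' ∩ halfSpace m, h (κ y) = y) ∧
      ∀ x ∈ B ∩ halfSpace m, h x ∈ V' → κ (h x) = x := by
  set S := V ∩ halfSpace m with hS
  set A : (Fin (m + 1) → ℝ) ≃L[ℝ] (Fin (m + 1) → ℝ) :=
    (LinearEquiv.ofInjectiveEndo (fderivWithin ℝ h S x₀ : (Fin (m + 1) → ℝ) →ₗ[ℝ] _)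
      hinj).toContinuousLinearEquiv with hA
  have hA' : fderivWithin ℝ h S x₀ = (A : (Fin (m + 1) → ℝ) →L[ℝ] (Fin (m + 1) → ℝ)) := by
    ext1 x; rfl
  have hcont : ContinuousWithinAt (fderivWithin ℝ h S) S x₀ :=
    hh.continuousOn_fderivWithin (uniqueDiffOn_inter_halfSpace hV) (by simp) x₀ hx₀
  -- a constant of approximation small enough for the extension theorem
  set Λ : ℝ := ((lipschitzExtensionConstant (Fin (m + 1) → ℝ) : NNReal) : ℝ) with hΛ
  have hΛ0 : 0 < Λ := by
    rw [hΛ]; exact_mod_cast lipschitzExtensionConstant_pos _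
  set N : ℝ := ‖(A.symm : (Fin (m + 1) → ℝ) →L[ℝ] (Fin (m + 1) → ℝ))‖ with hN
  have hN0 : 0 < N := by
    rw [hN]
    refine norm_pos_iff.2 fun h0 => ?_
    have h1 : A.symm (A (fun _ => 1)) = 0 := by
      have := congrArg (fun L : (Fin (m + 1) → ℝ) →L[ℝ] (Fin (m + 1) → ℝ) => L (A fun _ => 1)) h0
      simpa using! this
    rw [A.symm_apply_apply] at h1
    simpa using congrFun h1 0
  set c : ℝ := 1 / (2 * Λ * N) with hc
  have hc0 : 0 < c := by positivity
  have hev : ∀ᶠ x in 𝓝[S] x₀, ‖fderivWithin ℝ h S x - A‖ ≤ c ∧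
      fderivWithin ℝ h S x ∈ range ContinuousLinearEquiv.toContinuousLinearMap := by
    refine Filter.Eventually.and (hcont.eventually (p := fun L => ‖L - (A : _ →L[ℝ] _)‖ ≤ c) ?_)
      (hcont.eventually (p := fun L => L ∈ range ContinuousLinearEquiv.toContinuousLinearMap) ?_)
    · rw [hA']
      filter_upwards [Metric.closedBall_mem_nhds _ hc0] with L hL
      rwa [mem_closedBall, dist_eq_norm] at hL
    · rw [hA']
      exact ContinuousLinearEquiv.nhds A
  obtain ⟨R, hR, hRS⟩ := Metric.mem_nhdsWithin_iff.1 hev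
  obtain ⟨R', hR', hR'V⟩ := Metric.isOpen_iff.1 hV x₀ hx₀.1
  set δ := min R R' with hδ
  have hδ0 : 0 < δ := lt_min hR hR'
  set B := ball x₀ δ with hB
  have hBV : B ⊆ V := (ball_subset_ball (min_le_right _ _)).trans hR'V
  have hBS : B ∩ halfSpace m ⊆ S := inter_subset_inter_left _ hBV
  have hBR : ∀ x ∈ B ∩ halfSpace m, x ∈ ball x₀ R ∩ S := fun x hx =>
    ⟨ball_subset_ball (min_le_left _ _) hx.1, hBS hx⟩
  have happ : ApproximatesLinearOn h (A : (Fin (m + 1) → ℝ) →L[ℝ] (Fin (m + 1) → ℝ))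
      (B ∩ halfSpace m) ⟨c, hc0.le⟩ := by
    intro x hx y hy
    refine ((convex_ball x₀ δ).inter convex_halfSpace).norm_image_sub_le_of_norm_hasFDerivWithin_le'
      (f' := fderivWithin ℝ h S) (fun z hz => ?_) (fun z hz => (hRS (hBR z hz)).1) hy hx
    exact ((hh.differentiableOn (by simp) z (hBS hz)).hasFDerivWithinAt).mono hBS
  obtain ⟨g, hg⟩ := happ.exists_homeomorph_extension (Or.inr (by
    rw [← NNReal.coe_lt_coe]
    push_cast
    change Λ * c < N⁻¹
    rw [hc, show Λ * (1 / (2 * Λ * N)) = N⁻¹ / 2 by field_simp]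
    have := inv_pos.2 hN0
    linarith))
  have hx₀B : x₀ ∈ B ∩ halfSpace m := ⟨mem_ball_self hδ0, hx₀.2⟩
  have hgx : g.symm (h x₀) = x₀ := by rw [hg hx₀B, g.symm_apply_apply]
  have hgB : g.symm ⁻¹' B ∈ 𝓝 (h x₀) := g.symm.continuous.continuousAt.preimage_mem_nhds
    (by rw [hgx]; exact isOpen_ball.mem_nhds hx₀B.1)
  obtain ⟨ρ, hρ, hρB⟩ := Metric.mem_nhds_iff.1 hgB
  have hmap : MapsTo g.symm (ball (h x₀) ρ ∩ halfSpace m) (B ∩ halfSpace m) := fun y hy =>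
    ⟨hρB hy.1, symm_mem_halfSpace (B := B) hρ (fun y hy => hρB hy) isOpen_ball
      (fun x hxB hxH => by rw [← hg ⟨hxB, hxH⟩]; exact hH x (hBS ⟨hxB, hxH⟩))
      (by rw [hgx]; exact hx₀.2) hy.1 hy.2⟩
  have hinv : ∀ y ∈ ball (h x₀) ρ ∩ halfSpace m, h (g.symm y) = y := fun y hy => by
    rw [hg (hmap hy), g.apply_symm_apply]
  refine ⟨B, ball (h x₀) ρ, g.symm, isOpen_ball, hBV, hx₀B.1, isOpen_ball, mem_ball_self hρ, ?_,
    hmap, hinv, fun x hx _ => by rw [hg hx, g.symm_apply_apply]⟩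
  refine contDiffOn_of_leftInverse isOpen_ball isOpen_ball (hh.mono hBS)
    g.symm.continuous.continuousOn hmap hinv fun x hx => ?_
  have hfd : fderivWithin ℝ h (B ∩ halfSpace m) x = fderivWithin ℝ h S x := by
    rw [inter_comm, fderivWithin_inter (isOpen_ball.mem_nhds hx.1), hS, inter_comm,
      fderivWithin_inter (hV.mem_nhds (hBV hx.1))]
  obtain ⟨A', hA''⟩ := (hRS (hBR x hx)).2
  exact ⟨A', hfd.trans hA''.symm⟩

end Inversion

/-! ### Coordinate systems adapted to the boundary -/

section Charts

/-- In every chart of the maximal atlas the boundary is the zero set of the coordinate with index `0`,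
by invariance of the boundary under diffeomorphisms. -/
theorem isBoundaryPoint_iff_chart {k : ℕ} [NeZero k] {X : Type*} [TopologicalSpace X]
    [ChartedSpace (EuclideanHalfSpace k) X] [IsManifold (𝓡∂ k) ∞ X]
    {φ : OpenPartialHomeomorph X (EuclideanHalfSpace k)}
    (hφ : φ ∈ IsManifold.maximalAtlas (𝓡∂ k) ∞ X) {y : X} (hy : y ∈ φ.source) :
    y ∈ (𝓡∂ k).boundary X ↔ (φ y).1 0 = 0 := by
  have hd : IsLocalDiffeomorphAt (𝓡∂ k) (𝓡∂ k) ∞ φ y :=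
    ⟨{ toPartialEquiv := φ.toPartialEquiv
       open_source := φ.open_source
       open_target := φ.open_target
       contMDiffOn_toFun := contMDiffOn_of_mem_maximalAtlas hφ
       contMDiffOn_invFun := contMDiffOn_symm_of_mem_maximalAtlas hφ }, hy, fun _ _ => rfl⟩
  have h1 := hd.isBoundaryPoint_iff (by simp)
  change (𝓡∂ k).IsBoundaryPoint y ↔ _
  rw [h1, ModelWithCorners.isBoundaryPoint_iff, frontier_range_modelWithCornersEuclideanHalfSpace]
  simp only [extChartAt_self_apply, modelWithCornersEuclideanHalfSpace_toFun]
  rw [mem_ofPred_eq]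
  exact eq_comm

variable {m : ℕ} {Y : Type*} [TopologicalSpace Y]
  {φ : OpenPartialHomeomorph Y (EuclideanHalfSpace (m + 2))}

theorem coordX_mem_halfSpace (φ : OpenPartialHomeomorph Y (EuclideanHalfSpace (m + 2))) (y : Y) :
    coordX φ y ∈ halfSpace m := (φ y).2

theorem snoc_coord (φ : OpenPartialHomeomorph Y (EuclideanHalfSpace (m + 2))) (y : Y) :
    WithLp.toLp 2 (Fin.snoc (α := fun _ => ℝ) (coordX φ y) (coordU φ y)) =
      φ.extend (𝓡∂ (m + 2)) y := by
  ext i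
  refine Fin.lastCases ?_ (fun i => ?_) i
  · simp [coordU]
  · simp [coordX]

theorem ofCoord_coord {y : Y} (hy : y ∈ φ.source) : ofCoord φ (coordX φ y) (coordU φ y) = y := by
  rw [ofCoord, snoc_coord]
  exact φ.extend_left_inv hy

theorem coord_mem_chartDom {y : Y} (hy : y ∈ φ.source) :
    (coordX φ y, coordU φ y) ∈ chartDom φ := ⟨y, hy, rfl⟩

theorem ofCoord_mem_source {x : Fin (m + 1) → ℝ} {u : ℝ} (h : (x, u) ∈ chartDom φ) :
    ofCoord φ x u ∈ φ.source := by
  obtain ⟨y, hy, he⟩ := h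
  obtain ⟨rfl, rfl⟩ := Prod.mk.inj he
  rwa [ofCoord_coord hy]

theorem coordX_ofCoord {x : Fin (m + 1) → ℝ} {u : ℝ} (h : (x, u) ∈ chartDom φ) :
    coordX φ (ofCoord φ x u) = x := by
  obtain ⟨y, hy, he⟩ := h
  obtain ⟨rfl, rfl⟩ := Prod.mk.inj he
  rw [ofCoord_coord hy]

theorem coordU_ofCoord {x : Fin (m + 1) → ℝ} {u : ℝ} (h : (x, u) ∈ chartDom φ) :
    coordU φ (ofCoord φ x u) = u := by
  obtain ⟨y, hy, he⟩ := h
  obtain ⟨rfl, rfl⟩ := Prod.mk.inj he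
  rw [ofCoord_coord hy]

theorem contDiff_snoc : ContDiff ℝ ∞ (fun z : (Fin (m + 1) → ℝ) × ℝ =>
    (WithLp.toLp 2 (Fin.snoc (α := fun _ => ℝ) z.1 z.2) : EuclideanSpace ℝ (Fin (m + 2)))) := by
  refine contDiff_euclidean.2 fun i => ?_
  refine Fin.lastCases ?_ (fun i => ?_) i
  · simpa using contDiff_snd
  · simp only [Fin.snoc_castSucc]
    fun_prop

theorem mem_chartDom_iff {z : (Fin (m + 1) → ℝ) × ℝ} : z ∈ chartDom φ ↔
    (WithLp.toLp 2 (Fin.snoc (α := fun _ => ℝ) z.1 z.2) : EuclideanSpace ℝ (Fin (m + 2))) ∈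
      (φ.extend (𝓡∂ (m + 2))).target := by
  constructor
  · rintro ⟨y, hy, rfl⟩
    rw [snoc_coord]
    exact (φ.extend _).map_source (by simpa using hy)
  · intro h
    have h1 := (φ.extend (𝓡∂ (m + 2))).map_target h
    rw [OpenPartialHomeomorph.extend_source] at h1
    refine ⟨_, h1, ?_⟩
    have h2 := (φ.extend (𝓡∂ (m + 2))).right_inv h
    rw [← snoc_coord] at h2
    have h3 : Fin.snoc (α := fun _ => ℝ) _ _ = Fin.snoc (α := fun _ => ℝ) z.1 z.2 :=
      (WithLp.toLp_injective 2) h2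
    have h4 := Fin.snoc_injective2 h3
    exact Prod.ext h4.1 h4.2

theorem isRelOpen_chartDom (φ : OpenPartialHomeomorph Y (EuclideanHalfSpace (m + 2))) :
    IsRelOpen (chartDom φ) := by
  refine ⟨(fun z : (Fin (m + 1) → ℝ) × ℝ =>
    (WithLp.toLp 2 (Fin.snoc (α := fun _ => ℝ) z.1 z.2) : EuclideanSpace ℝ (Fin (m + 2)))) ⁻¹'
      ((𝓡∂ (m + 2)).symm ⁻¹' φ.target), ?_, ?_⟩
  · exact (φ.open_target.preimage (𝓡∂ (m + 2)).continuous_symm).preimage contDiff_snoc.continuous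
  · ext z
    rw [mem_chartDom_iff, OpenPartialHomeomorph.extend_target,
      range_modelWithCornersEuclideanHalfSpace]
    refine and_congr Iff.rfl ?_
    have : (Fin.snoc (α := fun _ => ℝ) z.1 z.2 : Fin (m + 2) → ℝ) 0 = z.1 0 :=
      Fin.snoc_castSucc (α := fun _ => ℝ) z.2 z.1 0
    simp [halfSpace, this]

variable [ChartedSpace (EuclideanHalfSpace (m + 2)) Y]

theorem contMDiffOn_coordX (hφ : φ ∈ IsManifold.maximalAtlas (𝓡∂ (m + 2)) ∞ Y) :
    ContMDiffOn (𝓡∂ (m + 2)) 𝓘(ℝ, Fin (m + 1) → ℝ) ∞ (coordX φ) φ.source := by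
  have h := OpenPartialHomeomorph.contMDiffOn_extend hφ
  have h2 : ContDiff ℝ ∞ (fun (ξ : EuclideanSpace ℝ (Fin (m + 2))) (i : Fin (m + 1)) =>
      ξ i.castSucc) := by fun_prop
  exact h2.contMDiff.comp_contMDiffOn h

theorem contMDiffOn_coordU (hφ : φ ∈ IsManifold.maximalAtlas (𝓡∂ (m + 2)) ∞ Y) :
    ContMDiffOn (𝓡∂ (m + 2)) 𝓘(ℝ, ℝ) ∞ (coordU φ) φ.source := by
  have h := OpenPartialHomeomorph.contMDiffOn_extend hφ
  have h2 : ContDiff ℝ ∞ (fun (ξ : EuclideanSpace ℝ (Fin (m + 2))) =>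
      ξ (Fin.last (m + 1))) := by fun_prop
  exact h2.contMDiff.comp_contMDiffOn h

theorem contMDiffOn_ofCoord (hφ : φ ∈ IsManifold.maximalAtlas (𝓡∂ (m + 2)) ∞ Y) :
    ContMDiffOn 𝓘(ℝ, (Fin (m + 1) → ℝ) × ℝ) (𝓡∂ (m + 2)) ∞
      (fun z : (Fin (m + 1) → ℝ) × ℝ => ofCoord φ z.1 z.2) (chartDom φ) :=
  (contMDiffOn_extend_symm hφ).comp contDiff_snoc.contMDiff.contMDiffOn
    fun z hz => by
      rw [← OpenPartialHomeomorph.extend_target']; exact mem_chartDom_iff.1 hz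

/-- Vectors tangent to the boundary have no normal component in any coordinate system adapted to
the boundary: the normal coordinate has a minimum along each of them. -/
theorem mfderiv_coordX_zero_eq_zero (hφ : φ ∈ IsManifold.maximalAtlas (𝓡∂ (m + 2)) ∞ Y) {y : Y}
    (hy : y ∈ φ.source) (hb : coordX φ y 0 = 0) {ξ : TangentSpace (𝓡∂ (m + 2)) y}
    (hξ : (show EuclideanSpace ℝ (Fin (m + 2)) from ξ) 0 = 0) :
    (show Fin (m + 1) → ℝ from
      mfderiv (𝓡∂ (m + 2)) 𝓘(ℝ, Fin (m + 1) → ℝ) (coordX φ) y ξ) 0 = 0 := by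
  have hs := φ.open_source.mem_nhds hy
  have h1 := ((contMDiffOn_coordX hφ).contMDiffAt hs).mdifferentiableAt (by simp)
  have h2 := h1.hasMFDerivAt.2
  set z := extChartAt (𝓡∂ (m + 2)) y y with hz
  set ξ' : EuclideanSpace ℝ (Fin (m + 2)) := ξ with hξ'
  have hzr : 0 ≤ z 0 := (chartAt (EuclideanHalfSpace (m + 2)) y y).2
  have hmaps : ∀ s : ℝ, z + s • ξ' ∈ range (𝓡∂ (m + 2)) := fun s => by
    rw [range_modelWithCornersEuclideanHalfSpace]
    have : (z + s • ξ') 0 = z 0 := by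
      have h0 : ξ' 0 = 0 := hξ
      simp [h0]
    change 0 ≤ (z + s • ξ') 0
    rwa [this]
  have hc : HasDerivAt (fun s : ℝ => z + s • ξ') ξ' 0 := by
    simpa using ((hasDerivAt_id (0 : ℝ)).smul_const ξ').const_add z
  set G := writtenInExtChartAt (𝓡∂ (m + 2)) 𝓘(ℝ, Fin (m + 1) → ℝ) y (coordX φ) with hG
  have h2' : HasFDerivWithinAt G (mfderiv (𝓡∂ (m + 2)) 𝓘(ℝ, Fin (m + 1) → ℝ) (coordX φ) y)
      (range (𝓡∂ (m + 2))) (z + (0 : ℝ) • ξ') := by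
    rw [zero_smul, add_zero]; exact h2
  have h3 := HasFDerivWithinAt.comp_hasDerivAt (x := (0 : ℝ)) (f := fun s : ℝ => z + s • ξ')
    (hl := h2') (hf := hc) (ht := Eventually.of_forall hmaps)
  have h4 := (hasDerivAt_pi.1 h3) 0
  have h5 : IsLocalMin (fun s : ℝ => G (z + s • ξ') 0) 0 := by
    refine Eventually.of_forall fun s => ?_
    have h6 : G (z + (0 : ℝ) • ξ') = coordX φ y := by
      rw [zero_smul, add_zero]
      exact congrArg (coordX φ) (extChartAt_to_inv y)
    change G (z + (0 : ℝ) • ξ') 0 ≤ G (z + s • ξ') 0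
    rw [h6, hb]
    exact coordX_mem_halfSpace φ _
  exact h5.hasDerivAt_eq_zero h4

/-- A tangent vector is determined by its components in a coordinate system. -/
theorem eq_zero_of_mfderiv_coord (hφ : φ ∈ IsManifold.maximalAtlas (𝓡∂ (m + 2)) ∞ Y) {y : Y}
    (hy : y ∈ φ.source) {ξ : TangentSpace (𝓡∂ (m + 2)) y}
    (hX : mfderiv (𝓡∂ (m + 2)) 𝓘(ℝ, Fin (m + 1) → ℝ) (coordX φ) y ξ = 0)
    (hU : mfderiv (𝓡∂ (m + 2)) 𝓘(ℝ, ℝ) (coordU φ) y ξ = 0) : ξ = 0 := by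
  have hs := φ.open_source.mem_nhds hy
  have h1 := (((contMDiffOn_coordX hφ).contMDiffAt hs).mdifferentiableAt (by simp)).hasMFDerivAt
  have h2 := (((contMDiffOn_coordU hφ).contMDiffAt hs).mdifferentiableAt (by simp)).hasMFDerivAt
  have h3 := ((((contMDiffOn_coordX hφ).contMDiffAt hs).prodMk_space
    ((contMDiffOn_coordU hφ).contMDiffAt hs)).mdifferentiableAt (by simp)).hasMFDerivAt
  have h31 := hasMFDerivAt_unique h1 (HasMFDerivAt.comp y
    (ContinuousLinearMap.fst ℝ (Fin (m + 1) → ℝ) ℝ).hasMFDerivAt h3)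
  have h32 := hasMFDerivAt_unique h2 (HasMFDerivAt.comp y
    (ContinuousLinearMap.snd ℝ (Fin (m + 1) → ℝ) ℝ).hasMFDerivAt h3)
  have h4 := (((contMDiffOn_ofCoord hφ) _ (coord_mem_chartDom hy)).mdifferentiableWithinAt
    (by simp)).hasMFDerivWithinAt
  have h5 := HasMFDerivWithinAt.comp (f := fun y => (coordX φ y, coordU φ y)) y h4
    (h3.hasMFDerivWithinAt (s := φ.source)) fun y' hy' => coord_mem_chartDom hy'
  have h6 := h5.hasMFDerivAt hs
  have h7 : HasMFDerivAt (𝓡∂ (m + 2)) (𝓡∂ (m + 2)) (id : Y → Y) y _ :=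
    h6.congr_of_eventuallyEq (by
      filter_upwards [hs] with y' hy'
      exact (ofCoord_coord hy').symm)
  have h8 := hasMFDerivAt_unique h7 (hasMFDerivAt_id y)
  have h9 := congrArg (fun L => L ξ) h8
  rw [h31] at hX
  rw [h32] at hU
  have h10 : mfderiv (𝓡∂ (m + 2)) 𝓘(ℝ, (Fin (m + 1) → ℝ) × ℝ)
      (fun y => (coordX φ y, coordU φ y)) y ξ = (0 : (Fin (m + 1) → ℝ) × ℝ) :=
    Prod.ext hX hU
  exact h9.symm.trans ((congrArg _ h10).trans (ContinuousLinearMap.map_zero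
    (mfderivWithin 𝓘(ℝ, (Fin (m + 1) → ℝ) × ℝ) (𝓡∂ (m + 2)) (fun z => ofCoord φ z.1 z.2)
      (chartDom φ) (coordX φ y, coordU φ y))))

variable [IsManifold (𝓡∂ (m + 2)) ∞ Y]

theorem mem_boundary_iff_coordX (hφ : φ ∈ IsManifold.maximalAtlas (𝓡∂ (m + 2)) ∞ Y) {y : Y}
    (hy : y ∈ φ.source) : y ∈ (𝓡∂ (m + 2)).boundary Y ↔ coordX φ y 0 = 0 :=
  isBoundaryPoint_iff_chart hφ hy

end Charts

/-! ### Charts of the parametrizing manifold -/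

section ParamCharts

open MeasureTheory

variable {m : ℕ} {M : Type*} [TopologicalSpace M] [ChartedSpace (EuclideanHalfSpace (m + 1)) M]

variable (m) in
/-- The chart of `M` at `c`, with values in `ℝ ^ (m + 1)` with its product norm. -/
def chartPi (c p : M) : Fin (m + 1) → ℝ := (extChartAt (𝓡∂ (m + 1)) c p).ofLp

variable (m) in
/-- The inverse of the chart of `M` at `c`. -/
def chartInv (c : M) (x : Fin (m + 1) → ℝ) : M :=
  (extChartAt (𝓡∂ (m + 1)) c).symm (WithLp.toLp 2 x)

variable (m) in
/-- The range of the chart of `M` at `c`. -/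
def chartTgt (c : M) : Set (Fin (m + 1) → ℝ) :=
  {x | WithLp.toLp 2 x ∈ (extChartAt (𝓡∂ (m + 1)) c).target}

theorem exists_chartTgt_eq (c : M) :
    ∃ O : Set (Fin (m + 1) → ℝ), IsOpen O ∧ chartTgt m c = O ∩ halfSpace m := by
  refine ⟨(fun x => (WithLp.toLp 2 x : EuclideanSpace ℝ (Fin (m + 1)))) ⁻¹'
    ((𝓡∂ (m + 1)).symm ⁻¹' (chartAt (EuclideanHalfSpace (m + 1)) c).target), ?_, ?_⟩
  · exact ((chartAt _ c).open_target.preimage (𝓡∂ (m + 1)).continuous_symm).preimage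
      (PiLp.continuous_toLp 2 _)
  · ext x
    change WithLp.toLp 2 x ∈ (extChartAt (𝓡∂ (m + 1)) c).target ↔ _
    rw [extChartAt_target, range_modelWithCornersEuclideanHalfSpace]
    rfl

theorem chartTgt_subset_halfSpace (c : M) : chartTgt m c ⊆ halfSpace m := by
  obtain ⟨O, -, h⟩ := exists_chartTgt_eq (m := m) c
  rw [h]; exact inter_subset_right

theorem measurableSet_chartTgt (c : M) : MeasurableSet (chartTgt m c) := by
  obtain ⟨O, hO, h⟩ := exists_chartTgt_eq (m := m) c
  rw [h]; exact hO.measurableSet.inter isClosed_halfSpace.measurableSet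

theorem chartTgt_mem_nhdsWithin {c : M} {x : Fin (m + 1) → ℝ} (hx : x ∈ chartTgt m c) :
    chartTgt m c ∈ 𝓝[halfSpace m] x := by
  obtain ⟨O, hO, h⟩ := exists_chartTgt_eq (m := m) c
  rw [h] at hx ⊢
  rw [inter_comm]
  exact inter_mem_nhdsWithin _ (hO.mem_nhds hx.1)

theorem chartInv_mem_source {c : M} {x : Fin (m + 1) → ℝ} (hx : x ∈ chartTgt m c) :
    chartInv m c x ∈ (chartAt (EuclideanHalfSpace (m + 1)) c).source := by
  rw [← extChartAt_source (𝓡∂ (m + 1))]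
  exact (extChartAt (𝓡∂ (m + 1)) c).map_target hx

theorem chartPi_mem {c p : M} (hp : p ∈ (chartAt (EuclideanHalfSpace (m + 1)) c).source) :
    chartPi m c p ∈ chartTgt m c := by
  rw [← extChartAt_source (𝓡∂ (m + 1))] at hp
  exact (extChartAt (𝓡∂ (m + 1)) c).map_source hp

theorem chartPi_chartInv {c : M} {x : Fin (m + 1) → ℝ} (hx : x ∈ chartTgt m c) :
    chartPi m c (chartInv m c x) = x :=
  congrArg WithLp.ofLp ((extChartAt (𝓡∂ (m + 1)) c).right_inv hx)

theorem chartInv_chartPi {c p : M} (hp : p ∈ (chartAt (EuclideanHalfSpace (m + 1)) c).source) :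
    chartInv m c (chartPi m c p) = p := by
  rw [← extChartAt_source (𝓡∂ (m + 1))] at hp
  exact (extChartAt (𝓡∂ (m + 1)) c).left_inv hp

theorem setIntegral_chart_target (c : M) (G : EuclideanSpace ℝ (Fin (m + 1)) → ℝ) :
    ∫ s in (extChartAt (𝓡∂ (m + 1)) c).target, G s = ∫ x in chartTgt m c, G (WithLp.toLp 2 x) := by
  have h := (PiLp.volume_preserving_toLp (Fin (m + 1))).setIntegral_preimage_emb
    (MeasurableEquiv.toLp 2 (Fin (m + 1) → ℝ)).measurableEmbedding G
    (extChartAt (𝓡∂ (m + 1)) c).target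
  exact h.symm

variable [IsManifold (𝓡∂ (m + 1)) ∞ M]

theorem contMDiffOn_chartPi (c : M) :
    ContMDiffOn (𝓡∂ (m + 1)) 𝓘(ℝ, Fin (m + 1) → ℝ) ∞ (chartPi m c)
      (chartAt (EuclideanHalfSpace (m + 1)) c).source := by
  have h2 : ContDiff ℝ ∞ (fun (ξ : EuclideanSpace ℝ (Fin (m + 1))) => ξ.ofLp) := by fun_prop
  exact h2.contMDiff.comp_contMDiffOn contMDiffOn_extChartAt

theorem contMDiffOn_chartInv (c : M) :
    ContMDiffOn 𝓘(ℝ, Fin (m + 1) → ℝ) (𝓡∂ (m + 1)) ∞ (chartInv m c) (chartTgt m c) := by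
  have h2 : ContDiff ℝ ∞ (fun x => (WithLp.toLp 2 x : EuclideanSpace ℝ (Fin (m + 1)))) := by
    fun_prop
  exact (contMDiffOn_extChartAt_symm c).comp h2.contMDiff.contMDiffOn fun x hx => hx

theorem chartInv_mem_boundary_iff {c : M} {x : Fin (m + 1) → ℝ} (hx : x ∈ chartTgt m c) :
    chartInv m c x ∈ (𝓡∂ (m + 1)).boundary M ↔ x 0 = 0 := by
  rw [isBoundaryPoint_iff_chart (IsManifold.chart_mem_maximalAtlas c) (chartInv_mem_source hx)]
  have := congrFun (chartPi_chartInv hx) 0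
  change chartPi m c (chartInv m c x) 0 = 0 ↔ _
  rw [this]

theorem hasMFDerivWithinAt_chartInv {c : M} {x : Fin (m + 1) → ℝ} (hx : x ∈ chartTgt m c) :
    HasMFDerivWithinAt 𝓘(ℝ, Fin (m + 1) → ℝ) (𝓡∂ (m + 1)) (chartInv m c) (halfSpace m) x
      (mfderivWithin 𝓘(ℝ, Fin (m + 1) → ℝ) (𝓡∂ (m + 1)) (chartInv m c) (halfSpace m) x) :=
  ((((contMDiffOn_chartInv c) x hx).mono_of_mem_nhdsWithin
    (chartTgt_mem_nhdsWithin hx)).mdifferentiableWithinAt (by simp)).hasMFDerivWithinAt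

/-- The chain rule for a smooth map read in a chart of `M`. -/
theorem hasFDerivWithinAt_comp_chartInv {c : M} {x : Fin (m + 1) → ℝ} (hx : x ∈ chartTgt m c)
    {X : M → Fin (m + 1) → ℝ}
    (hX : MDifferentiableAt (𝓡∂ (m + 1)) 𝓘(ℝ, Fin (m + 1) → ℝ) X (chartInv m c x)) :
    ∃ L : (Fin (m + 1) → ℝ) →L[ℝ] (Fin (m + 1) → ℝ),
      HasFDerivWithinAt (X ∘ chartInv m c) L (halfSpace m) x ∧
      ∀ v : Fin (m + 1) → ℝ, L v = mfderiv (𝓡∂ (m + 1)) 𝓘(ℝ, Fin (m + 1) → ℝ) X (chartInv m c x)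
        (mfderivWithin 𝓘(ℝ, Fin (m + 1) → ℝ) (𝓡∂ (m + 1)) (chartInv m c) (halfSpace m) x v) :=
  ⟨_, hasMFDerivWithinAt_iff_hasFDerivWithinAt.1
    (hX.hasMFDerivAt.comp_hasMFDerivWithinAt x (hasMFDerivWithinAt_chartInv hx)), fun _ => rfl⟩

theorem mfderiv_chartPi_chartInv {c : M} {x : Fin (m + 1) → ℝ} (hx : x ∈ chartTgt m c)
    (v : Fin (m + 1) → ℝ) :
    mfderiv (𝓡∂ (m + 1)) 𝓘(ℝ, Fin (m + 1) → ℝ) (chartPi m c) (chartInv m c x)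
      (mfderivWithin 𝓘(ℝ, Fin (m + 1) → ℝ) (𝓡∂ (m + 1)) (chartInv m c) (halfSpace m) x v) = v := by
  obtain ⟨L, h1, hL⟩ := hasFDerivWithinAt_comp_chartInv hx (((contMDiffOn_chartPi c).contMDiffAt
    ((chartAt _ c).open_source.mem_nhds (chartInv_mem_source hx))).mdifferentiableAt (by simp))
  have h2 : HasFDerivWithinAt (chartPi m c ∘ chartInv m c) (ContinuousLinearMap.id ℝ _)
      (halfSpace m) x := by
    refine (hasFDerivWithinAt_id x _).congr_of_eventuallyEq ?_ (chartPi_chartInv hx)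
    filter_upwards [chartTgt_mem_nhdsWithin hx] with y hy using chartPi_chartInv hy
  have h3 := (uniqueDiffOn_halfSpace x (chartTgt_subset_halfSpace c hx)).eq h1 h2
  have hv : L v = v := by rw [h3]; rfl
  exact (hL v).symm.trans hv

theorem injective_mfderivWithin_chartInv {c : M} {x : Fin (m + 1) → ℝ} (hx : x ∈ chartTgt m c) :
    Function.Injective
      (mfderivWithin 𝓘(ℝ, Fin (m + 1) → ℝ) (𝓡∂ (m + 1)) (chartInv m c) (halfSpace m) x) :=
  fun v w hvw => (mfderiv_chartPi_chartInv hx v).symm.trans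
    ((congrArg _ hvw).trans (mfderiv_chartPi_chartInv hx w))

theorem formCoeff_toLp (θ : TopForm m M) {c : M} {x : Fin (m + 1) → ℝ} (hx : x ∈ chartTgt m c) :
    formCoeff θ c (WithLp.toLp 2 x) = θ (chartInv m c x) fun i =>
      mfderivWithin 𝓘(ℝ, Fin (m + 1) → ℝ) (𝓡∂ (m + 1)) (chartInv m c) (halfSpace m) x
        (Pi.single i 1) := by
  have h1 : HasMFDerivWithinAt 𝓘(ℝ, EuclideanSpace ℝ (Fin (m + 1))) (𝓡∂ (m + 1))
      (extChartAt (𝓡∂ (m + 1)) c).symm (range (𝓡∂ (m + 1))) (WithLp.toLp 2 x) _ :=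
    (((contMDiffWithinAt_extChartAt_symm_range (n := ∞) c hx)).mdifferentiableWithinAt
      (by simp)).hasMFDerivWithinAt
  set T : (Fin (m + 1) → ℝ) →L[ℝ] EuclideanSpace ℝ (Fin (m + 1)) :=
    (PiLp.continuousLinearEquiv 2 ℝ (fun _ : Fin (m + 1) => ℝ)).symm.toContinuousLinearMap with hT
  have h2 := HasMFDerivWithinAt.comp (f := fun x => (WithLp.toLp 2 x :
    EuclideanSpace ℝ (Fin (m + 1)))) x h1
    (T.hasMFDerivAt (x := x)).hasMFDerivWithinAt (s := halfSpace m) fun y hy => by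
      rw [range_modelWithCornersEuclideanHalfSpace]; exact hy
  have h3 := (hasMFDerivWithinAt_chartInv hx)
  have hu : UniqueMDiffWithinAt 𝓘(ℝ, Fin (m + 1) → ℝ) (halfSpace m) x :=
    uniqueMDiffWithinAt_iff_uniqueDiffWithinAt.2
      (uniqueDiffOn_halfSpace x (chartTgt_subset_halfSpace c hx))
  have h4 := hu.eq h3 h2
  rw [h4]
  rfl

/-- The coefficient of a form `a dx_0 ∧ ⋯ ∧ dx_m`, where the `x_i` are functions on `M`. -/
theorem formCoeff_eq_mul_det {θ : TopForm m M} {c : M} {x : Fin (m + 1) → ℝ} (hx : x ∈ chartTgt m c)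
    {X : M → Fin (m + 1) → ℝ}
    (hX : MDifferentiableAt (𝓡∂ (m + 1)) 𝓘(ℝ, Fin (m + 1) → ℝ) X (chartInv m c x)) {a : ℝ}
    (hθ : θ (chartInv m c x) = a •
      (Matrix.detRowAlternating (R := ℝ) (n := Fin (m + 1))).compLinearMap
        (mfderiv (𝓡∂ (m + 1)) 𝓘(ℝ, Fin (m + 1) → ℝ) X (chartInv m c x)).toLinearMap) :
    formCoeff θ c (WithLp.toLp 2 x) =
      a * (fderivWithin ℝ (X ∘ chartInv m c) (halfSpace m) x).det := by
  obtain ⟨L, h1, hL⟩ := hasFDerivWithinAt_comp_chartInv hx hX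
  rw [formCoeff_toLp θ hx, hθ, h1.fderivWithin
    (uniqueDiffOn_halfSpace x (chartTgt_subset_halfSpace c hx))]
  have h2 : Matrix.det (Matrix.of fun i => L (Pi.single i 1)) = L.det := by
    change _ = LinearMap.det (L : (Fin (m + 1) → ℝ) →ₗ[ℝ] (Fin (m + 1) → ℝ))
    rw [← LinearMap.det_toMatrix', ← Matrix.det_transpose]
    congr 1
  rw [← h2]
  simp only [hL]
  rfl

end ParamCharts

/-! ### Graphs and the pull-back of a Lagrangian -/

section Graphs

variable {m : ℕ} {Y : Type*} [TopologicalSpace Y] {M : Type*} [TopologicalSpace M]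
  {φ ψ : OpenPartialHomeomorph Y (EuclideanHalfSpace (m + 2))}

theorem chartDom_mem_nhdsWithin {z : (Fin (m + 1) → ℝ) × ℝ} (hz : z ∈ chartDom φ) :
    chartDom φ ∈ 𝓝[halfSpace m ×ˢ univ] z := by
  obtain ⟨O, hO, h⟩ := isRelOpen_chartDom φ
  rw [h] at hz ⊢
  filter_upwards [mem_nhdsWithin_of_mem_nhds (hO.mem_nhds hz.1), self_mem_nhdsWithin] with w h1 h2
  exact ⟨h1, h2.1⟩

variable [ChartedSpace (EuclideanHalfSpace (m + 2)) Y]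

theorem IsGraphNear.coordU_eq {f : (Fin (m + 1) → ℝ) → ℝ} {L : Set Y} {y : Y}
    (h : IsGraphNear φ f L y) : coordU φ y = f (coordX φ y) :=
  (h.2.2.2.2.self_of_nhds).1 h.2.2.1

theorem IsGraphNear.contDiffWithinAt {f : (Fin (m + 1) → ℝ) → ℝ} {L : Set Y} {y : Y}
    (h : IsGraphNear φ f L y) : ContDiffWithinAt ℝ ∞ f (halfSpace m) (coordX φ y) := by
  obtain ⟨W, hW, hf⟩ := h.2.2.2.1
  refine (hf _ ⟨mem_of_mem_nhds hW, coordX_mem_halfSpace φ y⟩).mono_of_mem_nhdsWithin ?_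
  rw [inter_comm]
  exact inter_mem_nhdsWithin _ hW

theorem IsGraphNear.eventually_eq {f : (Fin (m + 1) → ℝ) → ℝ} {ι : M → Y} {q : M}
    (h : IsGraphNear φ f (range ι) (ι q)) (hι : ContinuousAt ι q) :
    ∀ᶠ p in 𝓝 q, ι p ∈ φ.source ∧ coordU φ (ι p) = f (coordX φ (ι p)) := by
  filter_upwards [hι.eventually h.2.2.2.2, hι.eventually (φ.open_source.mem_nhds h.2.1)]
    with p h1 h2
  exact ⟨h2, h1.1 ⟨p, rfl⟩⟩

theorem continuousOn_coordX_comp (hφ : φ ∈ IsManifold.maximalAtlas (𝓡∂ (m + 2)) ∞ Y)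
    {ι : M → Y} {N : Set M} (hι : Continuous ι) (hN : ∀ p ∈ N, ι p ∈ φ.source) :
    ContinuousOn (fun p => coordX φ (ι p)) N :=
  (contMDiffOn_coordX hφ).continuousOn.comp hι.continuousOn hN

variable [ChartedSpace (EuclideanHalfSpace (m + 1)) M]

theorem contMDiffAt_coordX_comp (hφ : φ ∈ IsManifold.maximalAtlas (𝓡∂ (m + 2)) ∞ Y)
    (hι : ContMDiff (𝓡∂ (m + 1)) (𝓡∂ (m + 2)) ∞ ι) {p : M} (hp : ι p ∈ φ.source) :
    ContMDiffAt (𝓡∂ (m + 1)) 𝓘(ℝ, Fin (m + 1) → ℝ) ∞ (fun p => coordX φ (ι p)) p :=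
  ((contMDiffOn_coordX hφ).contMDiffAt (φ.open_source.mem_nhds hp)).comp p hι.contMDiffAt

theorem mdifferentiableAt_coordX_comp (hφ : φ ∈ IsManifold.maximalAtlas (𝓡∂ (m + 2)) ∞ Y)
    {ι : M → Y} {q : M} (hι : ContMDiffAt (𝓡∂ (m + 1)) (𝓡∂ (m + 2)) ∞ ι q)
    (hq : ι q ∈ φ.source) :
    MDifferentiableAt (𝓡∂ (m + 1)) 𝓘(ℝ, Fin (m + 1) → ℝ) (fun p => coordX φ (ι p)) q :=
  ((((contMDiffOn_coordX hφ).contMDiffAt (φ.open_source.mem_nhds hq))).comp q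
    hι).mdifferentiableAt (by simp)

/-- Along the graph of `f` the change of the independent variables is differentiable. -/
theorem IsGraphNear.hasFDerivWithinAt_change {f : (Fin (m + 1) → ℝ) → ℝ} {L : Set Y} {y : Y}
    (h : IsGraphNear φ f L y) (hψ : ψ ∈ IsManifold.maximalAtlas (𝓡∂ (m + 2)) ∞ Y)
    (hy : y ∈ ψ.source) :
    ∃ A : (Fin (m + 1) → ℝ) →L[ℝ] (Fin (m + 1) → ℝ),
      HasFDerivWithinAt (fun x => coordX ψ (ofCoord φ x (f x))) A (halfSpace m) (coordX φ y) := by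
  have hy1 : ofCoord φ (coordX φ y) (f (coordX φ y)) = y := by
    rw [← h.coordU_eq, ofCoord_coord h.2.1]
  have hdom : (coordX φ y, f (coordX φ y)) ∈ chartDom φ := by
    rw [← h.coordU_eq]; exact coord_mem_chartDom h.2.1
  have h1 : ContMDiffWithinAt 𝓘(ℝ, (Fin (m + 1) → ℝ) × ℝ) (𝓡∂ (m + 2)) ∞
      (fun z : (Fin (m + 1) → ℝ) × ℝ => ofCoord φ z.1 z.2) (halfSpace m ×ˢ univ)
      (coordX φ y, f (coordX φ y)) :=
    (contMDiffOn_ofCoord h.1 _ hdom).mono_of_mem_nhdsWithin (chartDom_mem_nhdsWithin hdom)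
  have h2 : ContMDiffWithinAt 𝓘(ℝ, Fin (m + 1) → ℝ) 𝓘(ℝ, (Fin (m + 1) → ℝ) × ℝ) ∞
      (fun x => (x, f x)) (halfSpace m) (coordX φ y) :=
    (contDiffWithinAt_id.prodMk h.contDiffWithinAt).contMDiffWithinAt
  have h3 := h1.comp (coordX φ y) h2
    (show MapsTo _ (halfSpace m) (halfSpace m ×ˢ univ) from fun x hx => ⟨hx, mem_univ _⟩)
  have h4 : ContMDiffAt (𝓡∂ (m + 2)) 𝓘(ℝ, Fin (m + 1) → ℝ) ∞ (coordX ψ)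
      (ofCoord φ (coordX φ y) (f (coordX φ y))) := by
    rw [hy1]; exact (contMDiffOn_coordX hψ).contMDiffAt (ψ.open_source.mem_nhds hy)
  have h5 := h4.comp_contMDiffWithinAt (coordX φ y) h3
  have h6 := (contMDiffWithinAt_iff_contDiffWithinAt.1 h5).differentiableWithinAt (by simp)
  exact ⟨_, h6.hasFDerivWithinAt⟩

/-- The independent variables of two coordinate systems along a graph are related by the
Jacobian of the change of variables. -/
theorem IsGraphNear.mfderiv_change {f : (Fin (m + 1) → ℝ) → ℝ} {ι : M → Y} {q : M}
    (h : IsGraphNear φ f (range ι) (ι q)) (hι : ContMDiffAt (𝓡∂ (m + 1)) (𝓡∂ (m + 2)) ∞ ι q)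
    {A : (Fin (m + 1) → ℝ) →L[ℝ] (Fin (m + 1) → ℝ)}
    (hA : HasFDerivWithinAt (fun x => coordX ψ (ofCoord φ x (f x))) A (halfSpace m)
      (coordX φ (ι q))) (v : TangentSpace (𝓡∂ (m + 1)) q) :
    mfderiv (𝓡∂ (m + 1)) 𝓘(ℝ, Fin (m + 1) → ℝ) (fun p => coordX ψ (ι p)) q v =
      A (mfderiv (𝓡∂ (m + 1)) 𝓘(ℝ, Fin (m + 1) → ℝ) (fun p => coordX φ (ι p)) q v) := by
  have h1 := (mdifferentiableAt_coordX_comp h.1 hι h.2.1).hasMFDerivAt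
  have h2 := HasMFDerivWithinAt.comp (f := fun p => coordX φ (ι p)) q
    (hasMFDerivWithinAt_iff_hasFDerivWithinAt.2 hA) (h1.hasMFDerivWithinAt (s := univ))
    fun p _ => coordX_mem_halfSpace φ _
  rw [hasMFDerivWithinAt_univ] at h2
  have h3 : HasMFDerivAt (𝓡∂ (m + 1)) 𝓘(ℝ, Fin (m + 1) → ℝ) (fun p => coordX ψ (ι p)) q _ :=
    h2.congr_of_eventuallyEq (by
      filter_upwards [h.eventually_eq hι.continuousAt] with p hp
      simp only [Function.comp]
      rw [← hp.2, ofCoord_coord hp.1])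
  rw [h3.mfderiv]
  rfl

/-- The independent variables are coordinates on a graph. -/
theorem IsGraphNear.injective_mfderiv [IsManifold (𝓡∂ (m + 2)) ∞ Y]
    {f : (Fin (m + 1) → ℝ) → ℝ} {ι : M → Y} {q : M}
    (h : IsGraphNear φ f (range ι) (ι q)) (hι : ContMDiffAt (𝓡∂ (m + 1)) (𝓡∂ (m + 2)) ∞ ι q)
    (himm : Function.Injective (mfderiv (𝓡∂ (m + 1)) (𝓡∂ (m + 2)) ι q)) :
    Function.Injective
      (mfderiv (𝓡∂ (m + 1)) 𝓘(ℝ, Fin (m + 1) → ℝ) (fun p => coordX φ (ι p)) q) := by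
  have hd := (hι.mdifferentiableAt (by simp)).hasMFDerivAt
  have hsrc := φ.open_source.mem_nhds h.2.1
  have h1 := (mdifferentiableAt_coordX_comp h.1 hι h.2.1).hasMFDerivAt
  have hX := (((contMDiffOn_coordX h.1).contMDiffAt hsrc).mdifferentiableAt
    (by simp)).hasMFDerivAt.comp q hd
  have hU := (((contMDiffOn_coordU h.1).contMDiffAt hsrc).mdifferentiableAt
    (by simp)).hasMFDerivAt.comp q hd
  have h2 := HasMFDerivWithinAt.comp (f := fun p => coordX φ (ι p)) q
    (hasMFDerivWithinAt_iff_hasFDerivWithinAt.2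
      (h.contDiffWithinAt.differentiableWithinAt (by simp)).hasFDerivWithinAt)
    (h1.hasMFDerivWithinAt (s := univ)) fun p _ => coordX_mem_halfSpace φ _
  rw [hasMFDerivWithinAt_univ] at h2
  have h3 := hasMFDerivAt_unique hU (h2.congr_of_eventuallyEq (by
      filter_upwards [h.eventually_eq hι.continuousAt] with p hp using hp.2))
  have h4 := hasMFDerivAt_unique h1 hX
  refine (injective_iff_map_eq_zero _).2 fun v hv => ?_
  have hX0 : mfderiv (𝓡∂ (m + 2)) 𝓘(ℝ, Fin (m + 1) → ℝ) (coordX φ) (ι q)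
      (mfderiv (𝓡∂ (m + 1)) (𝓡∂ (m + 2)) ι q v) = 0 := (DFunLike.congr_fun h4 v).symm.trans hv
  have hU0 : mfderiv (𝓡∂ (m + 2)) 𝓘(ℝ, ℝ) (coordU φ) (ι q)
      (mfderiv (𝓡∂ (m + 1)) (𝓡∂ (m + 2)) ι q v) = 0 :=
    (DFunLike.congr_fun h3 v).trans ((congrArg _ hv).trans (ContinuousLinearMap.map_zero
      (fderivWithin ℝ f (halfSpace m) (coordX φ (ι q)))))
  have h5 := eq_zero_of_mfderiv_coord h.1 h.2.1 hX0 hU0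
  exact himm (h5.trans (map_zero _).symm)

/-- The pull-back of a Lagrangian may be computed in any coordinate system in which the
submanifold is a graph. -/
theorem pullbackForm_eq {r : ℕ} (lam : Lagrangian m Y r) {f : (Fin (m + 1) → ℝ) → ℝ} {ι : M → Y}
    {q : M} (h : IsGraphNear φ f (range ι) (ι q))
    (hι : ContMDiffAt (𝓡∂ (m + 1)) (𝓡∂ (m + 2)) ∞ ι q) :
    pullbackForm lam ι q = lam.coeff φ (prolong f (coordX φ (ι q))) •
      (Matrix.detRowAlternating (R := ℝ) (n := Fin (m + 1))).compLinearMap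
        (mfderiv (𝓡∂ (m + 1)) 𝓘(ℝ, Fin (m + 1) → ℝ) (fun p => coordX φ (ι p)) q).toLinearMap := by
  have hex : ∃ c : OpenPartialHomeomorph Y (EuclideanHalfSpace (m + 2)) ×
      ((Fin (m + 1) → ℝ) → ℝ), IsGraphNear c.1 c.2 (range ι) (ι q) := ⟨(φ, f), h⟩
  rw [pullbackForm, dif_pos hex]
  set c := hex.choose with hc
  have hspec : IsGraphNear c.1 c.2 (range ι) (ι q) := hex.choose_spec
  obtain ⟨A, hA⟩ := hspec.hasFDerivWithinAt_change h.1 h.2.1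
  have hcompat := lam.compat c.1 φ c.2 f (range ι) (ι q) hspec h
  have hJ : (Matrix.of fun i j : Fin (m + 1) => pdHalf j
      (fun x => coordX φ (ofCoord c.1 x (c.2 x)) i) (coordX c.1 (ι q))) =
      LinearMap.toMatrix' (A : (Fin (m + 1) → ℝ) →ₗ[ℝ] (Fin (m + 1) → ℝ)) := by
    ext i j
    have h1 := (hasFDerivWithinAt_pi'.1 hA) i
    have h2 := HasFDerivWithinAt.pdHalf_eq (W := univ) isOpen_univ (by simpa using h1)
      ⟨mem_univ _, coordX_mem_halfSpace _ _⟩ j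
    rw [Matrix.of_apply, h2, LinearMap.toMatrix'_apply]
    rfl
  rw [hJ, LinearMap.det_toMatrix'] at hcompat
  rw [hcompat, mul_smul]
  congr 1
  ext v
  have h3 := fun w => hspec.mfderiv_change hι hA w
  change LinearMap.det (A : (Fin (m + 1) → ℝ) →ₗ[ℝ] (Fin (m + 1) → ℝ)) * Matrix.det (Matrix.of fun i =>
    (show Fin (m + 1) → ℝ from mfderiv (𝓡∂ (m + 1)) 𝓘(ℝ, Fin (m + 1) → ℝ)
      (fun p => coordX c.1 (ι p)) q (v i))) = Matrix.det (Matrix.of fun i =>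
    (show Fin (m + 1) → ℝ from mfderiv (𝓡∂ (m + 1)) 𝓘(ℝ, Fin (m + 1) → ℝ)
      (fun p => coordX φ (ι p)) q (v i)))
  simp only [h3]
  rw [← LinearMap.det_toMatrix', mul_comm, ← Matrix.det_transpose (LinearMap.toMatrix' _),
    ← Matrix.det_mul]
  congr 1
  ext i j
  rw [Matrix.mul_apply]
  simp only [Matrix.of_apply, Matrix.transpose_apply]
  have h6 := LinearMap.toMatrix'_mulVec (A : (Fin (m + 1) → ℝ) →ₗ[ℝ] (Fin (m + 1) → ℝ))
    (show Fin (m + 1) → ℝ from mfderiv (𝓡∂ (m + 1)) 𝓘(ℝ, Fin (m + 1) → ℝ)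
      (fun p => coordX c.1 (ι p)) q (v i))
  have h7 := congrFun h6 j
  rw [Matrix.mulVec, dotProduct] at h7
  refine Eq.trans ?_ h7
  exact Finset.sum_congr rfl fun k _ => mul_comm _ _

end Graphs

/-! ### Pieces of a submanifold that are graphs -/

section Patches

variable {m : ℕ} {Y : Type*} [TopologicalSpace Y]
  {M : Type*} [TopologicalSpace M] [ChartedSpace (EuclideanHalfSpace (m + 1)) M]
  {φ : OpenPartialHomeomorph Y (EuclideanHalfSpace (m + 2))} {ι : M → Y} {N : Set M}
  {W : Set (Fin (m + 1) → ℝ)} {κ : (Fin (m + 1) → ℝ) → M} {f : (Fin (m + 1) → ℝ) → ℝ}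

/-- In the coordinate system `φ` the open piece `N` of the submanifold parametrized by `ι` is the
graph of `f` over the relatively open subset `W` of the half-space, and `κ` is the inverse of the
projection of `N` to the independent variables. -/
structure GraphPatch (φ : OpenPartialHomeomorph Y (EuclideanHalfSpace (m + 2))) (ι : M → Y)
    (N : Set M) (W : Set (Fin (m + 1) → ℝ)) (κ : (Fin (m + 1) → ℝ) → M)
    (f : (Fin (m + 1) → ℝ) → ℝ) : Prop where
  isOpen_N : IsOpen N
  isOpen_W : IsOpen W
  mem_source : ∀ p ∈ N, ι p ∈ φ.source
  coordX_mem : ∀ p ∈ N, coordX φ (ι p) ∈ W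
  inv_mem : ∀ x ∈ W ∩ halfSpace m, κ x ∈ N
  inv_smooth : ContMDiffOn 𝓘(ℝ, Fin (m + 1) → ℝ) (𝓡∂ (m + 1)) ∞ κ (W ∩ halfSpace m)
  coordX_inv : ∀ x ∈ W ∩ halfSpace m, coordX φ (ι (κ x)) = x
  inv_coordX : ∀ p ∈ N, κ (coordX φ (ι p)) = p
  coordU_eq : ∀ p ∈ N, coordU φ (ι p) = f (coordX φ (ι p))
  smooth : ContDiffOn ℝ ∞ f (W ∩ halfSpace m)

theorem GraphPatch.mem_inter (h : GraphPatch φ ι N W κ f) {p : M} (hp : p ∈ N) :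
    coordX φ (ι p) ∈ W ∩ halfSpace m := ⟨h.coordX_mem p hp, coordX_mem_halfSpace φ _⟩

theorem GraphPatch.mem_chartDom (h : GraphPatch φ ι N W κ f) {x : Fin (m + 1) → ℝ}
    (hx : x ∈ W ∩ halfSpace m) : (x, f x) ∈ chartDom φ := by
  have h1 := h.inv_mem x hx
  have h2 := coord_mem_chartDom (h.mem_source _ h1)
  rwa [h.coordU_eq _ h1, h.coordX_inv x hx] at h2

theorem GraphPatch.ofCoord_eq (h : GraphPatch φ ι N W κ f) {x : Fin (m + 1) → ℝ}
    (hx : x ∈ W ∩ halfSpace m) : ofCoord φ x (f x) = ι (κ x) := by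
  have h1 := h.inv_mem x hx
  have h2 := ofCoord_coord (h.mem_source _ h1)
  rwa [h.coordU_eq _ h1, h.coordX_inv x hx] at h2

variable [ChartedSpace (EuclideanHalfSpace (m + 2)) Y]

theorem GraphPatch.restrict (h : GraphPatch φ ι N W κ f)
    (hφ : φ ∈ IsManifold.maximalAtlas (𝓡∂ (m + 2)) ∞ Y) (hι : Continuous ι)
    {W' : Set (Fin (m + 1) → ℝ)} (hW' : IsOpen W') (hWW : W' ⊆ W) :
    GraphPatch φ ι (N ∩ (fun p => coordX φ (ι p)) ⁻¹' W') W' κ f where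
  isOpen_N := (continuousOn_coordX_comp hφ hι h.mem_source).isOpen_inter_preimage h.isOpen_N hW'
  isOpen_W := hW'
  mem_source p hp := h.mem_source p hp.1
  coordX_mem p hp := hp.2
  inv_mem x hx := ⟨h.inv_mem x ⟨hWW hx.1, hx.2⟩, by
    rw [mem_preimage, h.coordX_inv x ⟨hWW hx.1, hx.2⟩]; exact hx.1⟩
  inv_smooth := h.inv_smooth.mono (inter_subset_inter_left _ hWW)
  coordX_inv x hx := h.coordX_inv x ⟨hWW hx.1, hx.2⟩
  inv_coordX p hp := h.inv_coordX p hp.1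
  coordU_eq p hp := h.coordU_eq p hp.1
  smooth := h.smooth.mono (inter_subset_inter_left _ hWW)

theorem GraphPatch.isGraphNear (h : GraphPatch φ ι N W κ f)
    (hφ : φ ∈ IsManifold.maximalAtlas (𝓡∂ (m + 2)) ∞ Y) (hι : IsEmbedding ι) {p : M}
    (hp : p ∈ N) : IsGraphNear φ f (range ι) (ι p) := by
  refine ⟨hφ, h.mem_source p hp, ⟨p, rfl⟩, ⟨W, h.isOpen_W.mem_nhds (h.coordX_mem p hp), h.smooth⟩,
    ?_⟩
  obtain ⟨O, hO, hON⟩ := hι.isOpen_iff.1 h.isOpen_N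
  have hpO : ι p ∈ O := by rw [← hON] at hp; exact hp
  have hX : ContinuousAt (coordX φ) (ι p) := (contMDiffOn_coordX hφ).continuousOn.continuousAt
    (φ.open_source.mem_nhds (h.mem_source p hp))
  filter_upwards [hO.mem_nhds hpO, φ.open_source.mem_nhds (h.mem_source p hp),
    hX (h.isOpen_W.mem_nhds (h.coordX_mem p hp))] with y hyO hys hyW
  constructor
  · rintro ⟨p', rfl⟩
    exact h.coordU_eq p' (by rw [← hON]; exact hyO)
  · intro hy
    have h1 : coordX φ y ∈ W ∩ halfSpace m := ⟨hyW, coordX_mem_halfSpace φ y⟩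
    refine ⟨κ (coordX φ y), ?_⟩
    rw [← h.ofCoord_eq h1, ← hy, ofCoord_coord hys]

variable [IsManifold (𝓡∂ (m + 1)) ∞ M] [IsManifold (𝓡∂ (m + 2)) ∞ Y]

/-- Where the independent variables have independent differentials on the submanifold, it is
a graph. -/
theorem exists_graphPatch (hφ : φ ∈ IsManifold.maximalAtlas (𝓡∂ (m + 2)) ∞ Y)
    (hι : ContMDiff (𝓡∂ (m + 1)) (𝓡∂ (m + 2)) ∞ ι)
    (hbd : ∀ p, p ∈ (𝓡∂ (m + 1)).boundary M ↔ ι p ∈ (𝓡∂ (m + 2)).boundary Y) {q : M}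
    (hq : ι q ∈ φ.source) (hinj : Function.Injective
      (mfderiv (𝓡∂ (m + 1)) 𝓘(ℝ, Fin (m + 1) → ℝ) (fun p => coordX φ (ι p)) q)) :
    ∃ N W κ f, GraphPatch φ ι N W κ f ∧ q ∈ N := by
  have hqs : q ∈ (chartAt (EuclideanHalfSpace (m + 1)) q).source := mem_chart_source _ q
  obtain ⟨O, hO, hOq⟩ := exists_chartTgt_eq (m := m) q
  have hinvq : chartInv m q (chartPi m q q) = q := chartInv_chartPi hqs
  -- the part of the chart that is mapped to the domain of `φ`
  have hcont : ContinuousOn (fun x => ι (chartInv m q x)) (O ∩ halfSpace m) := by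
    rw [← hOq]
    exact hι.continuous.comp_continuousOn (contMDiffOn_chartInv q).continuousOn
  obtain ⟨O', hO', hOO'⟩ := (continuousOn_iff'.1 hcont) φ.source φ.open_source
  set V := O ∩ O' with hV
  have hVtgt : V ∩ halfSpace m ⊆ chartTgt m q := by
    rw [hOq]; exact fun x hx => ⟨hx.1.1, hx.2⟩
  have hVsrc : ∀ x ∈ V ∩ halfSpace m, ι (chartInv m q x) ∈ φ.source := fun x hx => by
    have : x ∈ O' ∩ (O ∩ halfSpace m) := ⟨hx.1.2, hx.1.1, hx.2⟩
    rw [← hOO'] at this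
    exact this.1
  have hx₀ : chartPi m q q ∈ V ∩ halfSpace m := by
    have h1 := chartPi_mem hqs
    rw [hOq] at h1
    have : chartPi m q q ∈ O' ∩ (O ∩ halfSpace m) := by
      rw [← hOO']
      refine ⟨?_, h1⟩
      rw [mem_preimage, hinvq]
      exact hq
    exact ⟨⟨h1.1, this.1⟩, h1.2⟩
  set h : (Fin (m + 1) → ℝ) → (Fin (m + 1) → ℝ) := fun x => coordX φ (ι (chartInv m q x)) with hh
  have hsm : ContDiffOn ℝ ∞ h (V ∩ halfSpace m) := by
    rw [← contMDiffOn_iff_contDiffOn]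
    exact (contMDiffOn_coordX hφ).comp (hι.comp_contMDiffOn
      ((contMDiffOn_chartInv q).mono hVtgt)) hVsrc
  have hinj' : Function.Injective (fderivWithin ℝ h (V ∩ halfSpace m) (chartPi m q q)) := by
    obtain ⟨L, h1, hL⟩ := hasFDerivWithinAt_comp_chartInv (hVtgt hx₀)
      (X := fun p => coordX φ (ι p))
      (mdifferentiableAt_coordX_comp hφ hι.contMDiffAt (hVsrc _ hx₀))
    have h2 : HasFDerivWithinAt h L (V ∩ halfSpace m) (chartPi m q q) :=
      h1.mono inter_subset_right
    rw [h2.fderivWithin (uniqueDiffOn_inter_halfSpace (hO.inter hO') _ hx₀)]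
    intro v w hvw
    rw [hL, hL] at hvw
    rw [hinvq] at hvw
    exact injective_mfderivWithin_chartInv (hVtgt hx₀) (hinj hvw)
  have hH : ∀ x ∈ V ∩ halfSpace m, h x ∈ halfSpace m ∧ (h x 0 = 0 ↔ x 0 = 0) := fun x hx =>
    ⟨coordX_mem_halfSpace φ _, by
      rw [← mem_boundary_iff_coordX hφ (hVsrc x hx), ← hbd, chartInv_mem_boundary_iff (hVtgt hx)]⟩
  obtain ⟨B, V', κ, hB, hBV, hqB, hV', hqV', hκ, hmaps, hhκ, hκh⟩ :=
    exists_local_inverse (hO.inter hO') hsm hx₀ hinj' hH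
  have hBV2 : B ∩ halfSpace m ⊆ V ∩ halfSpace m := inter_subset_inter_left _ hBV
  have hN1 : IsOpen ((chartAt (EuclideanHalfSpace (m + 1)) q).source ∩ chartPi m q ⁻¹' B) :=
    (contMDiffOn_chartPi q).continuousOn.isOpen_inter_preimage (chartAt _ q).open_source hB
  have hmem : ∀ p ∈ (chartAt (EuclideanHalfSpace (m + 1)) q).source ∩ chartPi m q ⁻¹' B,
      chartPi m q p ∈ B ∩ halfSpace m := fun p hp =>
    ⟨hp.2, chartTgt_subset_halfSpace q (chartPi_mem hp.1)⟩
  have hpinv : ∀ p ∈ (chartAt (EuclideanHalfSpace (m + 1)) q).source ∩ chartPi m q ⁻¹' B,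
      h (chartPi m q p) = coordX φ (ι p) := fun p hp => by
    simp only [hh]; rw [chartInv_chartPi hp.1]
  have hsrc : ∀ p ∈ (chartAt (EuclideanHalfSpace (m + 1)) q).source ∩ chartPi m q ⁻¹' B,
      ι p ∈ φ.source := fun p hp => by
    have := hVsrc _ (hBV2 (hmem p hp))
    rwa [chartInv_chartPi hp.1] at this
  have hκs : ContMDiffOn 𝓘(ℝ, Fin (m + 1) → ℝ) (𝓡∂ (m + 1)) ∞ (fun x => chartInv m q (κ x))
      (V' ∩ halfSpace m) :=
    (contMDiffOn_chartInv q).comp hκ.contMDiffOn fun x hx => hVtgt (hBV2 (hmaps hx))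
  have hinvX : ∀ p ∈ (chartAt (EuclideanHalfSpace (m + 1)) q).source ∩ chartPi m q ⁻¹' B,
      coordX φ (ι p) ∈ V' → chartInv m q (κ (coordX φ (ι p))) = p := fun p hp hpV => by
    rw [← hpinv p hp] at hpV ⊢
    rw [hκh _ (hmem p hp) hpV, chartInv_chartPi hp.1]
  refine ⟨((chartAt (EuclideanHalfSpace (m + 1)) q).source ∩ chartPi m q ⁻¹' B) ∩
    (fun p => coordX φ (ι p)) ⁻¹' V', V', fun x => chartInv m q (κ x),
    fun x => coordU φ (ι (chartInv m q (κ x))),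
    { isOpen_N := (continuousOn_coordX_comp hφ hι.continuous hsrc).isOpen_inter_preimage hN1 hV'
      isOpen_W := hV'
      mem_source := fun p hp => hsrc p hp.1
      coordX_mem := fun p hp => hp.2
      inv_mem := fun x hx => ⟨⟨chartInv_mem_source (hVtgt (hBV2 (hmaps hx))), by
        rw [mem_preimage, chartPi_chartInv (hVtgt (hBV2 (hmaps hx)))]
        exact (hmaps hx).1⟩, by
        change h (κ x) ∈ V'
        rw [hhκ x hx]; exact hx.1⟩
      inv_smooth := hκs
      coordX_inv := fun x hx => hhκ x hx
      inv_coordX := fun p hp => hinvX p hp.1 hp.2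
      coordU_eq := fun p hp => by rw [hinvX p hp.1 hp.2]
      smooth := ?_ }, ⟨⟨hqs, hqB⟩, ?_⟩⟩
  · rw [← contMDiffOn_iff_contDiffOn]
    exact (contMDiffOn_coordU hφ).comp (hι.comp_contMDiffOn hκs) fun x hx =>
      hVsrc _ (hBV2 (hmaps hx))
  · rw [mem_preimage, ← hpinv q ⟨hqs, hqB⟩]
    exact hqV'

end Patches

/-! ### Coordinate systems in which a submanifold is a graph -/

section GraphCharts

/-- A hyperplane (or smaller subspace) of `ℝ ^ k` is mapped injectively by forgetting one of the
coordinates; that coordinate can be chosen different from `x 0` unless `x 0` vanishes on it. -/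
theorem exists_forget_injective {k l : ℕ} (hlk : l < k + 1)
    (A : EuclideanSpace ℝ (Fin l) →ₗ[ℝ] EuclideanSpace ℝ (Fin (k + 1)))
    (hA : Function.Injective A) :
    ∃ j, (∀ v, (∀ i, i ≠ j → A v i = 0) → v = 0) ∧ (j = 0 → ∀ v, A v 0 = 0) := by
  have hlt : LinearMap.range A < ⊤ := by
    refine lt_top_iff_ne_top.2 fun h => ?_
    have h1 := LinearMap.finrank_range_of_inj hA
    rw [h, finrank_top, finrank_euclideanSpace, finrank_euclideanSpace, Fintype.card_fin,
      Fintype.card_fin] at h1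
    omega
  obtain ⟨ℓ, hℓ, hle⟩ := Submodule.exists_le_ker_of_lt_top _ hlt
  have h0 : ∀ v, ℓ (A v) = 0 := fun v => hle ⟨v, rfl⟩
  have hsum : ∀ ξ : EuclideanSpace ℝ (Fin (k + 1)),
      ℓ ξ = ∑ i, ξ i * ℓ (EuclideanSpace.single i 1) := fun ξ => by
    conv_lhs => rw [← (EuclideanSpace.basisFun (Fin (k + 1)) ℝ).sum_repr ξ]
    simp [EuclideanSpace.basisFun_apply]
  have key : ∀ j, ℓ (EuclideanSpace.single j 1) ≠ 0 → ∀ v, (∀ i, i ≠ j → A v i = 0) →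
      A v j = 0 := fun j hj v hv => by
    have h1 := h0 v
    rw [hsum, Finset.sum_eq_single j (fun i _ hi => by rw [hv i hi, zero_mul]) (by simp)] at h1
    exact (mul_eq_zero.1 h1).resolve_right hj
  have hzero : ∀ v, (∀ i, A v i = 0) → v = 0 := fun v hv => hA (by
    rw [map_zero]; ext i; exact hv i)
  by_cases hj : ∃ j, j ≠ 0 ∧ ℓ (EuclideanSpace.single j 1) ≠ 0
  · obtain ⟨j, hj0, hj⟩ := hj
    refine ⟨j, fun v hv => hzero v fun i => ?_, fun h => absurd h hj0⟩
    by_cases hi : i = j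
    · subst hi; exact key i hj v hv
    · exact hv i hi
  · push Not at hj
    have hℓ0 : ℓ (EuclideanSpace.single 0 1) ≠ 0 := fun h => hℓ (LinearMap.ext fun ξ => by
      rw [hsum]
      refine Finset.sum_eq_zero fun i _ => ?_
      by_cases hi : i = 0
      · rw [hi, h, mul_zero]
      · rw [hj i hi, mul_zero])
    have hA0 : ∀ v, A v 0 = 0 := fun v => by
      have h1 := h0 v
      rw [hsum, Finset.sum_eq_single 0 (fun i _ hi => by rw [hj i hi, mul_zero]) (by simp)] at h1
      exact (mul_eq_zero.1 h1).resolve_right hℓ0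
    refine ⟨0, fun v hv => hzero v fun i => ?_, fun _ => hA0⟩
    by_cases hi : i = 0
    · rw [hi]; exact hA0 v
    · exact hv i hi

variable {k : ℕ} [NeZero k]

/-- A local homeomorphism of the half-space obtained from a bijection of the ambient space which,
on an open set, preserves the half-space. -/
def halfSpaceHomeo (g g' : EuclideanSpace ℝ (Fin k) → EuclideanSpace ℝ (Fin k))
    (hg : Continuous g) (hg' : Continuous g') (hl : ∀ ξ, g' (g ξ) = ξ) (hr : ∀ ξ, g (g' ξ) = ξ)
    (O : Set (EuclideanSpace ℝ (Fin k))) (hO : IsOpen O)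
    (hOg : ∀ ξ ∈ O, 0 ≤ ξ 0 ↔ 0 ≤ g ξ 0) :
    OpenPartialHomeomorph (EuclideanHalfSpace k) (EuclideanHalfSpace k) where
  toFun p := (𝓡∂ k).symm (g p.1)
  invFun p := (𝓡∂ k).symm (g' p.1)
  source := {p | p.1 ∈ O}
  target := {p | g' p.1 ∈ O}
  map_source' p hp := by
    have h1 : g p.1 ∈ range (𝓡∂ k) := by
      rw [range_modelWithCornersEuclideanHalfSpace]; exact (hOg _ hp).1 p.2
    change g' ((𝓡∂ k) ((𝓡∂ k).symm (g p.1))) ∈ O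
    rw [(𝓡∂ k).right_inv h1, hl]; exact hp
  map_target' p hp := by
    have h1 : g' p.1 ∈ range (𝓡∂ k) := by
      rw [range_modelWithCornersEuclideanHalfSpace]
      exact (hOg _ hp).2 (by rw [hr]; exact p.2)
    change ((𝓡∂ k) ((𝓡∂ k).symm (g' p.1))) ∈ O
    rw [(𝓡∂ k).right_inv h1]; exact hp
  left_inv' p hp := by
    have h1 : g p.1 ∈ range (𝓡∂ k) := by
      rw [range_modelWithCornersEuclideanHalfSpace]; exact (hOg _ hp).1 p.2
    change (𝓡∂ k).symm (g' ((𝓡∂ k) ((𝓡∂ k).symm (g p.1)))) = p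
    rw [(𝓡∂ k).right_inv h1, hl]; exact (𝓡∂ k).left_inv p
  right_inv' p hp := by
    have h1 : g' p.1 ∈ range (𝓡∂ k) := by
      rw [range_modelWithCornersEuclideanHalfSpace]
      exact (hOg _ hp).2 (by rw [hr]; exact p.2)
    change (𝓡∂ k).symm (g ((𝓡∂ k) ((𝓡∂ k).symm (g' p.1)))) = p
    rw [(𝓡∂ k).right_inv h1, hr]; exact (𝓡∂ k).left_inv p
  open_source := hO.preimage continuous_subtype_val
  open_target := hO.preimage (hg'.comp continuous_subtype_val)
  continuousOn_toFun := ((𝓡∂ k).continuous_symm.comp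
    (hg.comp continuous_subtype_val)).continuousOn
  continuousOn_invFun := ((𝓡∂ k).continuous_symm.comp
    (hg'.comp continuous_subtype_val)).continuousOn

/-- Charts may be followed by diffeomorphisms of the ambient space that preserve the half-space on an
open set. -/
theorem trans_mem_maximalAtlas {X : Type*} [TopologicalSpace X]
    [ChartedSpace (EuclideanHalfSpace k) X] [IsManifold (𝓡∂ k) ∞ X]
    {ψ : OpenPartialHomeomorph X (EuclideanHalfSpace k)}
    (hψ : ψ ∈ IsManifold.maximalAtlas (𝓡∂ k) ∞ X)
    {g g' : EuclideanSpace ℝ (Fin k) → EuclideanSpace ℝ (Fin k)}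
    (hg : ContDiff ℝ ∞ g) (hg' : ContDiff ℝ ∞ g') (hl : ∀ ξ, g' (g ξ) = ξ)
    (hr : ∀ ξ, g (g' ξ) = ξ) {O : Set (EuclideanSpace ℝ (Fin k))} (hO : IsOpen O)
    (hOg : ∀ ξ ∈ O, 0 ≤ ξ 0 ↔ 0 ≤ g ξ 0) :
    ψ.trans (halfSpaceHomeo g g' hg.continuous hg'.continuous hl hr O hO hOg) ∈
      IsManifold.maximalAtlas (𝓡∂ k) ∞ X := by
  set e := halfSpaceHomeo g g' hg.continuous hg'.continuous hl hr O hO hOg with he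
  have h1 : ContMDiffOn (𝓡∂ k) (𝓡∂ k) ∞ e e.source :=
    (𝓡∂ k).contMDiffOn_symm.comp (hg.contMDiff.comp (𝓡∂ k).contMDiff).contMDiffOn
      fun p hp => by
        rw [mem_preimage, range_modelWithCornersEuclideanHalfSpace]
        exact (hOg _ hp).1 p.2
  have h2 : ContMDiffOn (𝓡∂ k) (𝓡∂ k) ∞ e.symm e.target :=
    (𝓡∂ k).contMDiffOn_symm.comp (hg'.contMDiff.comp (𝓡∂ k).contMDiff).contMDiffOn
      fun p hp => by
        rw [mem_preimage, range_modelWithCornersEuclideanHalfSpace]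
        exact (hOg _ hp).2 (by rw [hr]; exact p.2)
  refine OpenPartialHomeomorph.mem_maximalAtlas_of_contMDiffOn (I := 𝓡∂ k) (n := ∞)
    (φ := ψ.trans e) ?_ ?_
  · exact h1.comp ((contMDiffOn_of_mem_maximalAtlas hψ).mono fun x hx => hx.1) fun x hx => hx.2
  · exact (contMDiffOn_symm_of_mem_maximalAtlas hψ).comp (h2.mono fun x hx => hx.1)
      fun x hx => hx.2

end GraphCharts

section

variable {m : ℕ} {Y : Type*} [TopologicalSpace Y] [ChartedSpace (EuclideanHalfSpace (m + 2)) Y]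
  [IsManifold (𝓡∂ (m + 2)) ∞ Y]
  {M : Type*} [TopologicalSpace M] [ChartedSpace (EuclideanHalfSpace (m + 1)) M]
  {ι : M → Y}

/-- Near each of its points, an admissible submanifold projects diffeomorphically to the
independent variables of a suitable coordinate system. At a boundary point the hyperplane tangent
to the submanifold differs from the one tangent to `∂Y`, so that a permutation of the coordinates
tangential to `∂Y` suffices; at an interior point any coordinate may become the dependent one. -/
theorem IsAdmissible.exists_chart (h : IsAdmissible (m := m) ι) (q : M) :
    ∃ φ ∈ IsManifold.maximalAtlas (𝓡∂ (m + 2)) ∞ Y, ι q ∈ φ.source ∧ Function.Injective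
      (mfderiv (𝓡∂ (m + 1)) 𝓘(ℝ, Fin (m + 1) → ℝ) (fun p => coordX φ (ι p)) q) := by
  set ψ := chartAt (EuclideanHalfSpace (m + 2)) (ι q) with hψ
  have hψm : ψ ∈ IsManifold.maximalAtlas (𝓡∂ (m + 2)) ∞ Y := IsManifold.chart_mem_maximalAtlas _
  have hqψ : ι q ∈ ψ.source := mem_chart_source _ _
  have hd := (h.smooth.contMDiffAt (x := q)).mdifferentiableAt (by simp) |>.hasMFDerivAt
  obtain ⟨A, hA, hAv⟩ : ∃ A : EuclideanSpace ℝ (Fin (m + 1)) →L[ℝ] EuclideanSpace ℝ (Fin (m + 2)),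
      HasMFDerivAt (𝓡∂ (m + 1)) 𝓘(ℝ, EuclideanSpace ℝ (Fin (m + 2)))
        (fun p => extChartAt (𝓡∂ (m + 2)) (ι q) (ι p)) q A ∧
      ∀ v, A v = mfderiv (𝓡∂ (m + 1)) (𝓡∂ (m + 2)) ι q v := by
    refine ⟨mfderiv (𝓡∂ (m + 1)) (𝓡∂ (m + 2)) ι q, ⟨?_, hd.2⟩, fun v => rfl⟩
    exact (continuousAt_extChartAt (I := 𝓡∂ (m + 2)) (ι q)).comp h.smooth.continuous.continuousAt
  have hAinj : Function.Injective
      (A : EuclideanSpace ℝ (Fin (m + 1)) →ₗ[ℝ] EuclideanSpace ℝ (Fin (m + 2))) := fun v w hvw =>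
    h.immersion q ((hAv v).symm.trans (hvw.trans (hAv w)))
  obtain ⟨j, hj, hj0⟩ := exists_forget_injective (k := m + 1) (by omega) _ hAinj
  set σ := Equiv.swap j (Fin.last (m + 1)) with hσ
  -- a coordinate system in which the coordinate with index `j` becomes the dependent variable
  have hmain : ∀ (τ : ℝ) (O : Set (EuclideanSpace ℝ (Fin (m + 2)))), IsOpen O →
      (∀ ξ ∈ O, 0 ≤ ξ 0 ↔ 0 ≤ ξ (σ 0) + τ) → (ψ (ι q)).1 ∈ O →
      ∃ φ ∈ IsManifold.maximalAtlas (𝓡∂ (m + 2)) ∞ Y, ι q ∈ φ.source ∧ Function.Injective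
        (mfderiv (𝓡∂ (m + 1)) 𝓘(ℝ, Fin (m + 1) → ℝ) (fun p => coordX φ (ι p)) q) := by
    intro τ O hO hOτ hqO
    set g : EuclideanSpace ℝ (Fin (m + 2)) → EuclideanSpace ℝ (Fin (m + 2)) := fun ξ =>
      WithLp.toLp 2 fun i => ξ (σ i) + if i = 0 then τ else 0 with hg
    set g' : EuclideanSpace ℝ (Fin (m + 2)) → EuclideanSpace ℝ (Fin (m + 2)) := fun ξ =>
      WithLp.toLp 2 fun i => ξ (σ i) - if σ i = 0 then τ else 0 with hg'
    have hgs : ContDiff ℝ ∞ g := contDiff_euclidean.2 fun i => by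
      simp only [hg]; fun_prop
    have hgs' : ContDiff ℝ ∞ g' := contDiff_euclidean.2 fun i => by
      simp only [hg']; fun_prop
    have hl : ∀ ξ, g' (g ξ) = ξ := fun ξ => by ext i; simp [hg, hg', hσ]
    have hr : ∀ ξ, g (g' ξ) = ξ := fun ξ => by ext i; simp [hg, hg', hσ]
    have hOg : ∀ ξ ∈ O, 0 ≤ ξ 0 ↔ 0 ≤ g ξ 0 := fun ξ hξ => by
      rw [hOτ ξ hξ]; simp [hg]
    refine ⟨_, trans_mem_maximalAtlas hψm hgs hgs' hl hr hO hOg, ⟨hqψ, hqO⟩, ?_⟩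
    set φ := ψ.trans (halfSpaceHomeo g g' hgs.continuous hgs'.continuous hl hr O hO hOg) with hφ
    set P : EuclideanSpace ℝ (Fin (m + 2)) →L[ℝ] (Fin (m + 1) → ℝ) :=
      ContinuousLinearMap.pi fun i => EuclideanSpace.proj (σ i.castSucc)
    have hPd : ∀ ξ, HasFDerivAt (fun (ξ : EuclideanSpace ℝ (Fin (m + 2))) (i : Fin (m + 1)) =>
        g ξ i.castSucc) P ξ := fun ξ => by
      refine hasFDerivAt_pi.2 fun i => ?_
      simp only [hg]
      exact ((EuclideanSpace.proj (𝕜 := ℝ) (σ i.castSucc)).hasFDerivAt).add_const _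
    have h3 := HasMFDerivAt.comp q (hPd _).hasMFDerivAt hA
    have h4 : HasMFDerivAt (𝓡∂ (m + 1)) 𝓘(ℝ, Fin (m + 1) → ℝ) (fun p => coordX φ (ι p)) q
        (P.comp A) := by
      refine h3.congr_of_eventuallyEq ?_
      filter_upwards [h.smooth.continuous.continuousAt (φ.open_source.mem_nhds
        (show ι q ∈ φ.source from ⟨hqψ, hqO⟩))] with p hp
      funext i
      have h5 : g (ψ (ι p)).1 ∈ range (𝓡∂ (m + 2)) := by
        rw [range_modelWithCornersEuclideanHalfSpace]
        exact (hOg _ hp.2).1 (ψ (ι p)).2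
      change (𝓡∂ (m + 2)) ((𝓡∂ (m + 2)).symm (g (ψ (ι p)).1)) i.castSucc = _
      rw [(𝓡∂ (m + 2)).right_inv h5]
      rfl
    rw [h4.mfderiv]
    refine (injective_iff_map_eq_zero _).2 fun v hv => hj v fun i hi => ?_
    have hσi : σ i ≠ Fin.last (m + 1) := fun hc => hi (by
      rw [hσ, Equiv.swap_apply_eq_iff, Equiv.swap_apply_right] at hc; exact hc)
    obtain ⟨i', hi'⟩ := Fin.exists_castSucc_eq.2 hσi
    have h6 := congrFun hv i'
    change A v (σ i'.castSucc) = 0 at h6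
    rwa [hi', hσ, Equiv.swap_apply_self] at h6
  by_cases hj00 : j = 0
  · -- the submanifold is tangent to a hyperplane `x 0 = const` at an interior point
    have hint : 0 < (ψ (ι q)).1 0 := by
      refine lt_of_le_of_ne (ψ (ι q)).2 fun h0 => ?_
      have h1 := (h.boundary q).2 ((isBoundaryPoint_iff_chart hψm hqψ).2 h0.symm)
      obtain ⟨v, hv⟩ := h.not_tangent q h1
      exact hv (by
        rw [← hj0 hj00 v]
        exact congrArg (fun ξ : EuclideanSpace ℝ (Fin (m + 2)) => ξ 0) (hAv v).symm)
    -- the constant gives the new coordinate with index `0` the value `1` at `ι q`, so that near `ι q`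
    -- both the old and the new one are positive
    refine hmain (1 - (ψ (ι q)).1 (σ 0)) {ξ | 0 < ξ 0 ∧ 0 < ξ (σ 0) + (1 - (ψ (ι q)).1 (σ 0))}
      ?_ (fun ξ hξ => ⟨fun _ => hξ.2.le, fun _ => hξ.1.le⟩) ⟨hint, by simp⟩
    have hpr : ∀ i, Continuous fun ξ : EuclideanSpace ℝ (Fin (m + 2)) => ξ i := fun i => by fun_prop
    exact (isOpen_lt continuous_const (hpr 0)).inter
      (isOpen_lt continuous_const ((hpr (σ 0)).add continuous_const))
  · have hσ0 : σ 0 = 0 := Equiv.swap_apply_of_ne_of_ne (Ne.symm hj00) (Fin.last_pos').ne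
    exact hmain 0 univ isOpen_univ (fun ξ _ => by rw [hσ0, add_zero]) (mem_univ _)

end

/-! ### Integration of top-degree forms -/

section Integration

open MeasureTheory

variable {m : ℕ} {M : Type*} [TopologicalSpace M] [ChartedSpace (EuclideanHalfSpace (m + 1)) M]

theorem continuousOn_formCoeff_orient (o : OrientForm m M) (c : M) :
    ContinuousOn (fun x => formCoeff o.form c (WithLp.toLp 2 x)) (chartTgt m c) :=
  (o.cont c).comp (PiLp.continuous_toLp 2 _).continuousOn fun _ hx => hx

/-- An `n`-form on an `n`-dimensional space is a multiple of `dx_0 ∧ ⋯ ∧ dx_m`, for coordinates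
`x_i`. -/
theorem exists_eq_smul_det {V : Type*} [AddCommGroup V] [Module ℝ V]
    (L : V →ₗ[ℝ] (Fin (m + 1) → ℝ)) (hL : Function.Bijective L) (η : V [⋀^Fin (m + 1)]→ₗ[ℝ] ℝ) :
    ∃ w : ℝ, η = w • (Matrix.detRowAlternating (R := ℝ) (n := Fin (m + 1))).compLinearMap L := by
  set e := (Pi.basisFun ℝ (Fin (m + 1))).map (LinearEquiv.ofBijective L hL).symm with he
  set g := (Matrix.detRowAlternating (R := ℝ) (n := Fin (m + 1))).compLinearMap L with hg
  have hge : g e = 1 := by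
    have h1 : ∀ i, L (e i) = Pi.single i 1 := fun i => by
      have : (LinearEquiv.ofBijective L hL) (e i) = Pi.single i 1 := by
        rw [he, Module.Basis.map_apply, LinearEquiv.apply_symm_apply, Pi.basisFun_apply]
      exact this
    change Matrix.det (Matrix.of fun i => L (e i)) = 1
    simp only [h1]
    rw [← Matrix.det_one (n := Fin (m + 1)) (R := ℝ)]
    congr 1
    ext i j
    simp [Matrix.one_apply, Pi.single_apply, eq_comm]
  refine ⟨η e, ?_⟩
  rw [AlternatingMap.eq_smul_basis_det e g, hge, one_smul]
  exact AlternatingMap.eq_smul_basis_det e η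

theorem injective_iff_surjective_euclidean
    (L : EuclideanSpace ℝ (Fin (m + 1)) →L[ℝ] (Fin (m + 1) → ℝ)) :
    Function.Injective L ↔ Function.Surjective L :=
  LinearMap.injective_iff_surjective_of_finrank_eq_finrank (f := L.toLinearMap) (by simp)

theorem exists_form_eq_smul_det (θ : TopForm m M) {p : M} {X : M → Fin (m + 1) → ℝ}
    (hinj : Function.Injective (mfderiv (𝓡∂ (m + 1)) 𝓘(ℝ, Fin (m + 1) → ℝ) X p)) :
    ∃ w : ℝ, θ p = w • (Matrix.detRowAlternating (R := ℝ) (n := Fin (m + 1))).compLinearMap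
      (mfderiv (𝓡∂ (m + 1)) 𝓘(ℝ, Fin (m + 1) → ℝ) X p).toLinearMap := by
  refine exists_eq_smul_det (V := EuclideanSpace ℝ (Fin (m + 1))) _ ⟨hinj, ?_⟩ (θ p)
  exact (injective_iff_surjective_euclidean
    (mfderiv (𝓡∂ (m + 1)) 𝓘(ℝ, Fin (m + 1) → ℝ) X p)).1 hinj

variable [IsManifold (𝓡∂ (m + 1)) ∞ M]

theorem contDiffWithinAt_comp_chartInv {c : M} {x : Fin (m + 1) → ℝ} (hx : x ∈ chartTgt m c)
    {X : M → Fin (m + 1) → ℝ}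
    (hX : ContMDiffAt (𝓡∂ (m + 1)) 𝓘(ℝ, Fin (m + 1) → ℝ) ∞ X (chartInv m c x)) :
    ContDiffWithinAt ℝ ∞ (X ∘ chartInv m c) (halfSpace m) x :=
  contMDiffWithinAt_iff_contDiffWithinAt.1 (hX.comp_contMDiffWithinAt x
    ((contMDiffOn_chartInv c x hx).mono_of_mem_nhdsWithin (chartTgt_mem_nhdsWithin hx)))

theorem continuousWithinAt_det_chart {c : M} {x : Fin (m + 1) → ℝ} (hx : x ∈ chartTgt m c)
    {X : M → Fin (m + 1) → ℝ}
    (hX : ContMDiffAt (𝓡∂ (m + 1)) 𝓘(ℝ, Fin (m + 1) → ℝ) ∞ X (chartInv m c x)) :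
    ContinuousWithinAt (fun y => (fderivWithin ℝ (X ∘ chartInv m c) (halfSpace m) y).det)
      (halfSpace m) x :=
  ContinuousLinearMap.continuous_det.continuousAt.comp_continuousWithinAt
    (((contDiffWithinAt_comp_chartInv hx hX).fderivWithin_right (m := 0) uniqueDiffOn_halfSpace
      (by simp) (chartTgt_subset_halfSpace c hx)).continuousWithinAt)

theorem det_fderivWithin_ne_zero {c : M} {x : Fin (m + 1) → ℝ} (hx : x ∈ chartTgt m c)
    {X : M → Fin (m + 1) → ℝ}
    (hX : MDifferentiableAt (𝓡∂ (m + 1)) 𝓘(ℝ, Fin (m + 1) → ℝ) X (chartInv m c x))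
    (hinj : Function.Injective (mfderiv (𝓡∂ (m + 1)) 𝓘(ℝ, Fin (m + 1) → ℝ) X (chartInv m c x))) :
    (fderivWithin ℝ (X ∘ chartInv m c) (halfSpace m) x).det ≠ 0 := by
  obtain ⟨L, h1, hL⟩ := hasFDerivWithinAt_comp_chartInv hx hX
  rw [h1.fderivWithin (uniqueDiffOn_halfSpace x (chartTgt_subset_halfSpace c hx))]
  have hLi : Function.Injective (L : (Fin (m + 1) → ℝ) →ₗ[ℝ] (Fin (m + 1) → ℝ)) := fun v w hvw =>
    injective_mfderivWithin_chartInv hx (hinj ((hL v).symm.trans (hvw.trans (hL w))))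
  exact (LinearEquiv.isUnit_det' (LinearEquiv.ofInjectiveEndo _ hLi)).ne_zero

theorem formCoeff_orient_ne_zero (o : OrientForm m M) {c : M} {x : Fin (m + 1) → ℝ}
    (hx : x ∈ chartTgt m c) : formCoeff o.form c (WithLp.toLp 2 x) ≠ 0 := by
  have hs := chartInv_mem_source hx
  have hX := ((contMDiffOn_chartPi c).contMDiffAt ((chartAt _ c).open_source.mem_nhds
    hs)).mdifferentiableAt (by simp)
  have hinj : Function.Injective (mfderiv (𝓡∂ (m + 1)) 𝓘(ℝ, Fin (m + 1) → ℝ) (chartPi m c)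
      (chartInv m c x)) :=
    (injective_iff_surjective_euclidean
      (mfderiv (𝓡∂ (m + 1)) 𝓘(ℝ, Fin (m + 1) → ℝ) (chartPi m c) (chartInv m c x))).2
      fun v => ⟨_, mfderiv_chartPi_chartInv hx v⟩
  obtain ⟨w, hw⟩ := exists_form_eq_smul_det o.form hinj
  rw [formCoeff_eq_mul_det hx hX hw]
  refine mul_ne_zero (fun h0 => o.ne_zero (chartInv m c x) ?_) (det_fderivWithin_ne_zero hx hX hinj)
  rw [hw, h0, zero_smul]

variable [T2Space M] [CompactSpace M]

variable (m M) in
/-- The partition of unity used in the definition of the integral. -/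
def chartPartition : SmoothPartitionOfUnity M (𝓡∂ (m + 1)) M univ :=
  (SmoothPartitionOfUnity.exists_isSubordinate_chartAt_source (𝓡∂ (m + 1)) M).choose

theorem tsupport_chartPartition (c : M) :
    tsupport (chartPartition m M c) ⊆ (chartAt (EuclideanHalfSpace (m + 1)) c).source :=
  (SmoothPartitionOfUnity.exists_isSubordinate_chartAt_source (𝓡∂ (m + 1)) M).choose_spec c

variable (m M) in
theorem finite_chartPartition :
    {c : M | (Function.support (chartPartition m M c)).Nonempty}.Finite :=
  (chartPartition m M).locallyFinite.finite_nonempty_of_compact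

/-- The integrand, in the chart at `c`, of the integral of an `n`-form. -/
def formIntegrand (o : OrientForm m M) (θ : TopForm m M) (c : M) (x : Fin (m + 1) → ℝ) : ℝ :=
  chartPartition m M c (chartInv m c x) *
    (SignType.sign (formCoeff o.form c (WithLp.toLp 2 x)) : ℝ) * formCoeff θ c (WithLp.toLp 2 x)

theorem formIntegral_eq_sum (o : OrientForm m M) (θ : TopForm m M) :
    formIntegral o θ = ∑ c ∈ (finite_chartPartition m M).toFinset,
      ∫ x in chartTgt m c, formIntegrand o θ c x := by
  have h1 : formIntegral o θ = ∑ᶠ c : M, ∫ x in chartTgt m c, formIntegrand o θ c x := by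
    refine finsum_congr fun c => ?_
    rw [setIntegral_chart_target]
    rfl
  rw [h1]
  refine finsum_eq_sum_of_support_subset _ fun c hc => ?_
  rw [Finite.coe_toFinset]
  by_contra hcon
  rw [mem_ofPred_eq, not_nonempty_iff_eq_empty, Function.support_eq_empty_iff] at hcon
  refine hc ?_
  simp [formIntegrand, hcon]

theorem continuousOn_formIntegrand (o : OrientForm m M) {θ : TopForm m M} {c : M}
    (hθ : ContinuousOn (fun x => formCoeff θ c (WithLp.toLp 2 x)) (chartTgt m c)) :
    ContinuousOn (formIntegrand o θ c) (chartTgt m c) := by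
  have h1 : ContinuousOn (fun x => chartPartition m M c (chartInv m c x)) (chartTgt m c) :=
    (chartPartition m M c).contMDiff.continuous.comp_continuousOn
      (contMDiffOn_chartInv c).continuousOn
  have h2 : ContinuousOn (fun x => (SignType.sign (formCoeff o.form c (WithLp.toLp 2 x)) : ℝ))
      (chartTgt m c) := fun x hx => by
    have h3 := ContinuousAt.comp_continuousWithinAt (g := SignType.sign)
      (f := fun x => formCoeff o.form c (WithLp.toLp 2 x))
      (continuousAt_sign_of_ne_zero (formCoeff_orient_ne_zero o hx))
      (continuousOn_formCoeff_orient o c x hx)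
    exact (continuous_of_discreteTopology
      (f := fun s : SignType => (s : ℝ))).continuousAt.comp_continuousWithinAt h3
  exact (h1.mul h2).mul hθ

theorem integrableOn_formIntegrand (o : OrientForm m M) {θ : TopForm m M} {c : M}
    (hθ : ContinuousOn (fun x => formCoeff θ c (WithLp.toLp 2 x)) (chartTgt m c)) :
    IntegrableOn (formIntegrand o θ c) (chartTgt m c) := by
  have hK : IsCompact (tsupport (chartPartition m M c)) := (isClosed_tsupport _).isCompact
  have hK2 : IsCompact (chartPi m c '' tsupport (chartPartition m M c)) :=
    hK.image_of_continuousOn ((contMDiffOn_chartPi c).continuousOn.mono (tsupport_chartPartition c))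
  have hsub : chartPi m c '' tsupport (chartPartition m M c) ⊆ chartTgt m c := by
    rintro _ ⟨p, hp, rfl⟩
    exact chartPi_mem (tsupport_chartPartition c hp)
  have h1 : IntegrableOn (formIntegrand o θ c) (chartPi m c '' tsupport (chartPartition m M c)) :=
    ((continuousOn_formIntegrand o hθ).mono hsub).integrableOn_compact hK2
  refine h1.of_forall_sdiff_eq_zero (measurableSet_chartTgt c) fun x hx => ?_
  have h2 : chartPartition m M c (chartInv m c x) = 0 := by
    by_contra h
    exact hx.2 ⟨chartInv m c x, subset_tsupport _ h, chartPi_chartInv hx.1⟩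
  simp [formIntegrand, h2]

theorem formIntegral_sub (o : OrientForm m M) {θ θ' : TopForm m M}
    (hθ : ∀ c, ContinuousOn (fun x => formCoeff θ c (WithLp.toLp 2 x)) (chartTgt m c))
    (hθ' : ∀ c, ContinuousOn (fun x => formCoeff θ' c (WithLp.toLp 2 x)) (chartTgt m c)) :
    formIntegral o θ - formIntegral o θ' = formIntegral o (fun p => θ p - θ' p) := by
  rw [formIntegral_eq_sum, formIntegral_eq_sum, formIntegral_eq_sum, ← Finset.sum_sub_distrib]
  refine Finset.sum_congr rfl fun c _ => ?_
  rw [← integral_sub (integrableOn_formIntegrand o (hθ c)) (integrableOn_formIntegrand o (hθ' c))]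
  refine integral_congr_ae (Eventually.of_forall fun x => ?_)
  simp only [formIntegrand]
  rw [← mul_sub]
  rfl

end Integration

section PatchIntegral

open MeasureTheory

variable {m r : ℕ} {Y : Type*} [TopologicalSpace Y] [ChartedSpace (EuclideanHalfSpace (m + 2)) Y]
  {M : Type*} [TopologicalSpace M]
  [ChartedSpace (EuclideanHalfSpace (m + 1)) M] [IsManifold (𝓡∂ (m + 1)) ∞ M]
  {φ : OpenPartialHomeomorph Y (EuclideanHalfSpace (m + 2))} {ι : M → Y} {N : Set M}
  {W : Set (Fin (m + 1) → ℝ)} {κ : (Fin (m + 1) → ℝ) → M} {f : (Fin (m + 1) → ℝ) → ℝ}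

/-- On a connected piece that is a graph over `W`, the integral of a form `a dx_0 ∧ ⋯ ∧ dx_m`
supported there is the integral of `a`, up to the sign that compares the orientations. -/
theorem GraphPatch.exists_formIntegral_eq [T2Space M] [CompactSpace M] (h : GraphPatch φ ι N W κ f)
    (hφ : φ ∈ IsManifold.maximalAtlas (𝓡∂ (m + 2)) ∞ Y)
    (hι : ContMDiff (𝓡∂ (m + 1)) (𝓡∂ (m + 2)) ∞ ι)
    (hinj : ∀ p ∈ N, Function.Injective
      (mfderiv (𝓡∂ (m + 1)) 𝓘(ℝ, Fin (m + 1) → ℝ) (fun p => coordX φ (ι p)) p))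
    (hconn : IsPreconnected (W ∩ halfSpace m)) (hne : (W ∩ halfSpace m).Nonempty)
    (o : OrientForm m M) :
    ∃ σ : ℝ, σ ≠ 0 ∧ ∀ (θ : TopForm m M) (a : (Fin (m + 1) → ℝ) → ℝ) (C : Set (Fin (m + 1) → ℝ)),
      IsCompact C → C ⊆ W ∩ halfSpace m → ContinuousOn a C →
      (∀ x ∈ W ∩ halfSpace m, x ∉ C → a x = 0) →
      (∀ p ∈ N, θ p = a (coordX φ (ι p)) •
        (Matrix.detRowAlternating (R := ℝ) (n := Fin (m + 1))).compLinearMap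
          (mfderiv (𝓡∂ (m + 1)) 𝓘(ℝ, Fin (m + 1) → ℝ) (fun p => coordX φ (ι p)) p).toLinearMap) →
      (∀ p, p ∉ N → θ p = 0) → formIntegral o θ = σ * ∫ x in C, a x := by
  set X : M → Fin (m + 1) → ℝ := fun p => coordX φ (ι p) with hX
  have hXs : ∀ p ∈ N, ContMDiffAt (𝓡∂ (m + 1)) 𝓘(ℝ, Fin (m + 1) → ℝ) ∞ X p := fun p hp =>
    contMDiffAt_coordX_comp hφ hι (h.mem_source p hp)
  have hXd : ∀ p ∈ N, MDifferentiableAt (𝓡∂ (m + 1)) 𝓘(ℝ, Fin (m + 1) → ℝ) X p := fun p hp =>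
    (hXs p hp).mdifferentiableAt (by simp)
  -- the orienting form in the coordinates `x`
  choose! w hw using fun p (hp : p ∈ N) => exists_form_eq_smul_det o.form (hinj p hp)
  have hw0 : ∀ p ∈ N, w p ≠ 0 := fun p hp h0 => o.ne_zero p (by rw [hw p hp, h0, zero_smul])
  have hoc : ∀ c, ∀ x ∈ chartTgt m c, chartInv m c x ∈ N →
      formCoeff o.form c (WithLp.toLp 2 x) = w (chartInv m c x) *
        (fderivWithin ℝ (X ∘ chartInv m c) (halfSpace m) x).det := fun c x hx hxN =>
    formCoeff_eq_mul_det hx (hXd _ hxN) (hw _ hxN)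
  have hdet : ∀ c, ∀ x ∈ chartTgt m c, chartInv m c x ∈ N →
      (fderivWithin ℝ (X ∘ chartInv m c) (halfSpace m) x).det ≠ 0 := fun c x hx hxN =>
    det_fderivWithin_ne_zero hx (hXd _ hxN) (hinj _ hxN)
  have hκc : ContinuousOn κ (W ∩ halfSpace m) := h.inv_smooth.continuousOn
  have hwc : ContinuousOn (fun y => w (κ y)) (W ∩ halfSpace m) := by
    intro y hy
    set c := κ y with hc
    have hcs : c ∈ (chartAt (EuclideanHalfSpace (m + 1)) c).source := mem_chart_source _ c
    have hev : ∀ᶠ y' in 𝓝[W ∩ halfSpace m] y,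
        κ y' ∈ (chartAt (EuclideanHalfSpace (m + 1)) c).source :=
      hκc y hy ((chartAt _ c).open_source.mem_nhds hcs)
    have hx : chartPi m c c ∈ chartTgt m c := chartPi_mem hcs
    have hxc : chartInv m c (chartPi m c c) = c := chartInv_chartPi hcs
    have hval : ∀ y' ∈ W ∩ halfSpace m,
        κ y' ∈ (chartAt (EuclideanHalfSpace (m + 1)) c).source →
        w (κ y') = formCoeff o.form c (WithLp.toLp 2 (chartPi m c (κ y'))) /
          (fderivWithin ℝ (X ∘ chartInv m c) (halfSpace m) (chartPi m c (κ y'))).det := by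
      intro y' hy' hs
      have h1 := chartPi_mem (m := m) hs
      have h2 := chartInv_chartPi (m := m) hs
      have h3 : chartInv m c (chartPi m c (κ y')) ∈ N := by rw [h2]; exact h.inv_mem y' hy'
      rw [hoc c _ h1 h3, mul_div_cancel_right₀ _ (hdet c _ h1 h3), h2]
    refine ContinuousWithinAt.congr_of_eventuallyEq ?_
      (by filter_upwards [hev, self_mem_nhdsWithin] with y' h1 h2 using hval y' h2 h1)
      (hval y hy hcs)
    have hpi : ContinuousWithinAt (fun y' => chartPi m c (κ y')) (W ∩ halfSpace m) y :=
      ((contMDiffOn_chartPi c).contMDiffAt ((chartAt _ c).open_source.mem_nhds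
        hcs)).continuousAt.comp_continuousWithinAt (hκc y hy)
    have hpit : Tendsto (fun y' => chartPi m c (κ y')) (𝓝[W ∩ halfSpace m] y)
        (𝓝[chartTgt m c] (chartPi m c c)) :=
      tendsto_nhdsWithin_iff.2 ⟨hpi, by filter_upwards [hev] with y' h1 using chartPi_mem h1⟩
    have hxN : chartInv m c (chartPi m c c) ∈ N := by rw [hxc]; exact h.inv_mem y hy
    refine ContinuousWithinAt.div ?_ ?_ (hdet c _ hx hxN)
    · exact (continuousOn_formCoeff_orient o c _ hx).tendsto.comp hpit
    · exact (((continuousWithinAt_det_chart hx (hXs _ hxN)).mono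
        (chartTgt_subset_halfSpace c)).tendsto).comp hpit
  obtain ⟨y₀, hy₀⟩ := hne
  set σ : SignType := SignType.sign (w (κ y₀)) with hσ
  have hsign : ∀ y ∈ W ∩ halfSpace m, SignType.sign (w (κ y)) = σ := fun y hy =>
    hconn.constant (f := fun y => SignType.sign (w (κ y))) (fun z hz =>
      ContinuousAt.comp_continuousWithinAt (g := SignType.sign) (f := fun y => w (κ y))
        (continuousAt_sign_of_ne_zero (hw0 _ (h.inv_mem z hz))) (hwc z hz)) hy hy₀
  have hσ0 : (σ : ℝ) ≠ 0 := by
    have h1 : ∀ s : SignType, s ≠ 0 → (s : ℝ) ≠ 0 := fun s => by cases s <;> simp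
    exact h1 σ fun h0 => hw0 _ (h.inv_mem y₀ hy₀) (sign_eq_zero_iff.1 h0)
  refine ⟨σ, hσ0, fun θ a C hC hCW ha ha0 hθ hθ0 => ?_⟩
  -- the contribution of each chart
  have hWm : MeasurableSet (W ∩ halfSpace m) :=
    h.isOpen_W.measurableSet.inter isClosed_halfSpace.measurableSet
  have hchart : ∀ c, ∫ x in chartTgt m c, formIntegrand o θ c x =
      ∫ y in C, chartPartition m M c (κ y) * σ * a y := by
    intro c
    set A := chartTgt m c ∩ chartInv m c ⁻¹' N with hA
    have hAm : MeasurableSet A := by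
      obtain ⟨O, hO, hOc⟩ := (continuousOn_iff'.1 (contMDiffOn_chartInv (m := m) c).continuousOn) N
        h.isOpen_N
      rw [hA, inter_comm, hOc]
      exact hO.measurableSet.inter (measurableSet_chartTgt c)
    set G : (Fin (m + 1) → ℝ) → ℝ := fun y => chartPartition m M c (κ y) * σ * a y with hG
    have hXinv : ∀ p ∈ N, κ (X p) = p := h.inv_coordX
    have h1 : ∫ x in chartTgt m c, formIntegrand o θ c x = ∫ x in A, formIntegrand o θ c x := by
      refine setIntegral_eq_of_subset_of_forall_sdiff_eq_zero (measurableSet_chartTgt c)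
        inter_subset_left fun x hx => ?_
      have hxN : chartInv m c x ∉ N := fun hN => hx.2 ⟨hx.1, hN⟩
      have : formCoeff θ c (WithLp.toLp 2 x) = 0 := by
        rw [formCoeff_toLp θ hx.1, hθ0 _ hxN]; rfl
      rw [formIntegrand, this, mul_zero]
    have h2 : ∫ x in A, formIntegrand o θ c x = ∫ x in A,
        |(fderivWithin ℝ (X ∘ chartInv m c) (halfSpace m) x).det| • G ((X ∘ chartInv m c) x) := by
      refine setIntegral_congr_fun hAm fun x hx => ?_
      have hxN : chartInv m c x ∈ N := hx.2
      have hy : X (chartInv m c x) ∈ W ∩ halfSpace m := h.mem_inter hxN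
      have hs := hsign _ hy
      rw [hXinv _ hxN] at hs
      simp only [formIntegrand, hG, Function.comp, smul_eq_mul]
      rw [hXinv _ hxN, formCoeff_eq_mul_det hx.1 (hXd _ hxN) (hθ _ hxN), hoc c x hx.1 hxN,
        sign_mul, hs, ← sign_mul_self]
      push_cast
      ring
    have hinjA : InjOn (X ∘ chartInv m c) A := by
      intro x hx x' hx' hxx
      have h3 := congrArg κ hxx
      simp only [Function.comp] at h3
      rw [hXinv _ hx.2, hXinv _ hx'.2] at h3
      rw [← chartPi_chartInv hx.1, h3, chartPi_chartInv hx'.1]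
    have h3 := integral_image_eq_integral_abs_det_fderiv_smul volume hAm (fun x hx =>
      (((contDiffWithinAt_comp_chartInv hx.1 (hXs _ hx.2)).differentiableWithinAt
        (by simp)).hasFDerivWithinAt).mono
          (inter_subset_left.trans (chartTgt_subset_halfSpace c))) hinjA G
    have h4 : ∫ y in W ∩ halfSpace m, G y = ∫ y in (X ∘ chartInv m c) '' A, G y := by
      refine setIntegral_eq_of_subset_of_forall_sdiff_eq_zero hWm ?_ fun y hy => ?_
      · rintro _ ⟨x, hx, rfl⟩
        exact h.mem_inter hx.2
      · have : chartPartition m M c (κ y) = 0 := by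
          by_contra hne
          have hs := tsupport_chartPartition (m := m) c (subset_tsupport _ hne)
          refine hy.2 ⟨chartPi m c (κ y), ⟨chartPi_mem hs, ?_⟩, ?_⟩
          · rw [mem_preimage, chartInv_chartPi hs]; exact h.inv_mem y hy.1
          · simp only [Function.comp]
            rw [chartInv_chartPi hs]; exact h.coordX_inv y hy.1
        simp [hG, this]
    have h5 : ∫ y in W ∩ halfSpace m, G y = ∫ y in C, G y :=
      setIntegral_eq_of_subset_of_forall_sdiff_eq_zero hWm hCW fun y hy => by
        simp [hG, ha0 y hy.1 hy.2]
    rw [h1, h2, ← h3, ← h4, h5]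
  rw [formIntegral_eq_sum, Finset.sum_congr rfl fun c _ => hchart c, ← integral_finsetSum]
  · rw [← integral_const_mul]
    refine setIntegral_congr_fun hC.measurableSet fun y hy => ?_
    rw [← Finset.sum_mul, ← Finset.sum_mul]
    have h1 := (chartPartition m M).sum_eq_one (mem_univ (κ y))
    rw [finsum_eq_sum_of_support_subset (s := (finite_chartPartition m M).toFinset)] at h1
    · rw [h1, one_mul]
    · intro c hc
      rw [Finite.coe_toFinset]
      exact ⟨κ y, hc⟩
  · intro c _
    have h1 : ContinuousOn (fun y => chartPartition m M c (κ y)) C :=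
      (chartPartition m M c).contMDiff.continuous.comp_continuousOn (hκc.mono hCW)
    exact ((h1.mul continuousOn_const).mul ha).integrableOn_compact hC

variable [IsManifold (𝓡∂ (m + 2)) ∞ Y]

/-- The pull-back of a Lagrangian to an admissible submanifold is continuous. -/
theorem continuousOn_formCoeff_pullback (lam : Lagrangian m Y r) (h : IsAdmissible (m := m) ι)
    (hemb : IsEmbedding ι) (c : M) :
    ContinuousOn (fun x => formCoeff (pullbackForm lam ι) c (WithLp.toLp 2 x)) (chartTgt m c) := by
  intro x hx
  obtain ⟨φ, hφ, hq, hinj⟩ := h.exists_chart (chartInv m c x)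
  obtain ⟨N, W, κ, f, hP, hqN⟩ := exists_graphPatch hφ h.smooth h.boundary hq hinj
  have hsub := chartTgt_subset_halfSpace (m := m) c
  have hcont : ContinuousWithinAt (chartInv m c) (chartTgt m c) x :=
    (contMDiffOn_chartInv c).continuousOn x hx
  have hev : ∀ᶠ y in 𝓝[chartTgt m c] x, chartInv m c y ∈ N :=
    hcont (hP.isOpen_N.mem_nhds hqN)
  have hval : ∀ y ∈ chartTgt m c, chartInv m c y ∈ N →
      formCoeff (pullbackForm lam ι) c (WithLp.toLp 2 y) =
        lam.coeff φ (prolong f (coordX φ (ι (chartInv m c y)))) *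
          (fderivWithin ℝ ((fun p => coordX φ (ι p)) ∘ chartInv m c) (halfSpace m) y).det :=
    fun y hy hyN => formCoeff_eq_mul_det hy
      (mdifferentiableAt_coordX_comp hφ h.smooth.contMDiffAt (hP.mem_source _ hyN))
      (pullbackForm_eq lam (hP.isGraphNear hφ hemb hyN) h.smooth.contMDiffAt)
  refine ContinuousWithinAt.congr_of_eventuallyEq ?_
    (by filter_upwards [hev, self_mem_nhdsWithin] with y hy hy2 using hval y hy2 hy)
    (hval x hx hqN)
  have hX := contMDiffAt_coordX_comp hφ h.smooth hq
  refine ContinuousWithinAt.mul ?_ ((continuousWithinAt_det_chart hx hX).mono hsub)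
  have h1 : ContinuousOn (fun y : Fin (m + 1) → ℝ => lam.coeff φ (prolong f y))
      (W ∩ halfSpace m) :=
    (JetSmooth.comp_prolong ⟨r, lam.smooth φ hφ⟩ hP.isOpen_W hP.smooth
      fun y hy => hP.mem_chartDom hy).continuousOn
  have h2 : ContinuousWithinAt (fun y => coordX φ (ι (chartInv m c y))) (chartTgt m c) x :=
    hX.continuousAt.comp_continuousWithinAt hcont
  have h3 := h1 _ (hP.mem_inter hqN)
  refine ContinuousWithinAt.comp_of_mem_nhdsWithin_image (t := W ∩ halfSpace m)
    (g := fun y : Fin (m + 1) → ℝ => lam.coeff φ (prolong f y)) h3 h2 ?_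
  have h4 : (fun y => coordX φ (ι (chartInv m c y))) '' chartTgt m c ⊆ halfSpace m := by
    rintro _ ⟨y, _, rfl⟩; exact coordX_mem_halfSpace φ _
  exact mem_of_superset (inter_mem_nhdsWithin _ (hP.isOpen_W.mem_nhds (hP.coordX_mem _ hqN)))
    fun y hy => ⟨hy.2, h4 hy.1⟩

end PatchIntegral

/-! ### Variations supported in a graph -/

section Variation

open Metric

variable {m r : ℕ} {Y : Type*} [TopologicalSpace Y] {M : Type*}
  {φ : OpenPartialHomeomorph Y (EuclideanHalfSpace (m + 2))} {ι : M → Y} {N : Set M}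
  {W : Set (Fin (m + 1) → ℝ)} {κ : (Fin (m + 1) → ℝ) → M} {f : (Fin (m + 1) → ℝ) → ℝ}
  {ρ : ℝ} {v : (Fin (m + 1) → ℝ) → ℝ} {t : ℝ}

/-- The vertical displacements of size less than `ρ` of the graph of `f` over `W` stay in the range
of the coordinate system and do not meet the other parts of the submanifold. -/
def IsTube (φ : OpenPartialHomeomorph Y (EuclideanHalfSpace (m + 2))) (ι : M → Y)
    (W : Set (Fin (m + 1) → ℝ)) (f : (Fin (m + 1) → ℝ) → ℝ) (ρ : ℝ) : Prop :=
  ∀ x ∈ W ∩ halfSpace m, ∀ τ, |τ| < ρ →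
    (x, f x + τ) ∈ chartDom φ ∧ (ofCoord φ x (f x + τ) ∈ range ι → τ = 0)

open Classical in
/-- The displacement of the piece `N` of the submanifold by `t * v` in the direction of the
dependent variable. -/
def variation (φ : OpenPartialHomeomorph Y (EuclideanHalfSpace (m + 2))) (ι : M → Y) (N : Set M)
    (v : (Fin (m + 1) → ℝ) → ℝ) (t : ℝ) (p : M) : Y :=
  if p ∈ N then ofCoord φ (coordX φ (ι p)) (coordU φ (ι p) + t * v (coordX φ (ι p))) else ι p

theorem variation_of_notMem {p : M} (hp : p ∉ N) : variation φ ι N v t p = ι p := if_neg hp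

variable [TopologicalSpace M] [ChartedSpace (EuclideanHalfSpace (m + 1)) M]

theorem variation_of_mem (h : GraphPatch φ ι N W κ f) {p : M} (hp : p ∈ N) :
    variation φ ι N v t p =
      ofCoord φ (coordX φ (ι p)) (f (coordX φ (ι p)) + t * v (coordX φ (ι p))) := by
  rw [variation, if_pos hp, h.coordU_eq p hp]

theorem variation_mem_chartDom (h : GraphPatch φ ι N W κ f) (hρ : IsTube φ ι W f ρ)
    (ht : ∀ x, |t * v x| < ρ) {p : M} (hp : p ∈ N) :
    (coordX φ (ι p), f (coordX φ (ι p)) + t * v (coordX φ (ι p))) ∈ chartDom φ :=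
  (hρ _ (h.mem_inter hp) _ (ht _)).1

theorem coordX_variation (h : GraphPatch φ ι N W κ f) (hρ : IsTube φ ι W f ρ)
    (ht : ∀ x, |t * v x| < ρ) {p : M} (hp : p ∈ N) :
    coordX φ (variation φ ι N v t p) = coordX φ (ι p) := by
  rw [variation_of_mem h hp, coordX_ofCoord (variation_mem_chartDom h hρ ht hp)]

/-- Off the compact set over the support of `v` nothing is displaced. -/
theorem variation_of_notMem_image (h : GraphPatch φ ι N W κ f) {p : M}
    (hp : p ∉ κ '' (tsupport v ∩ halfSpace m)) : variation φ ι N v t p = ι p := by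
  by_cases hN : p ∈ N
  · have h1 : coordX φ (ι p) ∉ tsupport v := fun hc =>
      hp ⟨coordX φ (ι p), ⟨hc, coordX_mem_halfSpace φ _⟩, h.inv_coordX p hN⟩
    rw [variation, if_pos hN, image_eq_zero_of_notMem_tsupport h1, mul_zero, add_zero,
      ofCoord_coord (h.mem_source p hN)]
  · exact variation_of_notMem hN

theorem isCompact_image_support (h : GraphPatch φ ι N W κ f) (hv : HasCompactSupport v)
    (hvW : tsupport v ⊆ W) : IsCompact (κ '' (tsupport v ∩ halfSpace m)) :=
  (hv.isCompact.inter_right isClosed_halfSpace).image_of_continuousOn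
    (h.inv_smooth.continuousOn.mono (inter_subset_inter_left _ hvW))

theorem image_support_subset (h : GraphPatch φ ι N W κ f) (hvW : tsupport v ⊆ W) :
    κ '' (tsupport v ∩ halfSpace m) ⊆ N := by
  rintro _ ⟨x, hx, rfl⟩
  exact h.inv_mem x ⟨hvW hx.1, hx.2⟩

theorem eventually_variation_eq [T2Space M] (h : GraphPatch φ ι N W κ f) (hv : HasCompactSupport v)
    (hvW : tsupport v ⊆ W) {p : M} (hp : p ∉ κ '' (tsupport v ∩ halfSpace m)) :
    variation φ ι N v t =ᶠ[𝓝 p] ι := by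
  filter_upwards [(isCompact_image_support h hv hvW).isClosed.isOpen_compl.mem_nhds hp] with q hq
  exact variation_of_notMem_image h hq

/-- The displaced piece is the graph of `f + t * v`. -/
theorem graphPatch_variation (h : GraphPatch φ ι N W κ f) (hρ : IsTube φ ι W f ρ)
    (ht : ∀ x, |t * v x| < ρ) (hv : ContDiff ℝ ∞ v) :
    GraphPatch φ (variation φ ι N v t) N W κ (fun x => f x + t * v x) where
  isOpen_N := h.isOpen_N
  isOpen_W := h.isOpen_W
  mem_source p hp := by
    rw [variation_of_mem h hp]
    exact ofCoord_mem_source (variation_mem_chartDom h hρ ht hp)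
  coordX_mem p hp := by rw [coordX_variation h hρ ht hp]; exact h.coordX_mem p hp
  inv_mem := h.inv_mem
  inv_smooth := h.inv_smooth
  coordX_inv x hx := by rw [coordX_variation h hρ ht (h.inv_mem x hx), h.coordX_inv x hx]
  inv_coordX p hp := by rw [coordX_variation h hρ ht hp, h.inv_coordX p hp]
  coordU_eq p hp := by
    rw [coordX_variation h hρ ht hp, variation_of_mem h hp,
      coordU_ofCoord (variation_mem_chartDom h hρ ht hp)]
  smooth := h.smooth.add (contDiff_const.mul hv).contDiffOn

theorem injective_variation (h : GraphPatch φ ι N W κ f) (hρ : IsTube φ ι W f ρ)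
    (ht : ∀ x, |t * v x| < ρ) (hι : Function.Injective ι) :
    Function.Injective (variation φ ι N v t) := by
  have key : ∀ p ∈ N, ∀ p', p' ∉ N → variation φ ι N v t p ≠ variation φ ι N v t p' := by
    intro p hp p' hp' he
    rw [variation_of_notMem hp', variation_of_mem h hp] at he
    have h1 := (hρ _ (h.mem_inter hp) _ (ht _)).2 ⟨p', he.symm⟩
    rw [h1, add_zero, ← h.coordU_eq p hp, ofCoord_coord (h.mem_source p hp)] at he
    exact hp' (hι he ▸ hp)
  intro p p' he
  by_cases hp : p ∈ N
  · by_cases hp' : p' ∈ N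
    · have h1 := congrArg (coordX φ) he
      rw [coordX_variation h hρ ht hp, coordX_variation h hρ ht hp'] at h1
      rw [← h.inv_coordX p hp, h1, h.inv_coordX p' hp']
    · exact absurd he (key p hp p' hp')
  · by_cases hp' : p' ∈ N
    · exact absurd he.symm (key p' hp' p hp)
    · rw [variation_of_notMem hp, variation_of_notMem hp'] at he
      exact hι he

/-- At points that are not displaced, the displaced and the original submanifold agree as sets: by
injectivity such a point is at a positive distance from the images of the displaced compact set. -/
theorem eventually_mem_range_variation_iff [T2Space Y] (h : GraphPatch φ ι N W κ f)
    (hρ : IsTube φ ι W f ρ) (ht : ∀ x, |t * v x| < ρ) (hv : HasCompactSupport v)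
    (hvW : tsupport v ⊆ W) (hι : Function.Injective ι) (hιc : Continuous ι)
    (hFc : Continuous (variation φ ι N v t)) {p : M}
    (hp : p ∉ κ '' (tsupport v ∩ halfSpace m)) :
    ∀ᶠ y in 𝓝 (ι p), y ∈ range (variation φ ι N v t) ↔ y ∈ range ι := by
  set K := κ '' (tsupport v ∩ halfSpace m) with hK
  have hKc : IsCompact K := isCompact_image_support h hv hvW
  have hFi := injective_variation (t := t) h hρ ht hι
  have hout : ∀ q ∉ K, variation φ ι N v t q = ι q := fun q hq => variation_of_notMem_image h hq
  have h1 : ι p ∉ ι '' K := fun ⟨q, hq, he⟩ => hp (hι he ▸ hq)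
  have h2 : ι p ∉ variation φ ι N v t '' K := fun ⟨q, hq, he⟩ => by
    rw [← hout p hp] at he
    exact hp (hFi he ▸ hq)
  filter_upwards [(hKc.image hιc).isClosed.isOpen_compl.mem_nhds h1,
    (hKc.image hFc).isClosed.isOpen_compl.mem_nhds h2] with y hy1 hy2
  constructor
  · rintro ⟨q, rfl⟩
    have hq : q ∉ K := fun hq => hy2 ⟨q, hq, rfl⟩
    exact ⟨q, (hout q hq).symm⟩
  · rintro ⟨q, rfl⟩
    have hq : q ∉ K := fun hq => hy1 ⟨q, hq, rfl⟩
    exact ⟨q, hout q hq⟩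

theorem mfderiv_coordX_variation (h : GraphPatch φ ι N W κ f) (hρ : IsTube φ ι W f ρ)
    (ht : ∀ x, |t * v x| < ρ) {p : M} (hp : p ∈ N) :
    mfderiv (𝓡∂ (m + 1)) 𝓘(ℝ, Fin (m + 1) → ℝ)
      (fun p => coordX φ (variation φ ι N v t p)) p =
    mfderiv (𝓡∂ (m + 1)) 𝓘(ℝ, Fin (m + 1) → ℝ) (fun p => coordX φ (ι p)) p := by
  refine Filter.EventuallyEq.mfderiv_eq ?_
  filter_upwards [h.isOpen_N.mem_nhds hp] with p' hp'
  exact coordX_variation h hρ ht hp'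

variable [ChartedSpace (EuclideanHalfSpace (m + 2)) Y]

/-- Near one of its points an embedded submanifold is the only piece of itself in a tube around the
graph; small vertical displacements therefore meet nothing else. -/
theorem exists_isTube (h : GraphPatch φ ι N W κ f)
    (hφ : φ ∈ IsManifold.maximalAtlas (𝓡∂ (m + 2)) ∞ Y) (hemb : IsEmbedding ι) {q : M}
    (hq : q ∈ N) : ∃ ε > 0, ∃ ρ > 0, ball (coordX φ (ι q)) ε ⊆ W ∧
      IsTube φ ι (ball (coordX φ (ι q)) ε) f ρ := by
  obtain ⟨O, hO, hON⟩ := hemb.isOpen_iff.1 h.isOpen_N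
  set x₀ := coordX φ (ι q) with hx₀
  have hx₀W : x₀ ∈ W ∩ halfSpace m := h.mem_inter hq
  have hdom := h.mem_chartDom hx₀W
  have hy : ofCoord φ x₀ (f x₀) = ι q := by
    rw [← h.coordU_eq q hq, ofCoord_coord (h.mem_source q hq)]
  have h1 : ContinuousWithinAt (fun z : (Fin (m + 1) → ℝ) × ℝ => ofCoord φ z.1 z.2)
      (halfSpace m ×ˢ univ) (x₀, f x₀) :=
    ((contMDiffOn_ofCoord hφ).continuousOn _ hdom).mono_of_mem_nhdsWithin
      (chartDom_mem_nhdsWithin hdom)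
  have h2 : ∀ᶠ z in 𝓝[halfSpace m ×ˢ univ] (x₀, f x₀),
      z ∈ chartDom φ ∧ ofCoord φ z.1 z.2 ∈ O := by
    refine Filter.Eventually.and (chartDom_mem_nhdsWithin hdom) (h1 (hO.mem_nhds ?_))
    change ofCoord φ x₀ (f x₀) ∈ O
    rw [hy]; rw [← hON] at hq; exact hq
  have hf : ContinuousWithinAt f (halfSpace m) x₀ :=
    (h.smooth.continuousOn _ hx₀W).mono_of_mem_nhdsWithin (by
      rw [inter_comm]; exact inter_mem_nhdsWithin _ (h.isOpen_W.mem_nhds hx₀W.1))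
  have h3 : Tendsto (fun z : (Fin (m + 1) → ℝ) × ℝ => (z.1, f z.1 + z.2))
      (𝓝[halfSpace m ×ˢ univ] (x₀, 0)) (𝓝[halfSpace m ×ˢ univ] (x₀, f x₀)) := by
    refine tendsto_nhdsWithin_iff.2 ⟨?_, ?_⟩
    · have h4 : Tendsto (fun z : (Fin (m + 1) → ℝ) × ℝ => z.1)
          (𝓝[halfSpace m ×ˢ univ] (x₀, 0)) (𝓝[halfSpace m] x₀) :=
        tendsto_nhdsWithin_iff.2 ⟨continuous_fst.continuousAt.continuousWithinAt, by
          filter_upwards [self_mem_nhdsWithin] with z hz using hz.1⟩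
      have h5 : Tendsto (fun z : (Fin (m + 1) → ℝ) × ℝ => z.2)
          (𝓝[halfSpace m ×ˢ univ] (x₀, 0)) (𝓝 0) :=
        continuous_snd.continuousAt.continuousWithinAt
      have h6 := (h4.mono_right nhdsWithin_le_nhds).prodMk_nhds ((hf.tendsto.comp h4).add h5)
      simpa using h6
    · filter_upwards [self_mem_nhdsWithin] with z hz using ⟨hz.1, mem_univ _⟩
  obtain ⟨ρ, hρ, hρ2⟩ := Metric.mem_nhdsWithin_iff.1 (h3.eventually h2)
  obtain ⟨ρ', hρ', hρW⟩ := Metric.isOpen_iff.1 h.isOpen_W x₀ hx₀W.1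
  refine ⟨min ρ ρ', lt_min hρ hρ', ρ, hρ, (ball_subset_ball (min_le_right _ _)).trans hρW,
    fun x hx τ hτ => ?_⟩
  have h7 : (x, τ) ∈ ball (x₀, (0 : ℝ)) ρ ∩ halfSpace m ×ˢ univ := by
    refine ⟨?_, hx.2, mem_univ _⟩
    rw [← ball_prod_same]
    exact ⟨ball_subset_ball (min_le_left _ _) hx.1, by simpa using hτ⟩
  have h8 := hρ2 h7
  refine ⟨h8.1, fun ⟨p, hp⟩ => ?_⟩
  have hpN : p ∈ N := by
    rw [← hON, mem_preimage, hp]; exact h8.2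
  have h9 := h.coordU_eq p hpN
  rw [hp, coordX_ofCoord h8.1, coordU_ofCoord h8.1] at h9
  linarith

theorem contMDiffOn_variation [T2Space M] (h : GraphPatch φ ι N W κ f)
    (hφ : φ ∈ IsManifold.maximalAtlas (𝓡∂ (m + 2)) ∞ Y)
    (hι : ContMDiff (𝓡∂ (m + 1)) (𝓡∂ (m + 2)) ∞ ι) (hρ : IsTube φ ι W f ρ)
    (hv : ContDiff ℝ ∞ v) (hvc : HasCompactSupport v) (hvW : tsupport v ⊆ W) {ε : ℝ}
    (hε : ∀ t ∈ Ioo (-ε) ε, ∀ x, |t * v x| < ρ) :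
    ContMDiffOn (𝓘(ℝ, ℝ).prod (𝓡∂ (m + 1))) (𝓡∂ (m + 2)) ∞
      (fun q : ℝ × M => variation φ ι N v q.1 q.2) (Ioo (-ε) ε ×ˢ univ) := by
  set K := κ '' (tsupport v ∩ halfSpace m) with hK
  have hKc : IsClosed K := (isCompact_image_support h hvc hvW).isClosed
  have hN : ContMDiffOn (𝓘(ℝ, ℝ).prod (𝓡∂ (m + 1))) (𝓡∂ (m + 2)) ∞
      (fun q : ℝ × M => variation φ ι N v q.1 q.2) (Ioo (-ε) ε ×ˢ N) := by
    have hX : ContMDiffOn (𝓘(ℝ, ℝ).prod (𝓡∂ (m + 1))) 𝓘(ℝ, Fin (m + 1) → ℝ) ∞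
        (fun q : ℝ × M => coordX φ (ι q.2)) (Ioo (-ε) ε ×ˢ N) :=
      (contMDiffOn_coordX hφ).comp (hι.comp contMDiff_snd).contMDiffOn
        fun q hq => h.mem_source _ hq.2
    have hU : ContMDiffOn (𝓘(ℝ, ℝ).prod (𝓡∂ (m + 1))) 𝓘(ℝ, ℝ) ∞
        (fun q : ℝ × M => coordU φ (ι q.2)) (Ioo (-ε) ε ×ˢ N) :=
      (contMDiffOn_coordU hφ).comp (hι.comp contMDiff_snd).contMDiffOn
        fun q hq => h.mem_source _ hq.2
    have hvX : ContMDiffOn (𝓘(ℝ, ℝ).prod (𝓡∂ (m + 1))) 𝓘(ℝ, ℝ) ∞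
        (fun q : ℝ × M => v (coordX φ (ι q.2))) (Ioo (-ε) ε ×ˢ N) :=
      hv.contMDiff.comp_contMDiffOn hX
    have ht : ContMDiffOn (𝓘(ℝ, ℝ).prod (𝓡∂ (m + 1))) 𝓘(ℝ, ℝ) ∞
        (fun q : ℝ × M => q.1) (Ioo (-ε) ε ×ˢ N) := contMDiff_fst.contMDiffOn
    have hpair := hX.prodMk_space (hU.add (ht.smul hvX))
    refine ((contMDiffOn_ofCoord hφ).comp hpair fun q hq => ?_).congr fun q hq => ?_
    · have h1 := variation_mem_chartDom h hρ (hε q.1 hq.1) hq.2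
      rw [← h.coordU_eq _ hq.2] at h1
      exact h1
    · rw [variation_of_mem h hq.2, ← h.coordU_eq _ hq.2]
      rfl
  intro q hq
  by_cases hqN : q.2 ∈ N
  · have h1 := hN q ⟨hq.1, hqN⟩
    refine h1.mono_of_mem_nhdsWithin ?_
    have h2 : (Prod.snd ⁻¹' N : Set (ℝ × M)) ∈ 𝓝 q :=
      (h.isOpen_N.preimage continuous_snd).mem_nhds hqN
    filter_upwards [mem_nhdsWithin_of_mem_nhds h2, self_mem_nhdsWithin] with q' h3 h4
    exact ⟨h4.1, h3⟩
  · have hqK : q.2 ∉ K := fun hc => hqN (image_support_subset h hvW hc)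
    have h1 : ContMDiffWithinAt (𝓘(ℝ, ℝ).prod (𝓡∂ (m + 1))) (𝓡∂ (m + 2)) ∞
      (fun q : ℝ × M => ι q.2) (Ioo (-ε) ε ×ˢ univ) q := (hι.comp contMDiff_snd).contMDiffAt
        |>.contMDiffWithinAt
    refine h1.congr_of_eventuallyEq ?_ (variation_of_notMem_image h hqK)
    have h2 : (Prod.snd ⁻¹' Kᶜ : Set (ℝ × M)) ∈ 𝓝 q :=
      (hKc.isOpen_compl.preimage continuous_snd).mem_nhds hqK
    filter_upwards [mem_nhdsWithin_of_mem_nhds h2] with q' h3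
    exact variation_of_notMem_image h h3

variable [IsManifold (𝓡∂ (m + 2)) ∞ Y]

/-- A displacement of a graph in the direction of the dependent variable is admissible: it keeps the
independent variables, hence injectivity of the differential, the boundary (`x 0 = 0`) and
transversality to `∂Y`. -/
theorem isAdmissible_variation [T2Space M] (h : GraphPatch φ ι N W κ f)
    (hφ : φ ∈ IsManifold.maximalAtlas (𝓡∂ (m + 2)) ∞ Y) (hadm : IsAdmissible (m := m) ι)
    (hinj : ∀ p ∈ N, Function.Injective
      (mfderiv (𝓡∂ (m + 1)) 𝓘(ℝ, Fin (m + 1) → ℝ) (fun p => coordX φ (ι p)) p))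
    (hρ : IsTube φ ι W f ρ) (hvc : HasCompactSupport v) (hvW : tsupport v ⊆ W)
    (ht : ∀ x, |t * v x| < ρ)
    (hs : ContMDiff (𝓡∂ (m + 1)) (𝓡∂ (m + 2)) ∞ (variation φ ι N v t)) :
    IsAdmissible (m := m) (variation φ ι N v t) := by
  have hFsrc : ∀ p ∈ N, variation φ ι N v t p ∈ φ.source := fun p hp => by
    rw [variation_of_mem h hp]
    exact ofCoord_mem_source (variation_mem_chartDom h hρ ht hp)
  have hout : ∀ p, p ∉ N → p ∉ κ '' (tsupport v ∩ halfSpace m) := fun p hp hc =>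
    hp (image_support_subset h hvW hc)
  have hchain : ∀ p ∈ N, ∀ ξ, mfderiv (𝓡∂ (m + 1)) 𝓘(ℝ, Fin (m + 1) → ℝ)
      (fun p => coordX φ (ι p)) p ξ = mfderiv (𝓡∂ (m + 2)) 𝓘(ℝ, Fin (m + 1) → ℝ) (coordX φ)
        (variation φ ι N v t p) (mfderiv (𝓡∂ (m + 1)) (𝓡∂ (m + 2)) (variation φ ι N v t) p ξ) := by
    intro p hp ξ
    have h1 := mfderiv_comp (I := 𝓡∂ (m + 1)) (I' := 𝓡∂ (m + 2))
      (I'' := 𝓘(ℝ, Fin (m + 1) → ℝ)) p (f := variation φ ι N v t) (g := coordX φ)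
      (((contMDiffOn_coordX hφ).contMDiffAt
        (φ.open_source.mem_nhds (hFsrc p hp))).mdifferentiableAt (by simp))
      ((hs.contMDiffAt (x := p)).mdifferentiableAt (by simp))
    rw [← mfderiv_coordX_variation h hρ ht hp]
    exact DFunLike.congr_fun h1 ξ
  refine ⟨hs, injective_variation h hρ ht hadm.injective, fun p => ?_, fun p => ?_, fun p hp => ?_⟩
  · by_cases hp : p ∈ N
    · intro ξ ξ' he
      refine hinj p hp ?_
      rw [hchain p hp, hchain p hp, he]
    · rw [(eventually_variation_eq h hvc hvW (hout p hp)).mfderiv_eq]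
      exact hadm.immersion p
  · by_cases hp : p ∈ N
    · rw [hadm.boundary, mem_boundary_iff_coordX hφ (h.mem_source p hp),
        mem_boundary_iff_coordX hφ (hFsrc p hp), coordX_variation h hρ ht hp]
    · rw [variation_of_notMem hp]; exact hadm.boundary p
  · by_cases hpN : p ∈ N
    · have hsurj := (injective_iff_surjective_euclidean
        (mfderiv (𝓡∂ (m + 1)) 𝓘(ℝ, Fin (m + 1) → ℝ) (fun p => coordX φ (ι p)) p)).1 (hinj p hpN)
      obtain ⟨ξ, hξ⟩ := hsurj (Pi.single 0 1)
      refine ⟨ξ, fun h0 => ?_⟩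
      have hb : coordX φ (variation φ ι N v t p) 0 = 0 := by
        rw [coordX_variation h hρ ht hpN, ← mem_boundary_iff_coordX hφ (h.mem_source p hpN)]
        exact (hadm.boundary p).1 hp
      have h1 := mfderiv_coordX_zero_eq_zero hφ (hFsrc p hpN) hb h0
      have h2 := congrFun ((hchain p hpN ξ).symm.trans hξ) 0
      rw [Pi.single_eq_same] at h2
      exact one_ne_zero (h2.symm.trans h1)
    · rw [(eventually_variation_eq h hvc hvW (hout p hpN)).mfderiv_eq]
      exact hadm.not_tangent p hp

end Variation

/-! ### The first variation of the action -/

section FirstVariation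

open Metric MeasureTheory

section Local

variable {m r : ℕ} {D : Set ((Fin (m + 1) → ℝ) × ℝ)} {W : Set (Fin (m + 1) → ℝ)}
  {𝓛 : JetSp m → ℝ} {f v : (Fin (m + 1) → ℝ) → ℝ}

theorem prolong_congr (hW : IsOpen W) {f g : (Fin (m + 1) → ℝ) → ℝ}
    (h : EqOn f g (W ∩ halfSpace m)) {x : Fin (m + 1) → ℝ} (hx : x ∈ W ∩ halfSpace m) :
    prolong f x = prolong g x :=
  Prod.ext rfl (funext fun I => multiIter_pdHalf_congr hW h I hx)

theorem prolong_add_mul_of_notMem_tsupport {x : Fin (m + 1) → ℝ} (hx : x ∈ halfSpace m)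
    (hxv : x ∉ tsupport v) (t : ℝ) :
    prolong (fun y => f y + t * v y) x = prolong f x :=
  prolong_congr (W := (tsupport v)ᶜ) (isClosed_tsupport v).isOpen_compl
    (fun y hy => by simp [image_eq_zero_of_notMem_tsupport hy.1]) ⟨hxv, hx⟩

theorem trunc_prolong_add_mul (hW : IsOpen W) (hf : ContDiffOn ℝ ∞ f (W ∩ halfSpace m))
    (hv : ContDiff ℝ ∞ v) (k : ℕ) (t : ℝ) {x : Fin (m + 1) → ℝ} (hx : x ∈ W ∩ halfSpace m) :
    trunc m k (prolong (fun y => f y + t * v y) x) =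
      trunc m k (prolong f x) + t • (0, (trunc m k (prolong v x)).2) := by
  refine Prod.ext (by simp [trunc, prolong]) (funext fun I => ?_)
  have h1 := multiIter_pdHalf_add hW hf (contDiff_const (c := t) |>.mul hv).contDiffOn I.1 hx
  rw [multiIter_pdHalf_const_mul] at h1
  simpa [trunc, prolong] using h1

/-- The first variation of `∫ 𝓛(x, f, ∂f)` in the direction `v` is the integral of the
linearization of `𝓛`, applied to `v`, along the jets of `f`. -/
theorem hasDerivAt_integral_prolong (hD : IsRelOpen D) (h𝓛 : SmoothOfOrder D r 𝓛) (hW : IsOpen W)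
    (hf : ContDiffOn ℝ ∞ f (W ∩ halfSpace m)) (hv : ContDiff ℝ ∞ v) {ε : ℝ} (hε : 0 < ε)
    (hfD : ∀ t ∈ Ioo (-ε) ε, ∀ x ∈ W ∩ halfSpace m, (x, f x + t * v x) ∈ D)
    {C : Set (Fin (m + 1) → ℝ)} (hC : IsCompact C) (hCW : C ⊆ W ∩ halfSpace m) :
    HasDerivAt (fun t => ∫ x in C, 𝓛 (prolong (fun y => f y + t * v y) x))
      (∫ x in C, linearization r 𝓛 (fun z => v z.1) (prolong f x)) 0 := by
  obtain ⟨g, hg, h𝓛g⟩ := smoothOfOrder_iff.1 h𝓛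
  set q : (Fin (m + 1) → ℝ) → _ := fun x => trunc m r (prolong f x) with hq
  set w : (Fin (m + 1) → ℝ) → (Fin (m + 1) → ℝ) × (midxLE (m + 1) r → ℝ) :=
    fun x => (0, (trunc m r (prolong v x)).2) with hw
  have hqc : ContinuousOn q (W ∩ halfSpace m) := (contDiffOn_trunc_prolong hW hf r).continuousOn
  have hwc : ContinuousOn w (W ∩ halfSpace m) := continuousOn_const.prodMk
    (continuous_snd.comp_continuousOn (contDiffOn_trunc_prolong hW hv.contDiffOn r).continuousOn)
  have hmem : ∀ t ∈ Ioo (-ε) ε, ∀ x ∈ W ∩ halfSpace m, q x + t • w x ∈ jetSet r D := by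
    intro t ht x hx
    rw [hq, hw, ← trunc_prolong_add_mul hW hf hv r t hx]
    exact trunc_mem (prolong_mem_jetDom (hfD t ht x hx))
  have hval : ∀ t ∈ Ioo (-ε) ε, ∀ x ∈ W ∩ halfSpace m,
      𝓛 (prolong (fun y => f y + t * v y) x) = g (q x + t • w x) := by
    intro t ht x hx
    rw [h𝓛g _ (prolong_mem_jetDom (hfD t ht x hx)), trunc_prolong_add_mul hW hf hv r t hx]
  have h0 : (0 : ℝ) ∈ Ioo (-ε) ε := ⟨by linarith, hε⟩
  have hnhds : Ioo (-ε) ε ∈ 𝓝 (0 : ℝ) := isOpen_Ioo.mem_nhds h0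
  have hlin : ∀ x ∈ W ∩ halfSpace m, linearization r 𝓛 (fun z => v z.1) (prolong f x) =
      fderivWithin ℝ g (jetSet r D) (q x) (w x) := by
    intro x hx
    have hfD0 : ∀ x ∈ W ∩ halfSpace m, (x, f x) ∈ D := fun x hx => by simpa using hfD 0 h0 x hx
    have hsum : w x = ∑ I : midxLE (m + 1) r, multiIter pdHalf I.1 v x •
        ((0 : Fin (m + 1) → ℝ), (Pi.single I 1 : midxLE (m + 1) r → ℝ)) := by
      refine Prod.ext ?_ ?_
      · simp [hw, Prod.fst_sum]
      · funext J
        simp [hw, trunc, prolong, Prod.snd_sum, Finset.sum_apply, Pi.single_apply]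
    rw [hsum, map_sum, linearization, ← Finset.sum_coe_sort]
    refine Finset.sum_congr rfl fun I _ => ?_
    rw [pdU_apply hD hg h𝓛g (prolong_mem_jetDom (hfD0 x hx)), dif_pos I.2, map_smul, smul_eq_mul,
      mul_comm]
    congr 1
    exact multiIter_totalD_prolong hD (jetSmooth_base hv) hW hf hfD0 I.1 hx
  set G' : ℝ → (Fin (m + 1) → ℝ) → ℝ := fun t x =>
    fderivWithin ℝ g (jetSet r D) (q x + t • w x) (w x) with hG'
  have hsub : Icc (-(ε / 2)) (ε / 2) ⊆ Ioo (-ε) ε := fun t ht =>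
    ⟨by linarith [ht.1], by linarith [ht.2]⟩
  have hmap : ContinuousOn (fun z : ℝ × (Fin (m + 1) → ℝ) => q z.2 + z.1 • w z.2)
      (Ioo (-ε) ε ×ˢ C) :=
    ((hqc.mono hCW).comp continuousOn_snd fun z hz => hz.2).add
      (continuousOn_fst.smul ((hwc.mono hCW).comp continuousOn_snd fun z hz => hz.2))
  have hmaps : MapsTo (fun z : ℝ × (Fin (m + 1) → ℝ) => q z.2 + z.1 • w z.2)
      (Ioo (-ε) ε ×ˢ C) (jetSet r D) := fun z hz => hmem _ hz.1 _ (hCW hz.2)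
  have hG'c : ContinuousOn (fun z : ℝ × (Fin (m + 1) → ℝ) => G' z.1 z.2) (Ioo (-ε) ε ×ˢ C) :=
    ((hg.continuousOn_fderivWithin (uniqueDiffOn_jetSet hD r) (by simp)).comp hmap hmaps).clm_apply
      ((hwc.mono hCW).comp continuousOn_snd fun z hz => hz.2)
  obtain ⟨B, hB⟩ := (isCompact_Icc.prod hC).exists_bound_of_continuousOn
    (hG'c.mono (prod_mono hsub subset_rfl))
  have hGc : ∀ t ∈ Ioo (-ε) ε, ContinuousOn (fun x => g (q x + t • w x)) C := fun t ht =>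
    hg.continuousOn.comp ((hqc.mono hCW).add ((hwc.mono hCW).const_smul t))
      fun x hx => hmem t ht x (hCW hx)
  have hder := (hasDerivAt_integral_of_dominated_loc_of_deriv_le (μ := volume.restrict C)
    (F := fun t x => g (q x + t • w x)) (F' := G') (x₀ := (0 : ℝ)) (bound := fun _ => B)
    (s := Ioo (-(ε / 2)) (ε / 2)) (isOpen_Ioo.mem_nhds ⟨by linarith, by linarith⟩)
    (by
      filter_upwards [hnhds] with t ht
      exact (hGc t ht).aestronglyMeasurable_of_isCompact hC hC.measurableSet)
    ((hGc 0 h0).integrableOn_compact hC)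
    (by
      refine ContinuousOn.aestronglyMeasurable_of_isCompact ?_ hC hC.measurableSet
      exact hG'c.comp (continuousOn_const.prodMk continuousOn_id) fun x hx => ⟨h0, hx⟩)
    (by
      filter_upwards [ae_restrict_mem hC.measurableSet] with x hx t ht
      exact hB (t, x) ⟨Ioo_subset_Icc_self ht, hx⟩)
    (by
      have : IsFiniteMeasure (volume.restrict C) := ⟨by
        rw [Measure.restrict_apply_univ]; exact hC.measure_lt_top⟩
      exact integrable_const B)
    (by
      filter_upwards [ae_restrict_mem hC.measurableSet] with x hx t ht
      have ht' := hsub (Ioo_subset_Icc_self ht)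
      have h1 : HasDerivAt (fun t : ℝ => q x + t • w x) (w x) t := by
        simpa using ((hasDerivAt_id t).smul_const (w x)).const_add (q x)
      have h2 := ((hg.differentiableOn (by simp) _
        (hmem t ht' x (hCW hx))).hasFDerivWithinAt).comp_curve (h1.hasDerivWithinAt (s := univ)) rfl
        (by
          rw [nhdsWithin_univ]
          filter_upwards [isOpen_Ioo.mem_nhds ht'] with s hs using hmem s hs x (hCW hx))
      exact hasDerivWithinAt_univ.1 h2)).2
  have h1 : ∫ x in C, linearization r 𝓛 (fun z => v z.1) (prolong f x) = ∫ x in C, G' 0 x :=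
    setIntegral_congr_fun hC.measurableSet fun x hx => by
      simp only [hG', zero_smul, add_zero]; exact hlin x (hCW hx)
  rw [h1]
  refine hder.congr_of_eventuallyEq ?_
  filter_upwards [hnhds] with t ht
  exact setIntegral_congr_fun hC.measurableSet fun x hx => hval t ht x (hCW hx)

end Local

theorem IsAdmissible.isEmbedding {m : ℕ} {Y : Type*} [TopologicalSpace Y] [T2Space Y]
    [ChartedSpace (EuclideanHalfSpace (m + 2)) Y] {M : Type*} [TopologicalSpace M] [CompactSpace M]
    [ChartedSpace (EuclideanHalfSpace (m + 1)) M] {ι : M → Y} (h : IsAdmissible (m := m) ι) :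
    IsEmbedding ι :=
  (h.smooth.continuous.isClosedEmbedding h.injective).isEmbedding

variable {m r : ℕ} {Y : Type*} [TopologicalSpace Y] [T2Space Y]
  [ChartedSpace (EuclideanHalfSpace (m + 2)) Y] [IsManifold (𝓡∂ (m + 2)) ∞ Y]
  {M : Type*} [TopologicalSpace M] [CompactSpace M]
  [ChartedSpace (EuclideanHalfSpace (m + 1)) M] [IsManifold (𝓡∂ (m + 1)) ∞ M]
  {φ : OpenPartialHomeomorph Y (EuclideanHalfSpace (m + 2))} {ι : M → Y} {N : Set M}
  {W : Set (Fin (m + 1) → ℝ)} {κ : (Fin (m + 1) → ℝ) → M} {f : (Fin (m + 1) → ℝ) → ℝ}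
  {ρ : ℝ} {v : (Fin (m + 1) → ℝ) → ℝ} {t : ℝ}

theorem IsAdmissible.exists_isGraphNear (h : IsAdmissible (m := m) ι) (p : M) :
    ∃ (ψ : OpenPartialHomeomorph Y (EuclideanHalfSpace (m + 2))) (g : (Fin (m + 1) → ℝ) → ℝ),
      IsGraphNear ψ g (range ι) (ι p) := by
  obtain ⟨ψ, hψ, hq, hinj⟩ := h.exists_chart p
  obtain ⟨N, W, κ, g, hP, hp⟩ := exists_graphPatch hψ h.smooth h.boundary hq hinj
  exact ⟨ψ, g, hP.isGraphNear hψ h.isEmbedding hp⟩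

/-- Pulled-back Lagrangians depend on the submanifold only locally. -/
theorem pullbackForm_congr (lam : Lagrangian m Y r) {ι' : M → Y} (h : IsAdmissible (m := m) ι)
    {p : M} (hι : ι' =ᶠ[𝓝 p] ι) (hrange : ∀ᶠ y in 𝓝 (ι p), y ∈ range ι' ↔ y ∈ range ι) :
    pullbackForm lam ι' p = pullbackForm lam ι p := by
  obtain ⟨ψ, g, hg⟩ := h.exists_isGraphNear p
  have he : ι' p = ι p := hι.self_of_nhds
  have hg' : IsGraphNear ψ g (range ι') (ι' p) := by
    rw [he]
    refine ⟨hg.1, hg.2.1, ⟨p, he⟩, hg.2.2.2.1, ?_⟩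
    filter_upwards [hrange, hg.2.2.2.2] with y h1 h2
    rw [h1, h2]
  have hd : mfderiv (𝓡∂ (m + 1)) 𝓘(ℝ, Fin (m + 1) → ℝ) (fun q => coordX ψ (ι' q)) p =
      mfderiv (𝓡∂ (m + 1)) 𝓘(ℝ, Fin (m + 1) → ℝ) (fun q => coordX ψ (ι q)) p :=
    Filter.EventuallyEq.mfderiv_eq (by filter_upwards [hι] with q hq; rw [hq])
  rw [pullbackForm_eq lam hg' (h.smooth.contMDiffAt.congr_of_eventuallyEq hι),
    pullbackForm_eq lam hg h.smooth.contMDiffAt, he]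
  exact congrArg (fun L : EuclideanSpace ℝ (Fin (m + 1)) →L[ℝ] (Fin (m + 1) → ℝ) =>
    lam.coeff ψ (prolong g (coordX ψ (ι p))) •
      (Matrix.detRowAlternating (R := ℝ) (n := Fin (m + 1))).compLinearMap L.toLinearMap) hd

variable [T2Space M]

/-- The change of the action under a displacement of a graph is the change of the integral of
the Lagrangian in coordinates, up to the orientation sign of the coordinates. -/
theorem GraphPatch.exists_action_variation_sub_eq (lam : Lagrangian m Y r) (o : OrientForm m M)
    (h : GraphPatch φ ι N W κ f) (hφ : φ ∈ IsManifold.maximalAtlas (𝓡∂ (m + 2)) ∞ Y)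
    (hadm : IsAdmissible (m := m) ι)
    (hinj : ∀ p ∈ N, Function.Injective
      (mfderiv (𝓡∂ (m + 1)) 𝓘(ℝ, Fin (m + 1) → ℝ) (fun p => coordX φ (ι p)) p))
    (hρ : IsTube φ ι W f ρ) (hconn : IsPreconnected (W ∩ halfSpace m))
    (hne : (W ∩ halfSpace m).Nonempty) :
    ∃ σ : ℝ, σ ≠ 0 ∧ ∀ (C : Set (Fin (m + 1) → ℝ)) (v : (Fin (m + 1) → ℝ) → ℝ) (t : ℝ),
      IsCompact C → C ⊆ W ∩ halfSpace m → ContDiff ℝ ∞ v → HasCompactSupport v →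
      tsupport v ⊆ W → tsupport v ∩ halfSpace m ⊆ C → (∀ x, |t * v x| < ρ) →
      IsAdmissible (m := m) (variation φ ι N v t) →
      action lam o (variation φ ι N v t) - action lam o ι =
        σ * ∫ x in C, (lam.coeff φ (prolong (fun y => f y + t * v y) x) -
          lam.coeff φ (prolong f x)) := by
  obtain ⟨σ, hσ, hint⟩ := h.exists_formIntegral_eq hφ hadm.smooth hinj hconn hne o
  refine ⟨σ, hσ, fun C v t hC hCW hv hvc hvW hvC ht hadm' => ?_⟩
  have h' := graphPatch_variation h hρ ht hv
  have hsmooth : JetSmooth (chartDom φ) (lam.coeff φ) := ⟨r, lam.smooth φ hφ⟩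
  rw [action, action, formIntegral_sub o
    (continuousOn_formCoeff_pullback lam hadm' hadm'.isEmbedding)
    (continuousOn_formCoeff_pullback lam hadm hadm.isEmbedding)]
  refine hint _ (fun x => lam.coeff φ (prolong (fun y => f y + t * v y) x) -
    lam.coeff φ (prolong f x)) C hC hCW ?_ (fun x hx hxC => ?_) (fun p hp => ?_) fun p hp => ?_
  · exact ((hsmooth.comp_prolong h'.isOpen_W h'.smooth fun x hx =>
      h'.mem_chartDom hx).continuousOn.sub (hsmooth.comp_prolong h.isOpen_W h.smooth fun x hx =>
      h.mem_chartDom hx).continuousOn).mono hCW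
  · rw [prolong_add_mul_of_notMem_tsupport hx.2 (fun hc => hxC (hvC ⟨hc, hx.2⟩)), sub_self]
  · have key : ∀ (A B : EuclideanSpace ℝ (Fin (m + 1)) →L[ℝ] (Fin (m + 1) → ℝ)) (x y), A = B →
        x = y → lam.coeff φ (prolong (fun y => f y + t * v y) x) •
          (Matrix.detRowAlternating (R := ℝ) (n := Fin (m + 1))).compLinearMap A.toLinearMap =
        lam.coeff φ (prolong (fun y => f y + t * v y) y) •
          (Matrix.detRowAlternating (R := ℝ) (n := Fin (m + 1))).compLinearMap B.toLinearMap :=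
      fun A B x y hAB hxy => by rw [hAB, hxy]
    have e1 := (pullbackForm_eq lam (h'.isGraphNear hφ hadm'.isEmbedding hp)
      hadm'.smooth.contMDiffAt).trans (key _ _ _ _ (mfderiv_coordX_variation h hρ ht hp)
        (coordX_variation h hρ ht hp))
    have e2 := pullbackForm_eq lam (h.isGraphNear hφ hadm.isEmbedding hp) hadm.smooth.contMDiffAt
    exact (congrArg₂ (· - ·) e1 e2).trans (sub_smul _ _ _).symm
  · have hpK : p ∉ κ '' (tsupport v ∩ halfSpace m) := fun hc => hp (image_support_subset h hvW hc)
    have h1 := pullbackForm_congr lam hadm (eventually_variation_eq h hvc hvW hpK)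
      (eventually_mem_range_variation_iff h hρ ht hvc hvW hadm.injective hadm.smooth.continuous
        hadm'.smooth.continuous hpK)
    rw [sub_eq_zero]
    exact h1

end FirstVariation

/-! ### Natural boundary conditions -/

section NaturalBoundary

open Metric MeasureTheory

theorem IsRelEuler.boundary_unique {m r : ℕ} {D : Set ((Fin (m + 1) → ℝ) × ℝ)} (hD : IsRelOpen D)
    {𝓛 E₁ E₂ : JetSp m → ℝ} {η₁ η₂ : NormalJet m → NormalJetTangent m [⋀^Fin (m + 1)]→ₗ[ℝ] ℝ}
    (h₁ : IsRelEuler D r 𝓛 E₁ η₁) (h₂ : IsRelEuler D r 𝓛 E₂ η₂) {w : NormalJet m}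
    (hw : ofNormalJet w ∈ jetDom D) : η₁ w = η₂ w := by
  obtain ⟨hE₁, k₁, b₁, hb₁, hc₁, he₁⟩ := h₁
  obtain ⟨hE₂, k₂, b₂, hb₂, hc₂, he₂⟩ := h₂
  have key : ∀ k ≤ max k₁ k₂, ∀ b : ℕ → JetSp m → ℝ,
      ∑ α ∈ Finset.range k, b α (ofNormalJet w) • contactTop α w =
        ∑ α ∈ Finset.range (max k₁ k₂),
          (if α < k then b α (ofNormalJet w) else 0) • contactTop α w := by
    intro k hk b
    rw [← Finset.sum_subset (Finset.range_subset_range.2 hk) fun α _ hα => by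
      rw [if_neg (by simpa using hα), zero_smul]]
    exact Finset.sum_congr rfl fun α hα => by rw [if_pos (Finset.mem_range.1 hα)]
  rw [he₁ w hw, he₂ w hw, key k₁ (le_max_left _ _), key k₂ (le_max_right _ _)]
  refine Finset.sum_congr rfl fun α _ => ?_
  rw [hc₁.boundary_unique hD hE₁ hb₁ hE₂ hb₂ hc₂ hw rfl α]

variable {m r : ℕ} {Y : Type*} [TopologicalSpace Y]
  [ChartedSpace (EuclideanHalfSpace (m + 2)) Y]
  {M : Type*} [TopologicalSpace M] [ChartedSpace (EuclideanHalfSpace (m + 1)) M]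
  {φ : OpenPartialHomeomorph Y (EuclideanHalfSpace (m + 2))} {ι : M → Y} {N : Set M}
  {W : Set (Fin (m + 1) → ℝ)} {κ : (Fin (m + 1) → ℝ) → M} {f : (Fin (m + 1) → ℝ) → ℝ}

theorem IsGraphNear.exists_isOpen {L : Set Y} {y : Y} (h : IsGraphNear φ f L y) :
    ∃ W, IsOpen W ∧ coordX φ y ∈ W ∧ ContDiffOn ℝ ∞ f (W ∩ halfSpace m) ∧
      ∀ x ∈ W ∩ halfSpace m, (x, f x) ∈ chartDom φ := by
  obtain ⟨W₁, hW₁, hf⟩ := h.2.2.2.1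
  have hx := coordX_mem_halfSpace φ y
  have hdom : (coordX φ y, f (coordX φ y)) ∈ chartDom φ := by
    rw [← h.coordU_eq]; exact coord_mem_chartDom h.2.1
  have h1 : Tendsto (fun x => (x, f x)) (𝓝[halfSpace m] coordX φ y)
      (𝓝[halfSpace m ×ˢ univ] (coordX φ y, f (coordX φ y))) :=
    tendsto_nhdsWithin_iff.2 ⟨(continuousWithinAt_id.prodMk h.contDiffWithinAt.continuousWithinAt),
      by filter_upwards [self_mem_nhdsWithin] with x hx using ⟨hx, mem_univ _⟩⟩
  obtain ⟨W₂, hW₂, hxW₂, hsub⟩ := mem_nhdsWithin.1 (h1 (chartDom_mem_nhdsWithin hdom))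
  exact ⟨interior W₁ ∩ W₂, isOpen_interior.inter hW₂, ⟨mem_interior_iff_mem_nhds.2 hW₁, hxW₂⟩,
    hf.mono fun x hx => ⟨interior_subset hx.1.1, hx.2⟩, fun x hx => hsub ⟨hx.1.2, hx.2⟩⟩

/-- Two functions that have the same submanifold as a graph near a point have the same jets
there. -/
theorem GraphPatch.prolong_eq (h : GraphPatch φ ι N W κ f) (hι : Continuous ι)
    {g : (Fin (m + 1) → ℝ) → ℝ} {p : M} (hp : p ∈ N) (hg : IsGraphNear φ g (range ι) (ι p)) :
    prolong f (coordX φ (ι p)) = prolong g (coordX φ (ι p)) := by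
  have hx := h.mem_inter hp
  have h1 : ContinuousWithinAt (fun x => ι (κ x)) (W ∩ halfSpace m) (coordX φ (ι p)) :=
    hι.continuousAt.comp_continuousWithinAt (h.inv_smooth.continuousOn _ hx)
  have h2 : ∀ᶠ x in 𝓝[W ∩ halfSpace m] coordX φ (ι p), f x = g x := by
    have h3 := h1.eventually (p := fun y => y ∈ range ι ↔ coordU φ y = g (coordX φ y))
      (by
        change ∀ᶠ y in 𝓝 (ι (κ (coordX φ (ι p)))), _
        rw [h.inv_coordX p hp]
        exact hg.2.2.2.2)
    filter_upwards [h3, self_mem_nhdsWithin] with x h4 hxW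
    have h5 := h4.1 ⟨κ x, rfl⟩
    rwa [h.coordU_eq _ (h.inv_mem x hxW), h.coordX_inv x hxW] at h5
  obtain ⟨V, hV, hxV, hsub⟩ := mem_nhdsWithin.1 h2
  exact prolong_congr (hV.inter h.isOpen_W) (fun x hx => hsub ⟨hx.1.1, hx.1.2, hx.2⟩)
    ⟨⟨hxV, hx.1⟩, hx.2⟩

variable [T2Space Y] [IsManifold (𝓡∂ (m + 2)) ∞ Y] [T2Space M] [CompactSpace M]
  [IsManifold (𝓡∂ (m + 1)) ∞ M]

/-- At a solution, the linearization of the Lagrangian, applied to test functions, integrates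
to zero. -/
theorem GraphPatch.integral_linearization_eq_zero {lam : Lagrangian m Y r} {o : OrientForm m M}
    (hsol : IsSolution lam o ι) (h : GraphPatch φ ι N W κ f)
    (hφ : φ ∈ IsManifold.maximalAtlas (𝓡∂ (m + 2)) ∞ Y) {ρ : ℝ} (hρ0 : 0 < ρ)
    (hρ : IsTube φ ι W f ρ) (hconn : IsPreconnected (W ∩ halfSpace m))
    {C : Set (Fin (m + 1) → ℝ)} (hC : IsCompact C) (hCW : C ⊆ W ∩ halfSpace m) (hne : C.Nonempty)
    {v : (Fin (m + 1) → ℝ) → ℝ} (hv : ContDiff ℝ ∞ v) (hvc : HasCompactSupport v)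
    (hvW : tsupport v ⊆ W) (hvC : tsupport v ∩ halfSpace m ⊆ C) :
    ∫ x in C, linearization r (lam.coeff φ) (fun z => v z.1) (prolong f x) = 0 := by
  obtain ⟨hadm, hstat⟩ := hsol
  have hinj : ∀ p ∈ N, Function.Injective
      (mfderiv (𝓡∂ (m + 1)) 𝓘(ℝ, Fin (m + 1) → ℝ) (fun p => coordX φ (ι p)) p) := fun p hp =>
    (h.isGraphNear hφ hadm.isEmbedding hp).injective_mfderiv hadm.smooth.contMDiffAt
      (hadm.immersion p)
  obtain ⟨σ, hσ, hact⟩ := h.exists_action_variation_sub_eq lam o hφ hadm hinj hρ hconn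
    (hne.mono hCW)
  obtain ⟨B, hB⟩ := hvc.exists_bound_of_continuous hv.continuous
  have hB0 : 0 ≤ B := (norm_nonneg _).trans (hB 0)
  -- `|t| < ρ / (B + 1)` keeps the displacement `t * v` below `ρ`; `B` itself may be zero
  set ε := ρ / (B + 1) with hε
  have hε0 : 0 < ε := by positivity
  have hεv : ∀ t ∈ Ioo (-ε) ε, ∀ x, |t * v x| < ρ := fun t ht x => by
    have h1 : |t| < ε := abs_lt.2 ht
    calc |t * v x| = |t| * |v x| := abs_mul _ _
      _ ≤ |t| * (B + 1) := mul_le_mul_of_nonneg_left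
          (((Real.norm_eq_abs _).symm.le.trans (hB x)).trans (by linarith)) (abs_nonneg _)
      _ < ε * (B + 1) := mul_lt_mul_of_pos_right h1 (by linarith)
      _ = ρ := div_mul_cancel₀ _ (by linarith)
  have hsm := contMDiffOn_variation h hφ hadm.smooth hρ hv hvc hvW hεv
  have hadmt : ∀ t ∈ Ioo (-ε) ε, IsAdmissible (m := m) (variation φ ι N v t) := fun t ht =>
    isAdmissible_variation h hφ hadm hinj hρ hvc hvW (hεv t ht)
      (contMDiffOn_univ.1 (hsm.comp (contMDiff_const.prodMk contMDiff_id).contMDiffOn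
        fun p _ => ⟨ht, mem_univ _⟩))
  have h0 : variation φ ι N v 0 = ι := by
    funext p
    by_cases hp : p ∈ N
    · rw [variation, if_pos hp, zero_mul, add_zero, ofCoord_coord (h.mem_source p hp)]
    · exact variation_of_notMem hp
  have hd0 := hstat ε (variation φ ι N v) hε0 h0 hsm hadmt
  have hsmooth : JetSmooth (chartDom φ) (lam.coeff φ) := ⟨r, lam.smooth φ hφ⟩
  have hfD : ∀ t ∈ Ioo (-ε) ε, ∀ x ∈ W ∩ halfSpace m, (x, f x + t * v x) ∈ chartDom φ :=
    fun t ht x hx => (hρ x hx _ (hεv t ht x)).1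
  have hd1 := hasDerivAt_integral_prolong (isRelOpen_chartDom φ) (lam.smooth φ hφ) h.isOpen_W
    h.smooth hv hε0 hfD hC hCW
  have hd2 := ((hd1.sub_const (∫ x in C, lam.coeff φ (prolong f x))).const_mul σ).const_add
    (action lam o ι)
  have heq : (fun t => action lam o (variation φ ι N v t)) =ᶠ[𝓝 0] fun t => action lam o ι +
      σ * ((∫ x in C, lam.coeff φ (prolong (fun y => f y + t * v y) x)) -
        ∫ x in C, lam.coeff φ (prolong f x)) := by
    filter_upwards [isOpen_Ioo.mem_nhds (show (0 : ℝ) ∈ Ioo (-ε) ε from ⟨by linarith, hε0⟩)]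
      with t ht
    have h1 := hact C v t hC hCW hv hvc hvW hvC (hεv t ht) (hadmt t ht)
    rw [integral_sub] at h1
    · linarith
    · have h2 : ContDiffOn ℝ ∞ (fun x => f x + t * v x) (W ∩ halfSpace m) :=
        h.smooth.add (contDiff_const.mul hv).contDiffOn
      exact ((hsmooth.comp_prolong h.isOpen_W h2 (hfD t ht)).continuousOn.mono
        hCW).integrableOn_compact hC
    · exact ((hsmooth.comp_prolong h.isOpen_W h.smooth fun x hx =>
        h.mem_chartDom hx).continuousOn.mono hCW).integrableOn_compact hC
  have h3 := (hd2.congr_of_eventuallyEq heq).unique hd0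
  exact (mul_eq_zero.1 h3).resolve_left hσ

/-- The natural boundary conditions: the boundary component of the relative Euler class vanishes
along the boundary of a solution. -/
theorem IsSolution.boundary_eq_zero {lam : Lagrangian m Y r} {o : OrientForm m M}
    (hsol : IsSolution lam o ι) {E : JetSp m → ℝ}
    {η : NormalJet m → NormalJetTangent m [⋀^Fin (m + 1)]→ₗ[ℝ] ℝ}
    (hη : IsRelEuler (chartDom φ) r (lam.coeff φ) E η) {p : M} (hp : p ∈ (𝓡∂ (m + 1)).boundary M)
    (hg : IsGraphNear φ f (range ι) (ι p)) :
    η (boundaryJet f (Fin.tail (coordX φ (ι p)))) = 0 := by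
  have hadm := hsol.1
  have hφ := hg.1
  obtain ⟨W₀, hW₀, hxW₀, hf, hfD⟩ := hg.exists_isOpen
  have hx0 : coordX φ (ι p) 0 = 0 := (mem_boundary_iff_coordX hφ hg.2.1).1 ((hadm.boundary p).1 hp)
  have hjet : ofNormalJet (boundaryJet f (Fin.tail (coordX φ (ι p)))) =
      prolong f (coordX φ (ι p)) := by
    rw [ofNormalJet_boundaryJet hW₀ hf (by rwa [cons_zero_tail hx0]), cons_zero_tail hx0]
  obtain ⟨N, W, κ, g, hP, hpN⟩ := exists_graphPatch hφ hadm.smooth hadm.boundary hg.2.1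
    (hg.injective_mfderiv hadm.smooth.contMDiffAt (hadm.immersion p))
  obtain ⟨ε, hε, ρ, hρ0, hball, hρ⟩ := exists_isTube hP hφ hadm.isEmbedding hpN
  set x₀ := coordX φ (ι p) with hx₀
  have hP' := hP.restrict hφ hadm.smooth.continuous isOpen_ball hball
  have hpN' : p ∈ N ∩ (fun p => coordX φ (ι p)) ⁻¹' ball x₀ ε := ⟨hpN, mem_ball_self hε⟩
  have hcb : closedBall x₀ (ε / 2) ⊆ ball x₀ ε := closedBall_subset_ball (by linarith)
  obtain ⟨hE, k, b, hb, hclass, hη'⟩ := hη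
  rw [hη' _ (by rw [hjet]; exact prolong_mem_jetDom (hfD _ ⟨hxW₀, coordX_mem_halfSpace φ _⟩))]
  refine Finset.sum_eq_zero fun α hα => ?_
  rw [hjet, ← hP'.prolong_eq hadm.smooth.continuous hpN' hg,
    hclass.eq_zero_of_stationary (isRelOpen_chartDom φ) hE hb isOpen_ball hP'.smooth
      (fun x hx => hP'.mem_chartDom hx) hx0 (half_pos hε) hcb (fun v hv hvs => ?_)
      (Finset.mem_range.1 hα), zero_smul]
  have hvs' : tsupport v ⊆ closedBall x₀ (ε / 2) := hvs.trans ball_subset_closedBall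
  exact hP'.integral_linearization_eq_zero hsol hφ hρ0 hρ
    ((convex_ball x₀ ε).inter convex_halfSpace).isPreconnected (isCompact_halfCube x₀ (ε / 2))
    (inter_subset_inter_left _ hcb)
    ⟨x₀, mem_closedBall_self (half_pos hε).le, coordX_mem_halfSpace φ _⟩ hv
    (HasCompactSupport.of_support_subset_isCompact (isCompact_closedBall x₀ (ε / 2))
      ((subset_tsupport v).trans hvs'))
    (hvs'.trans hcb) (inter_subset_inter_left _ hvs')

end NaturalBoundary

end FreeBoundary

end

theorem mainTheorem3 {m r : ℕ}
    {Y : Type*} [TopologicalSpace Y] [T2Space Y] [SecondCountableTopology Y]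
    [ChartedSpace (EuclideanHalfSpace (m + 2)) Y] [IsManifold (𝓡∂ (m + 2)) ∞ Y]
    {M : Type*} [TopologicalSpace M] [T2Space M] [CompactSpace M] [ConnectedSpace M]
    [ChartedSpace (EuclideanHalfSpace (m + 1)) M] [IsManifold (𝓡∂ (m + 1)) ∞ M]
    (lam : FreeBoundary.Lagrangian m Y r) (o : FreeBoundary.OrientForm m M) (ι : M → Y)
    (hsol : FreeBoundary.IsSolution lam o ι) :
    ∀ φ ∈ IsManifold.maximalAtlas (𝓡∂ (m + 2)) ∞ Y,
      -- the relative Euler class has a boundary component, and only one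
      (∃ E η, FreeBoundary.IsRelEuler (FreeBoundary.chartDom φ) r (lam.coeff φ) E η) ∧
      (∀ E₁ η₁ E₂ η₂,
        FreeBoundary.IsRelEuler (FreeBoundary.chartDom φ) r (lam.coeff φ) E₁ η₁ →
        FreeBoundary.IsRelEuler (FreeBoundary.chartDom φ) r (lam.coeff φ) E₂ η₂ →
        ∀ w, FreeBoundary.ofNormalJet w ∈ FreeBoundary.jetDom (FreeBoundary.chartDom φ) →
          η₁ w = η₂ w) ∧
      ∀ E η, FreeBoundary.IsRelEuler (FreeBoundary.chartDom φ) r (lam.coeff φ) E η →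
        -- it vanishes along the boundary of the solution
        (∀ p ∈ (𝓡∂ (m + 1)).boundary M, ∀ f,
          FreeBoundary.IsGraphNear φ f (Set.range ι) (ι p) →
          η (FreeBoundary.boundaryJet f (Fin.tail (FreeBoundary.coordX φ (ι p)))) = 0) ∧
        -- its expression in the contact forms, and the formula for its components
        ∃ e : ℕ → FreeBoundary.NormalJet m → ℝ,
          (∀ w, FreeBoundary.ofNormalJet w ∈ FreeBoundary.jetDom (FreeBoundary.chartDom φ) →
            η w = ∑ α ∈ Finset.range r, e α w • FreeBoundary.contactTop α w) ∧
          ∀ p ∈ (𝓡∂ (m + 1)).boundary M, ∀ f,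
            FreeBoundary.IsGraphNear φ f (Set.range ι) (ι p) → ∀ α < r,
            e α (FreeBoundary.boundaryJet f (Fin.tail (FreeBoundary.coordX φ (ι p)))) =
              FreeBoundary.boundaryExpr r α (lam.coeff φ) f
                (Fin.tail (FreeBoundary.coordX φ (ι p))) := by
  intro φ hφ
  have hD := FreeBoundary.isRelOpen_chartDom φ
  have hsm : FreeBoundary.JetSmooth (FreeBoundary.chartDom φ) (lam.coeff φ) :=
    ⟨r, lam.smooth φ hφ⟩
  have hex := FreeBoundary.exists_isRelEuler hD hsm r
  refine ⟨⟨_, _, hex⟩, fun E₁ η₁ E₂ η₂ h₁ h₂ w hw => h₁.boundary_unique hD h₂ hw,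
    fun E η hη => ⟨fun p hp f hf => hsol.boundary_eq_zero hη hp hf,
      fun α w => FreeBoundary.bdryCoeff r (lam.coeff φ) α (FreeBoundary.ofNormalJet w),
      fun w hw => hη.boundary_unique hD hex hw, fun p hp f hf α _ => ?_⟩⟩
  obtain ⟨W, hW, hxW, hfs, hfD⟩ := hf.exists_isOpen
  have hx0 : FreeBoundary.coordX φ (ι p) 0 = 0 :=
    (FreeBoundary.mem_boundary_iff_coordX hφ hf.2.1).1 ((hsol.1.boundary p).1 hp)
  have hxW' : (Fin.cons 0 (Fin.tail (FreeBoundary.coordX φ (ι p))) : Fin (m + 1) → ℝ) ∈ W := by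
    rwa [FreeBoundary.cons_zero_tail hx0]
  change FreeBoundary.bdryCoeff r (lam.coeff φ) α (FreeBoundary.ofNormalJet _) = _
  rw [FreeBoundary.ofNormalJet_boundaryJet hW hfs hxW',
    FreeBoundary.bdryCoeff_prolong hD hsm hW hfs hfD r α hxW']
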